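/- Let $P=(p_1,\dots,p_n)$ be $n\ge 0$ points in the plane $\mathbb{R}^2$ with real (possibly negative) weights $w(p_1),\dots,w(p_n)$, let $Q=\{q_1,\dots,q_m\}$ be $m\ge 1$ points in the plane, and let $k\ge 1$ be an integer. No general position is assumed, and the points are given in arbitrary order. For a point $q$ put $\mathrm{dom}(q)=(-\infty,x(q)]\times(-\infty,y(q)]$, for $Q'\subseteq Q$ put $\mathrm{dom}(Q')=\bigcup_{q\in Q'}\mathrm{dom}(q)$, and for a region $R$ let $w(R)$ be the sum of the weights of the points of $P$ that lie in $R$. The maxDominance problem asks for the value $$\max\{\,w(\mathrm{dom}(Q')) : Q'\subseteq Q,\ |Q'|\le k\,\}$$ and for a subset $Q'\subseteq Q$ with $|Q'|\le k$ that attains it. The maxDominance problem can be solved in $O\bigl(k\cdot\min\{n+m,\ \tfrac{n}{k}+m^2\}\cdot\log m\bigr)$ time and $O(n+m)$ space, where $\log m$ is read as $\log 2$ when $m=1$. That is, there are a single program for the real RAM (unit-cost exact addition, subtraction and comparison of real numbers; unit-cost arithmetic and indirect addressing with words of $O(\log(n+m+k))$ bits) and a constant $C$ such that for all $n\ge 0$,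 $m\ge 1$, $k\ge 1$ and all inputs $(P,w,Q,k)$ of these sizes the program halts with the optimal value and an optimal subset after at most $C\cdot k\cdot\min\{n+m,\ \tfrac nk+m^2\}\cdot\log(\max\{m,2\})$ steps, and it uses at most $C\,(n+m)$ memory cells (registers and array cells, input included). -/

import Mathlib

noncomputable section

/-! ### The maxDominance problem -/

namespace MaxDominance

/-- The closed quadrant `(-∞, x(q)] × (-∞, y(q)]`. -/
def dom (q : ℝ × ℝ) : Set (ℝ × ℝ) := Set.Iic q.1 ×ˢ Set.Iic q.2

/-- The union of the regions `dom q` over the points `q` of a set. -/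
def domUnion (A : Set (ℝ × ℝ)) : Set (ℝ × ℝ) := ⋃ q ∈ A, dom q

open Classical in
/-- The weight of a region: the sum of the weights of the points of `P` that lie in it. -/
def weight {n : ℕ} (p : Fin n → ℝ × ℝ) (w : Fin n → ℝ) (R : Set (ℝ × ℝ)) : ℝ :=
  ∑ i with p i ∈ R, w i

/-- The values `w(dom(Q'))` of the feasible solutions: `Q'` consists of at most `k` points of `Q`. -/
def values {n m : ℕ} (p : Fin n → ℝ × ℝ) (w : Fin n → ℝ) (q : Fin m → ℝ × ℝ) (k : ℕ) : Set ℝ :=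
  {v | ∃ S : Finset (Fin m), S.card ≤ k ∧ v = weight p w (domUnion (q '' S))}

end MaxDominance

/-! ### The machine: a real RAM

The memory consists of word registers, real registers, word arrays and real arrays. Registers and
arrays are named by literals in the program, so that a program uses finitely many of them; array
cells are addressed through word registers. The machine has two parameters: every word is smaller
than `W`, and every array has length `s`. An instruction that would produce a larger word or access
an array outside its bounds has no successor state.

Reals can be added, subtracted and compared exactly, and nothing else; in particular there is no
rounding and no conversion of reals into words. -/

namespace RealRAM

/-- The contents of the memory. -/
structure State where
  /-- word registers -/
  word : ℕ → ℕ
  /-- real registers -/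
  real : ℕ → ℝ
  /-- word arrays: `warr A j` is cell `j` of array `A` -/
  warr : ℕ → ℕ → ℕ
  /-- real arrays: `rarr A j` is cell `j` of array `A` -/
  rarr : ℕ → ℕ → ℝ

/-- Arithmetic on words; subtraction is truncated, division rounds down. -/
inductive WordOp
  | add | sub | mul | div

/-- The result of a word operation. -/
def WordOp.eval : WordOp → ℕ → ℕ → ℕ
  | .add, x, y => x + y
  | .sub, x, y => x - y
  | .mul, x, y => x * y
  | .div, x, y => x / y

/-- Arithmetic on reals. -/
inductive RealOp
  | add | sub

/-- The result of a real operation. -/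
def RealOp.eval : RealOp → ℝ → ℝ → ℝ
  | .add, x, y => x + y
  | .sub, x, y => x - y

/-- The instructions. The first argument of `wload`, `wstore`, `rload`, `rstore` is the register
that is filled or stored, the second one the array, the third one the word register that holds the
index of the cell. -/
inductive Instr
  | wconst (r c : ℕ)
  | wmove (r a : ℕ)
  | wop (o : WordOp) (r a b : ℕ)
  | wload (r A i : ℕ)
  | wstore (r A i : ℕ)
  | rconst (r : ℕ) (c : ℤ)
  | rmove (r a : ℕ)
  | rop (o : RealOp) (r a b : ℕ)
  | rload (r A i : ℕ)
  | rstore (r A i : ℕ)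

/-- Write a word register. -/
def State.setWord (σ : State) (r v : ℕ) : State :=
  { σ with word := Function.update σ.word r v }

/-- Write a real register. -/
def State.setReal (σ : State) (r : ℕ) (v : ℝ) : State :=
  { σ with real := Function.update σ.real r v }

/-- Write a cell of a word array. -/
def State.setWarr (σ : State) (A j v : ℕ) : State :=
  { σ with warr := Function.update σ.warr A (Function.update (σ.warr A) j v) }

/-- Write a cell of a real array. -/
def State.setRarr (σ : State) (A j : ℕ) (v : ℝ) : State :=
  { σ with rarr := Function.update σ.rarr A (Function.update (σ.rarr A) j v) }

/-- The effect of an instruction on the machine with words `< W` and arrays of length `s`. -/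
def Instr.step (W s : ℕ) : Instr → State → Option State
  | .wconst r c, σ => if c < W then some (σ.setWord r c) else none
  | .wmove r a, σ => if σ.word a < W then some (σ.setWord r (σ.word a)) else none
  | .wop o r a b, σ =>
      if o.eval (σ.word a) (σ.word b) < W then
        some (σ.setWord r (o.eval (σ.word a) (σ.word b))) else none
  | .wload r A i, σ =>
      if σ.word i < s ∧ σ.warr A (σ.word i) < W then
        some (σ.setWord r (σ.warr A (σ.word i))) else none
  | .wstore r A i, σ =>
      if σ.word i < s ∧ σ.word r < W then some (σ.setWarr A (σ.word i) (σ.word r)) else none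
  | .rconst r c, σ => some (σ.setReal r c)
  | .rmove r a, σ => some (σ.setReal r (σ.real a))
  | .rop o r a b, σ => some (σ.setReal r (o.eval (σ.real a) (σ.real b)))
  | .rload r A i, σ =>
      if σ.word i < s then some (σ.setReal r (σ.rarr A (σ.word i))) else none
  | .rstore r A i, σ =>
      if σ.word i < s then some (σ.setRarr A (σ.word i) (σ.real r)) else none

/-- The tests: comparisons of two registers. -/
inductive Test
  | weq (a b : ℕ)
  | wlt (a b : ℕ)
  | rlt (a b : ℕ)
  | rle (a b : ℕ)

/-- Truth of a test in a state. -/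
def Test.Holds : Test → State → Prop
  | .weq a b, σ => σ.word a = σ.word b
  | .wlt a b, σ => σ.word a < σ.word b
  | .rlt a b, σ => σ.real a < σ.real b
  | .rle a b, σ => σ.real a ≤ σ.real b

/-- Programs: instructions under structured control flow. -/
inductive Prog
  | skip
  | instr (i : Instr)
  | seq (c d : Prog)
  | ite (b : Test) (c d : Prog)
  | loop (b : Test) (c : Prog)

/-- `Run W s c σ t σ'`: on the machine with words `< W` and arrays of length `s`, the program `c`
started in the state `σ` halts in the state `σ'` after exactly `t` steps. Every executed
instruction and every evaluated test is one step. -/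
inductive Run (W s : ℕ) : Prog → State → ℕ → State → Prop
  | skip (σ : State) : Run W s .skip σ 0 σ
  | instr (i : Instr) (σ σ' : State) (h : i.step W s σ = some σ') : Run W s (.instr i) σ 1 σ'
  | seq (c d : Prog) (σ σ' σ'' : State) (t u : ℕ) (hc : Run W s c σ t σ')
      (hd : Run W s d σ' u σ'') : Run W s (.seq c d) σ (t + u) σ''
  | ite_true (b : Test) (c d : Prog) (σ σ' : State) (t : ℕ) (hb : b.Holds σ)
      (hc : Run W s c σ t σ') : Run W s (.ite b c d) σ (1 + t) σ'
  | ite_false (b : Test) (c d : Prog) (σ σ' : State) (t : ℕ) (hb : ¬ b.Holds σ)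
      (hd : Run W s d σ t σ') : Run W s (.ite b c d) σ (1 + t) σ'
  | loop_true (b : Test) (c : Prog) (σ σ' σ'' : State) (t u : ℕ) (hb : b.Holds σ)
      (hc : Run W s c σ t σ') (hl : Run W s (.loop b c) σ' u σ'') :
      Run W s (.loop b c) σ (1 + t + u) σ''
  | loop_false (b : Test) (c : Prog) (σ : State) (hb : ¬ b.Holds σ) :
      Run W s (.loop b c) σ 1 σ

/-- The word registers (`inl`) and real registers (`inr`) that an instruction names. -/
def Instr.registers : Instr → Finset (ℕ ⊕ ℕ)
  | .wconst r _ => {.inl r}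
  | .wmove r a => {.inl r, .inl a}
  | .wop _ r a b => {.inl r, .inl a, .inl b}
  | .wload r _ i => {.inl r, .inl i}
  | .wstore r _ i => {.inl r, .inl i}
  | .rconst r _ => {.inr r}
  | .rmove r a => {.inr r, .inr a}
  | .rop _ r a b => {.inr r, .inr a, .inr b}
  | .rload r _ i => {.inr r, .inl i}
  | .rstore r _ i => {.inr r, .inl i}

/-- The word arrays (`inl`) and real arrays (`inr`) that an instruction names. -/
def Instr.arrays : Instr → Finset (ℕ ⊕ ℕ)
  | .wload _ A _ => {.inl A}
  | .wstore _ A _ => {.inl A}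
  | .rload _ A _ => {.inr A}
  | .rstore _ A _ => {.inr A}
  | _ => ∅

/-- The registers that a test names. -/
def Test.registers : Test → Finset (ℕ ⊕ ℕ)
  | .weq a b => {.inl a, .inl b}
  | .wlt a b => {.inl a, .inl b}
  | .rlt a b => {.inr a, .inr b}
  | .rle a b => {.inr a, .inr b}

/-- The registers that a program names. -/
def Prog.registers : Prog → Finset (ℕ ⊕ ℕ)
  | .skip => ∅
  | .instr i => i.registers
  | .seq c d => c.registers ∪ d.registers
  | .ite b c d => b.registers ∪ (c.registers ∪ d.registers)
  | .loop b c => b.registers ∪ c.registers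

/-- The arrays that a program names. -/
def Prog.arrays : Prog → Finset (ℕ ⊕ ℕ)
  | .skip => ∅
  | .instr i => i.arrays
  | .seq c d => c.arrays ∪ d.arrays
  | .ite _ c d => c.arrays ∪ d.arrays
  | .loop _ c => c.arrays

/-- The number of memory cells of a program on the machine with arrays of length `s`: one for each
of its registers and `s` for each of its arrays (those that hold the input included). -/
def Prog.space (c : Prog) (s : ℕ) : ℕ := c.registers.card + c.arrays.card * s

end RealRAM

/-! ### Input and output -/

namespace MaxDominance

open RealRAM

/-- A finite sequence as the contents of an array, padded with zeros. -/
def toArray {n : ℕ} (f : Fin n → ℝ) (j : ℕ) : ℝ := if h : j < n then f ⟨j, h⟩ else 0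

/-- The initial state: the word registers `0, 1, 2` hold `n`, `m`, `k`; the real arrays
`0, 1, 2` hold the abscissas, ordinates and weights of the points of `P`, the real arrays `3, 4`
the abscissas and ordinates of the points of `Q`, in an arbitrary order; everything else is zero. -/
def input {n m : ℕ} (p : Fin n → ℝ × ℝ) (w : Fin n → ℝ) (q : Fin m → ℝ × ℝ) (k : ℕ) : State where
  word r := if r = 0 then n else if r = 1 then m else if r = 2 then k else 0
  real _ := 0
  warr _ _ := 0
  rarr A :=
    if A = 0 then toArray fun i => (p i).1
    else if A = 1 then toArray fun i => (p i).2
    else if A = 2 then toArray w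
    else if A = 3 then toArray fun i => (q i).1
    else if A = 4 then toArray fun i => (q i).2
    else fun _ => 0

/-- The final state `σ` holds a solution: for some subset `Q'` of `Q` with at most `k` elements,
the word register `0` holds `|Q'|`, the first `|Q'|` cells of the word array `0` list the indices of
the elements of `Q'` without repetition, and the real register `0` holds `w(dom(Q'))`, which is the
maximum of the values of all feasible solutions. -/
def IsSolution {n m : ℕ} (p : Fin n → ℝ × ℝ) (w : Fin n → ℝ) (q : Fin m → ℝ × ℝ) (k : ℕ)
    (σ : State) : Prop :=
  ∃ S : Finset (Fin m), S.card ≤ k ∧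
    σ.word 0 = S.card ∧
    (Finset.range S.card).image (σ.warr 0) = S.image Fin.val ∧
    σ.real 0 = weight p w (domUnion (q '' S)) ∧
    IsGreatest (values p w q k) (σ.real 0)

end MaxDominance

end

/-! Give the points of `Q` positions 1, …, m by increasing abscissa and times τ = 1, …, m by
decreasing ordinate, and add a start 0 and an end m + 1. A point of `P` becomes a column `a` and a
row `t` such that the position `x` dominates it exactly when `a ≤ x` and `τ x ≤ t`
(`Describes.mem_dom`). In a chain, a sequence of positions increasing in both orders, the weight
that `x` adds to its predecessor `x'` is `cost x' x`, the weight in the columns `x' + 1, …, x` and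
the rows from `τ x` on; it depends on these two positions only. A subset has the weight of its
staircase of maximal points, so sets of at most `k` points correspond to chains from 0 to m + 1 with
at most `k + 1` steps (`Ranks.Reach.of_finset`, `Ranks.Path.pathCost_eq`, `Describes.solution`). The
last step is free, because no row exceeds m.

One layer of the dynamic program replaces `F` by the maximum of `F x' + cost x' x` over the
predecessors. A sweep over time evaluates it with a segment tree over the positions: leaf `y` holds
the weight of its column in the rows not yet passed and, once the time of `y` is over, the value `F
y`. A prefix query returns the maximum of a leaf value plus the sums to its right, that is, the
recurrence (`query_spec`, `layer_spec`). Points with equal ranks are merged into cells when that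
pays, so that there are `np = min n ((m+1)²)` cells and a layer costs O((np + m) log m).

Keeping the tables of all layers for the reconstruction would take too much space. Instead, as in
Hirschberg's method, only the position that an optimal chain occupies at the middle layer is
propagated, as a tag. These positions become new milestones, and the problem splits into subproblems
with half as many layers. All subproblems of a round share one sweep: passing a milestone subtracts
the penalty 1 + 2 · (total absolute weight) from the sum at its leaf, so that a value computed
across a milestone falls below that of every genuine chain (`Ranks.contrib_cases`,
`Ranks.LayerInv.step`, `Ranks.LayerInv.exact`). The rounds have K, K/2, …, 2 layers, fewer than 2K
together. When one layer is left per segment, the milestones are an optimal chain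
(`Ranks.Feasible.refine`, `rounds_spec`).

The halving needs a power of two K ≥ k + 1. The surplus is absorbed by a delay δ = K − (k + 1): a
chain may wait at the start, and must do so until layer δ. Preparation costs O((n + m) log m), the
rounds O(k (np + m) log m); `time_bound` compares the sum with the claimed minimum. Correctness and
running time are proved together with a weakest precondition calculus for the machine. -/

open RealRAM

namespace RealRAM

/-! ### Reading an updated memory -/

section Access
variable (σ : State)

@[simp] lemma setWord_word (r v r' : ℕ) :
    (σ.setWord r v).word r' = if r' = r then v else σ.word r' := by
  simp [State.setWord, Function.update_apply]
@[simp] lemma setWord_real (r v : ℕ) : (σ.setWord r v).real = σ.real := rfl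
@[simp] lemma setWord_warr (r v : ℕ) : (σ.setWord r v).warr = σ.warr := rfl
@[simp] lemma setWord_rarr (r v : ℕ) : (σ.setWord r v).rarr = σ.rarr := rfl

@[simp] lemma setReal_real (r : ℕ) (v : ℝ) (r' : ℕ) :
    (σ.setReal r v).real r' = if r' = r then v else σ.real r' := by
  simp [State.setReal, Function.update_apply]
@[simp] lemma setReal_word (r : ℕ) (v : ℝ) : (σ.setReal r v).word = σ.word := rfl
@[simp] lemma setReal_warr (r : ℕ) (v : ℝ) : (σ.setReal r v).warr = σ.warr := rfl
@[simp] lemma setReal_rarr (r : ℕ) (v : ℝ) : (σ.setReal r v).rarr = σ.rarr := rfl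

@[simp] lemma setWarr_warr (A j v A' : ℕ) :
    (σ.setWarr A j v).warr A' = if A' = A then Function.update (σ.warr A) j v else σ.warr A' := by
  simp [State.setWarr, Function.update_apply]
@[simp] lemma setWarr_word (A j v : ℕ) : (σ.setWarr A j v).word = σ.word := rfl
@[simp] lemma setWarr_real (A j v : ℕ) : (σ.setWarr A j v).real = σ.real := rfl
@[simp] lemma setWarr_rarr (A j v : ℕ) : (σ.setWarr A j v).rarr = σ.rarr := rfl

@[simp] lemma setRarr_rarr (A j : ℕ) (v : ℝ) (A' : ℕ) :
    (σ.setRarr A j v).rarr A' = if A' = A then Function.update (σ.rarr A) j v else σ.rarr A' := by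
  simp [State.setRarr, Function.update_apply]
@[simp] lemma setRarr_word (A j : ℕ) (v : ℝ) : (σ.setRarr A j v).word = σ.word := rfl
@[simp] lemma setRarr_real (A j : ℕ) (v : ℝ) : (σ.setRarr A j v).real = σ.real := rfl
@[simp] lemma setRarr_warr (A j : ℕ) (v : ℝ) : (σ.setRarr A j v).warr = σ.warr := rfl

end Access

/-! ### Weakest preconditions with running time -/

/-- The program halts, and its running time and final state satisfy `Q`. -/
def wp (W s : ℕ) (c : Prog) (σ : State) (Q : ℕ → State → Prop) : Prop :=
  ∃ t σ', Run W s c σ t σ' ∧ Q t σ'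

section WP
variable {W s : ℕ} {σ : State} {Q R : ℕ → State → Prop}

lemma wp_mono {c : Prog} (h : wp W s c σ Q) (hQ : ∀ t σ', Q t σ' → R t σ') : wp W s c σ R := by
  obtain ⟨t, σ', hr, hq⟩ := h
  exact ⟨t, σ', hr, hQ _ _ hq⟩

lemma wp_skip : wp W s .skip σ Q ↔ Q 0 σ :=
  ⟨fun ⟨_, _, hr, hq⟩ => by cases hr; exact hq, fun h => ⟨_, _, .skip σ, h⟩⟩

lemma wp_instr {i : Instr} : wp W s (.instr i) σ Q ↔ ∃ σ', i.step W s σ = some σ' ∧ Q 1 σ' :=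
  ⟨fun ⟨_, _, hr, hq⟩ => by cases hr with | instr _ _ _ h => exact ⟨_, h, hq⟩,
    fun ⟨_, h, hq⟩ => ⟨_, _, .instr _ _ _ h, hq⟩⟩

lemma wp_seq {c d : Prog} :
    wp W s (.seq c d) σ Q ↔ wp W s c σ fun t σ' => wp W s d σ' fun u σ'' => Q (t + u) σ'' :=
  ⟨fun ⟨_, _, hr, hq⟩ => by
    cases hr with
    | seq _ _ _ _ _ _ _ hc hd => exact ⟨_, _, hc, _, _, hd, hq⟩,
   fun ⟨_, _, hc, _, _, hd, hq⟩ => ⟨_, _, .seq _ _ _ _ _ _ _ hc hd, hq⟩⟩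

lemma wp_ite {b : Test} {c d : Prog} :
    wp W s (.ite b c d) σ Q ↔ (b.Holds σ → wp W s c σ fun t σ' => Q (1 + t) σ') ∧
      (¬ b.Holds σ → wp W s d σ fun t σ' => Q (1 + t) σ') := by
  constructor
  · rintro ⟨t, σ', hr, hq⟩
    cases hr with
    | ite_true _ _ _ _ _ t hb hc => exact ⟨fun _ => ⟨_, _, hc, hq⟩, fun h => absurd hb h⟩
    | ite_false _ _ _ _ _ t hb hc => exact ⟨fun h => absurd h hb, fun _ => ⟨_, _, hc, hq⟩⟩
  · rintro ⟨h₁, h₂⟩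
    by_cases hb : b.Holds σ
    · obtain ⟨t, σ', hr, hq⟩ := h₁ hb
      exact ⟨_, _, .ite_true _ _ _ _ _ _ hb hr, hq⟩
    · obtain ⟨t, σ', hr, hq⟩ := h₂ hb
      exact ⟨_, _, .ite_false _ _ _ _ _ _ hb hr, hq⟩

lemma wp_wconst {r c : ℕ} :
    wp W s (.instr (.wconst r c)) σ Q ↔ c < W ∧ Q 1 (σ.setWord r c) := by
  simp [wp_instr, Instr.step]
lemma wp_wmove {r a : ℕ} :
    wp W s (.instr (.wmove r a)) σ Q ↔ σ.word a < W ∧ Q 1 (σ.setWord r (σ.word a)) := by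
  simp [wp_instr, Instr.step]
lemma wp_wadd {r a b : ℕ} : wp W s (.instr (.wop .add r a b)) σ Q ↔
    σ.word a + σ.word b < W ∧ Q 1 (σ.setWord r (σ.word a + σ.word b)) := by
  simp only [wp_instr, Instr.step, Option.ite_none_right_eq_some, Option.some.injEq]
  simp [WordOp.eval]
lemma wp_wsub {r a b : ℕ} : wp W s (.instr (.wop .sub r a b)) σ Q ↔
    σ.word a - σ.word b < W ∧ Q 1 (σ.setWord r (σ.word a - σ.word b)) := by
  simp only [wp_instr, Instr.step, Option.ite_none_right_eq_some, Option.some.injEq]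
  simp [WordOp.eval]
lemma wp_wmul {r a b : ℕ} : wp W s (.instr (.wop .mul r a b)) σ Q ↔
    σ.word a * σ.word b < W ∧ Q 1 (σ.setWord r (σ.word a * σ.word b)) := by
  simp only [wp_instr, Instr.step, Option.ite_none_right_eq_some, Option.some.injEq]
  simp [WordOp.eval]
lemma wp_wdiv {r a b : ℕ} : wp W s (.instr (.wop .div r a b)) σ Q ↔
    σ.word a / σ.word b < W ∧ Q 1 (σ.setWord r (σ.word a / σ.word b)) := by
  simp only [wp_instr, Instr.step, Option.ite_none_right_eq_some, Option.some.injEq]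
  simp [WordOp.eval]
lemma wp_wload {r A i : ℕ} : wp W s (.instr (.wload r A i)) σ Q ↔
    (σ.word i < s ∧ σ.warr A (σ.word i) < W) ∧ Q 1 (σ.setWord r (σ.warr A (σ.word i))) := by
  simp [wp_instr, Instr.step]
lemma wp_wstore {r A i : ℕ} : wp W s (.instr (.wstore r A i)) σ Q ↔
    (σ.word i < s ∧ σ.word r < W) ∧ Q 1 (σ.setWarr A (σ.word i) (σ.word r)) := by
  simp [wp_instr, Instr.step]
lemma wp_rconst {r : ℕ} {c : ℤ} :
    wp W s (.instr (.rconst r c)) σ Q ↔ Q 1 (σ.setReal r c) := by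
  simp [wp_instr, Instr.step]
lemma wp_rmove {r a : ℕ} :
    wp W s (.instr (.rmove r a)) σ Q ↔ Q 1 (σ.setReal r (σ.real a)) := by
  simp [wp_instr, Instr.step]
lemma wp_radd {r a b : ℕ} : wp W s (.instr (.rop .add r a b)) σ Q ↔
    Q 1 (σ.setReal r (σ.real a + σ.real b)) := by
  simp [wp_instr, Instr.step, RealOp.eval]
lemma wp_rsub {r a b : ℕ} : wp W s (.instr (.rop .sub r a b)) σ Q ↔
    Q 1 (σ.setReal r (σ.real a - σ.real b)) := by
  simp [wp_instr, Instr.step, RealOp.eval]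
lemma wp_rload {r A i : ℕ} : wp W s (.instr (.rload r A i)) σ Q ↔
    σ.word i < s ∧ Q 1 (σ.setReal r (σ.rarr A (σ.word i))) := by
  simp [wp_instr, Instr.step]
lemma wp_rstore {r A i : ℕ} : wp W s (.instr (.rstore r A i)) σ Q ↔
    σ.word i < s ∧ Q 1 (σ.setRarr A (σ.word i) (σ.real r)) := by
  simp [wp_instr, Instr.step]

end WP

/-! ### What a program may write -/

/-- The word registers that an instruction writes. -/
def Instr.ww : Instr → List ℕ
  | .wconst r _ | .wmove r _ | .wop _ r _ _ | .wload r _ _ => [r]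
  | _ => []
/-- The real registers that an instruction writes. -/
def Instr.rw : Instr → List ℕ
  | .rconst r _ | .rmove r _ | .rop _ r _ _ | .rload r _ _ => [r]
  | _ => []
/-- The word arrays that an instruction writes. -/
def Instr.waw : Instr → List ℕ
  | .wstore _ A _ => [A]
  | _ => []
/-- The real arrays that an instruction writes. -/
def Instr.raw : Instr → List ℕ
  | .rstore _ A _ => [A]
  | _ => []

/-- Collect a list over the instructions of a program. -/
def Prog.collect (f : Instr → List ℕ) : Prog → List ℕ
  | .skip => []
  | .instr i => f i
  | .seq c d => c.collect f ++ d.collect f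
  | .ite _ c d => c.collect f ++ d.collect f
  | .loop _ c => c.collect f

/-- The states agree on everything that the program does not write. -/
structure Frame (c : Prog) (σ σ' : State) : Prop where
  w : ∀ r, r ∉ c.collect Instr.ww → σ'.word r = σ.word r
  r : ∀ r, r ∉ c.collect Instr.rw → σ'.real r = σ.real r
  wa : ∀ r, r ∉ c.collect Instr.waw → σ'.warr r = σ.warr r
  ra : ∀ r, r ∉ c.collect Instr.raw → σ'.rarr r = σ.rarr r

lemma Frame.refl (c : Prog) (σ : State) : Frame c σ σ :=
  ⟨fun _ _ => rfl, fun _ _ => rfl, fun _ _ => rfl, fun _ _ => rfl⟩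

lemma Frame.trans {c : Prog} {σ σ' σ'' : State} (h : Frame c σ σ') (h' : Frame c σ' σ'') :
    Frame c σ σ'' :=
  ⟨fun r hr => (h'.w r hr).trans (h.w r hr), fun r hr => (h'.r r hr).trans (h.r r hr),
    fun r hr => (h'.wa r hr).trans (h.wa r hr), fun r hr => (h'.ra r hr).trans (h.ra r hr)⟩

lemma Frame.mono {c d : Prog} {σ σ' : State} (h : Frame c σ σ')
    (hcd : ∀ f, c.collect f ⊆ d.collect f) : Frame d σ σ' :=
  ⟨fun r hr => h.w r fun h' => hr (hcd _ h'), fun r hr => h.r r fun h' => hr (hcd _ h'),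
    fun r hr => h.wa r fun h' => hr (hcd _ h'), fun r hr => h.ra r fun h' => hr (hcd _ h')⟩

lemma Instr.frame {W s : ℕ} {i : Instr} {σ σ' : State} (h : i.step W s σ = some σ') :
    Frame (.instr i) σ σ' := by
  cases i <;> simp only [Instr.step, Option.ite_none_right_eq_some, Option.some.injEq] at h <;>
    obtain ⟨_, rfl⟩ := h
  all_goals
    constructor <;> intro x hx <;>
      simp_all [Prog.collect, Instr.ww, Instr.rw, Instr.waw, Instr.raw]

/-- The write sets are computed from the program text alone. Specifications therefore mention only
what changes, and everything else is carried over by checking that a concrete number is not in a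
concrete list. -/
lemma Run.frame {W s : ℕ} {c : Prog} {σ σ' : State} {t : ℕ} (h : Run W s c σ t σ') :
    Frame c σ σ' := by
  induction h with
  | skip => exact Frame.refl _ _
  | instr i σ σ' h => exact Instr.frame h
  | seq c d σ σ' σ'' t u _ _ hc hd =>
    exact (hc.mono fun f => by simp [Prog.collect]).trans (hd.mono fun f => by simp [Prog.collect])
  | ite_true b c d σ σ' t _ _ hc => exact hc.mono fun f => by simp [Prog.collect]
  | ite_false b c d σ σ' t _ _ hc => exact hc.mono fun f => by simp [Prog.collect]
  | loop_true b c σ σ' σ'' t u _ _ _ hc hd =>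
    exact (hc.mono fun f => by simp [Prog.collect]).trans hd
  | loop_false => exact Frame.refl _ _

/-! ### Proof rules for calls and loops with time bounds -/

section Rules
variable {W s : ℕ} {σ : State} {Q R : ℕ → State → Prop}

/-- Use a specification and the frame property of a program. -/
lemma wp_call {c : Prog} (h : wp W s c σ Q) (hQ : ∀ t σ', Q t σ' → Frame c σ σ' → R t σ') :
    wp W s c σ R := by
  obtain ⟨t, σ', hr, hq⟩ := h
  exact ⟨t, σ', hr, hQ _ _ hq hr.frame⟩

/-- A loop with a bound on the number of iterations. `Inv i` holds when at most `i` iterations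
remain. -/
lemma wp_loop {b : Test} {c : Prog} (Inv : ℕ → State → Prop) (T N : ℕ) (h0 : Inv N σ)
    (hstep : ∀ i σ', Frame c σ σ' → Inv i σ' → b.Holds σ' →
      ∃ i', i = i' + 1 ∧ wp W s c σ' fun t σ'' => t ≤ T ∧ Inv i' σ'')
    (hQ : ∀ t i σ', t ≤ N * (T + 1) + 1 → Frame c σ σ' → Inv i σ' → ¬ b.Holds σ' → Q t σ') :
    wp W s (.loop b c) σ Q := by
  suffices H : ∀ N σ', Frame c σ σ' → Inv N σ' → wp W s (.loop b c) σ' fun t σ'' =>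
      t ≤ N * (T + 1) + 1 ∧ Frame c σ σ'' ∧ (∃ i, Inv i σ'') ∧ ¬ b.Holds σ'' by
    obtain ⟨t, σ', hr, h1, h2, ⟨i, h3⟩, h4⟩ := H N σ (Frame.refl _ _) h0
    exact ⟨t, σ', hr, hQ _ _ _ h1 h2 h3 h4⟩
  intro N
  induction N with
  | zero =>
    intro σ' hF hI
    by_cases hb : b.Holds σ'
    · obtain ⟨i', h, _⟩ := hstep _ _ hF hI hb
      omega
    · exact ⟨1, σ', .loop_false _ _ _ hb, by simp, hF, ⟨_, hI⟩, hb⟩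
  | succ N ih =>
    intro σ' hF hI
    by_cases hb : b.Holds σ'
    · obtain ⟨i', h, t, σ'', hr, ht, hI'⟩ := hstep _ _ hF hI hb
      obtain rfl : N = i' := by omega
      obtain ⟨u, τ, hr', hu, hq⟩ := ih σ'' (hF.trans hr.frame) hI'
      refine ⟨_, τ, .loop_true _ _ _ _ _ _ _ hb hr hr', ?_, hq⟩
      rw [Nat.add_mul]
      omega
    · exact ⟨1, σ', .loop_false _ _ _ hb, by simp, hF, ⟨_, hI⟩, hb⟩

/-- Count the word register `i` up to the contents of the word register `b`; the word register `3`
holds `1`. -/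
def forLoop (i b : ℕ) (c : Prog) : Prog :=
  .loop (.wlt i b) (.seq c (.instr (.wop .add i i 3)))

lemma forLoop_collect (i b : ℕ) (c : Prog) (f : Instr → List ℕ) :
    (forLoop i b c).collect f = c.collect f ++ f (.wop .add i i 3) := rfl

/-- The bound `T` may depend on the counter; this permits amortization when the work of an iteration
is the length of a list. Each iteration pays 2 extra steps for the test and the increment, and the
failing test at the end pays 1. -/
lemma wp_for {i b : ℕ} {c : Prog} (Inv : ℕ → State → Prop) (T : ℕ → ℕ) {lo hi : ℕ}
    (hi0 : σ.word i = lo) (hb0 : σ.word b = hi) (hle : lo ≤ hi) (h3 : σ.word 3 = 1) (hW : hi < W)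
    (hic : i ∉ c.collect Instr.ww) (hbc : b ∉ i :: c.collect Instr.ww)
    (h3c : 3 ∉ i :: c.collect Instr.ww) (h0 : Inv lo σ)
    (hstep : ∀ x σ', lo ≤ x → x < hi → Frame (forLoop i b c) σ σ' → σ'.word i = x → Inv x σ' →
      wp W s c σ' fun t σ'' => t ≤ T x ∧ Inv (x + 1) (σ''.setWord i (x + 1)))
    (hQ : ∀ t σ', t ≤ ∑ x ∈ Finset.Ico lo hi, (T x + 2) + 1 → Frame (forLoop i b c) σ σ' →
      σ'.word i = hi → Inv hi σ' → Q t σ') :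
    wp W s (forLoop i b c) σ Q := by
  -- Induction on the number `d` of iterations that remain; the frame condition keeps the bound and
  -- the constant 1 intact.
  have key : ∀ d x σ', x + d = hi → lo ≤ x → Frame (forLoop i b c) σ σ' → σ'.word i = x →
      Inv x σ' → wp W s (forLoop i b c) σ' fun t σ'' =>
        t ≤ ∑ x ∈ Finset.Ico x hi, (T x + 2) + 1 ∧ σ''.word i = hi ∧ Inv hi σ'' := by
    intro d
    induction d with
    | zero =>
      intro x σ' hx hlx hF hix hI
      have hbb : σ'.word b = hi := (hF.w b (by simpa [forLoop_collect, Instr.ww, and_comm] using hbc)).trans hb0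
      simp only [add_zero] at hx
      subst hx
      exact ⟨1, σ', .loop_false _ _ _ (by simp [Test.Holds, hix, hbb]), by simp, hix, hI⟩
    | succ d ih =>
      intro x σ' hx hlx hF hix hI
      have hbb : σ'.word b = hi := (hF.w b (by simpa [forLoop_collect, Instr.ww, and_comm] using hbc)).trans hb0
      obtain ⟨t, σ'', hr, ht, hI'⟩ := hstep x σ' hlx (by omega) hF hix hI
      have h1 : σ''.word i = x := (hr.frame.w i hic).trans hix
      have h2 : σ''.word 3 = 1 := by
        rw [hr.frame.w 3 (by simp_all), hF.w 3 (by simpa [forLoop_collect, Instr.ww, and_comm] using h3c), h3]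
      have hr2 : Run W s (.seq c (.instr (.wop .add i i 3))) σ' (t + 1) (σ''.setWord i (x + 1)) :=
        .seq _ _ _ _ _ _ _ hr (.instr _ _ _ (by
          simp only [Instr.step, WordOp.eval, h1, h2]
          rw [if_pos (by omega)]))
      obtain ⟨u, ρ, hr', hu, hq⟩ := ih (x + 1) (σ''.setWord i (x + 1)) (by omega) (by omega)
        (hF.trans (hr2.frame.mono fun f => by simp [Prog.collect, forLoop])) (by simp) hI'
      refine ⟨_, ρ, .loop_true _ _ _ _ _ _ _ (by simp [Test.Holds, hix, hbb]; omega) hr2 hr', ?_, hq⟩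
      rw [Finset.sum_eq_sum_Ico_succ_bot (by omega)]
      omega
  refine wp_call (key (hi - lo) lo σ (by omega) le_rfl (Frame.refl _ _) hi0 h0) ?_
  rintro t σ' ⟨h1, h2, h3⟩ hF
  exact hQ _ _ h1 hF h2 h3

end Rules

end RealRAM

namespace RealRAM

/-! ### Segment trees for weighted prefix maxima -/

/-- The triple `(sv, bv, gv)` summarizes the leaves `lo, …, hi - 1`: the sum of the `S y`, the
maximum of `B x + ∑_{x < y} S y` and the tag `G x` of a leaf `x` that attains it. -/
structure Seg (S B : ℕ → ℝ) (G : ℕ → ℕ) (lo hi : ℕ) (sv bv : ℝ) (gv : ℕ) : Prop where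
  sum : sv = ∑ y ∈ Finset.Ico lo hi, S y
  ex : ∃ x, lo ≤ x ∧ x < hi ∧ bv = B x + ∑ y ∈ Finset.Ico (x + 1) hi, S y ∧ gv = G x
  ub : ∀ x, lo ≤ x → x < hi → B x + ∑ y ∈ Finset.Ico (x + 1) hi, S y ≤ bv

lemma Seg.leaf (S B : ℕ → ℝ) (G : ℕ → ℕ) (x : ℕ) : Seg S B G x (x + 1) (S x) (B x) (G x) := by
  refine ⟨by simp, ⟨x, by simp⟩, fun y h1 h2 => ?_⟩
  obtain rfl : y = x := by omega
  simp

/-- A leaf of the left block collects the whole sum of the right block in addition, while the leaves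
of the right block are unaffected. Hence the summary of a union is a function of the two summaries,
which is what a tree node needs. -/
lemma Seg.append {S B : ℕ → ℝ} {G : ℕ → ℕ} {lo mid hi : ℕ} {s₁ b₁ s₂ b₂ : ℝ} {g₁ g₂ : ℕ}
    (h₁ : Seg S B G lo mid s₁ b₁ g₁) (h₂ : Seg S B G mid hi s₂ b₂ g₂) :
    Seg S B G lo hi (s₁ + s₂) (max (b₁ + s₂) b₂) (if b₂ < b₁ + s₂ then g₁ else g₂) := by
  obtain ⟨x₁, hx₁, hx₁', e₁, f₁⟩ := h₁.ex
  obtain ⟨x₂, hx₂, hx₂', e₂, f₂⟩ := h₂.ex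
  have split : ∀ x, x < mid → ∑ y ∈ Finset.Ico (x + 1) hi, S y =
      ∑ y ∈ Finset.Ico (x + 1) mid, S y + s₂ := fun x hx => by
    rw [h₂.sum, Finset.sum_Ico_consecutive _ (by omega) (by omega)]
  refine ⟨?_, ?_, fun x h h' => ?_⟩
  · rw [h₁.sum, h₂.sum, Finset.sum_Ico_consecutive _ (by omega) (by omega)]
  · by_cases hb : b₂ < b₁ + s₂
    · exact ⟨x₁, hx₁, by omega, by rw [max_eq_left hb.le, split _ hx₁', e₁, add_assoc], by simp [hb, f₁]⟩
    · exact ⟨x₂, by omega, hx₂', by rw [max_eq_right (not_lt.1 hb), e₂], by simp [hb, f₂]⟩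
  · rcases lt_or_ge x mid with hx | hx
    · refine le_trans ?_ (le_max_left _ _)
      rw [split x hx, ← add_assoc]
      gcongr
      exact h₁.ub x h hx
    · exact le_trans (h₂.ub x hx h') (le_max_right _ _)

/-- The node `v` carries the summary of its children `2 * v` and `2 * v + 1`. -/
def NodeOK (S B : ℕ → ℝ) (G : ℕ → ℕ) (v : ℕ) : Prop :=
  S v = S (2 * v) + S (2 * v + 1) ∧ B v = max (B (2 * v) + S (2 * v + 1)) (B (2 * v + 1)) ∧
    G v = if B (2 * v + 1) < B (2 * v) + S (2 * v + 1) then G (2 * v) else G (2 * v + 1)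

lemma NodeOK.congr {S B S' B' : ℕ → ℝ} {G G' : ℕ → ℕ} {v : ℕ} (h : NodeOK S B G v)
    (hS : ∀ u, u = v ∨ u = 2 * v ∨ u = 2 * v + 1 → S' u = S u ∧ B' u = B u ∧ G' u = G u) :
    NodeOK S' B' G' v := by
  obtain ⟨a1, a2, a3⟩ := hS v (by simp)
  obtain ⟨b1, b2, b3⟩ := hS (2 * v) (by simp)
  obtain ⟨c1, c2, c3⟩ := hS (2 * v + 1) (by simp)
  unfold NodeOK
  rw [a1, a2, a3, b1, b2, b3, c1, c2, c3]
  exact h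

/-- In heap numbering the descendants of `v` that are `l` levels down form an interval. The two
inequalities place it among the leaves `N, …, 2N - 1`, and induction on `l` appends the two halves.
-/
lemma seg_of_nodeOK {S B : ℕ → ℝ} {G : ℕ → ℕ} {N : ℕ} (h : ∀ v, 1 ≤ v → v < N → NodeOK S B G v)
    (l v : ℕ) (h₁ : N ≤ v * 2 ^ l) (h₂ : (v + 1) * 2 ^ l ≤ 2 * N) (hN : 1 ≤ N) :
    Seg S B G (v * 2 ^ l) ((v + 1) * 2 ^ l) (S v) (B v) (G v) := by
  induction l generalizing v with
  | zero => simpa using Seg.leaf S B G v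
  | succ l ih =>
    have hp : 1 ≤ 2 ^ l := Nat.one_le_two_pow
    rw [pow_succ] at h₁ h₂
    have e1 : v * (2 ^ l * 2) = 2 * v * 2 ^ l := by ring
    have e2 : (v + 1) * (2 ^ l * 2) = (2 * v + 1 + 1) * 2 ^ l := by ring
    have e3 : (2 * v + 1) * 2 ^ l = 2 * v * 2 ^ l + 2 ^ l := by ring
    have e4 : (2 * v + 1 + 1) * 2 ^ l = 2 * v * 2 ^ l + 2 * 2 ^ l := by ring
    have e5 : v ≤ v * 2 ^ l := Nat.le_mul_of_pos_right _ (by omega)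
    have e6 : 2 * v * 2 ^ l = 2 * (v * 2 ^ l) := by ring
    rw [pow_succ, e1, e2]
    rw [e1] at h₁
    rw [e2] at h₂
    have hv : 1 ≤ v := by
      rcases Nat.eq_zero_or_pos v with rfl | h
      · simp at h₁; omega
      · exact h
    have hvN : v < N := by omega
    obtain ⟨n1, n2, n3⟩ := h v hv hvN
    rw [n1, n2, n3]
    exact (ih (2 * v) h₁ (by omega)).append (ih (2 * v + 1) (by omega) h₂)

/-! ### The tree in the machine

The real arrays `5` and `6` hold sums and maxima, the word array `1` the tags. -/

/-- The constants that the tree operations rely on. -/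
structure Consts (h W s : ℕ) (σ : State) : Prop where
  w3 : σ.word 3 = 1
  w4 : σ.word 4 = 0
  w5 : σ.word 5 = 2
  w6 : σ.word 6 = 2 ^ h
  w7 : σ.word 7 = 2 ^ (h + 1)
  r17 : σ.real 17 = 0
  lW : 2 ^ (h + 1) < W
  ls : 2 ^ (h + 1) ≤ s

lemma Consts.congr {h W s : ℕ} {σ σ' : State} (hc : Consts h W s σ) 
    (hw : ∀ r, 3 ≤ r → r ≤ 7 → σ'.word r = σ.word r) (hr : σ'.real 17 = σ.real 17) :
    Consts h W s σ' :=
  ⟨by rw [hw _ (by norm_num) (by norm_num), hc.w3], by rw [hw _ (by norm_num) (by norm_num), hc.w4],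
   by rw [hw _ (by norm_num) (by norm_num), hc.w5], by rw [hw _ (by norm_num) (by norm_num), hc.w6],
   by rw [hw _ (by norm_num) (by norm_num), hc.w7], by rw [hr, hc.r17], hc.lW, hc.ls⟩

lemma Consts.frame {h W s : ℕ} {σ σ' : State} {c : Prog} (hc : Consts h W s σ)
    (hF : Frame c σ σ') (hw : ∀ r ∈ [3, 4, 5, 6, 7], r ∉ c.collect Instr.ww)
    (hr : 17 ∉ c.collect Instr.rw) : Consts h W s σ' :=
  hc.congr (fun r h1 h2 => hF.w r (hw r (by interval_cases r <;> simp))) (hF.r _ hr)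

/-- The arrays hold a consistent segment tree with `2 ^ h` leaves `2 ^ h, …, 2 ^ (h + 1) - 1`. -/
structure Tree (h W : ℕ) (σ : State) : Prop where
  ok : ∀ v, 1 ≤ v → v < 2 ^ h → NodeOK (σ.rarr 5) (σ.rarr 6) (σ.warr 1) v
  tag : ∀ v, v < 2 ^ (h + 1) → σ.warr 1 v < W

/-- Recompute the ancestors of the node in the word register `10`. -/
def climb : Prog :=
  .loop (.wlt 3 10)
    (.seq (.instr (.wop .div 10 10 5)) <|
     .seq (.instr (.wop .add 11 10 10)) <|
     .seq (.instr (.wop .add 12 11 3)) <|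
     .seq (.instr (.rload 10 5 11)) <|
     .seq (.instr (.rload 11 5 12)) <|
     .seq (.instr (.rop .add 12 10 11)) <|
     .seq (.instr (.rstore 12 5 10)) <|
     .seq (.instr (.rload 12 6 11)) <|
     .seq (.instr (.rop .add 12 12 11)) <|
     .seq (.instr (.rload 13 6 12)) <|
     .seq (.instr (.wload 13 1 12)) <|
     .seq (.ite (.rlt 13 12) (.seq (.instr (.rmove 13 12)) (.instr (.wload 13 1 11))) .skip) <|
     .seq (.instr (.rstore 13 6 10)) <|
     .instr (.wstore 13 1 10))

/-- At any moment at most one node is inconsistent, the parent of the current node. Recomputing it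
moves the defect one level up, until it leaves the tree above the root. -/
lemma climb_spec {h W s : ℕ} {σ : State} (hc : Consts h W s σ) {v₀ : ℕ} (hv : σ.word 10 = v₀)
    (h1 : 1 ≤ v₀) (h2 : v₀ < 2 ^ (h + 1))
    (hok : ∀ u, 1 ≤ u → u < 2 ^ h → u ≠ v₀ / 2 →
      NodeOK (σ.rarr 5) (σ.rarr 6) (σ.warr 1) u)
    (htag : ∀ v, v < 2 ^ (h + 1) → σ.warr 1 v < W) :
    wp W s climb σ fun t σ' => t ≤ 18 * h + 1 ∧ Tree h W σ' ∧
      ∀ y, 2 ^ h ≤ y → σ'.rarr 5 y = σ.rarr 5 y ∧ σ'.rarr 6 y = σ.rarr 6 y ∧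
        σ'.warr 1 y = σ.warr 1 y := by
  have hlW := hc.lW
  have hls := hc.ls
  refine wp_loop (fun i σ' => 1 ≤ σ'.word 10 ∧ σ'.word 10 < 2 ^ (i + 1) ∧ i ≤ h ∧
    (∀ u, 1 ≤ u → u < 2 ^ h → u ≠ σ'.word 10 / 2 →
      NodeOK (σ'.rarr 5) (σ'.rarr 6) (σ'.warr 1) u) ∧
    (∀ v, v < 2 ^ (h + 1) → σ'.warr 1 v < W) ∧
    ∀ y, 2 ^ h ≤ y → σ'.rarr 5 y = σ.rarr 5 y ∧ σ'.rarr 6 y = σ.rarr 6 y ∧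
        σ'.warr 1 y = σ.warr 1 y) 17 h ?_ ?_ ?_
  · rw [hv]
    exact ⟨h1, h2, le_rfl, hok, htag, fun _ _ => ⟨rfl, rfl, rfl⟩⟩
  · rintro i σ' hF ⟨g1, g2, gi, gok, gtag, glf⟩ hb
    have e3 : σ'.word 3 = 1 := (hF.w 3 (by decide)).trans hc.w3
    have e5 : σ'.word 5 = 2 := (hF.w 5 (by decide)).trans hc.w5
    simp only [Test.Holds, e3] at hb
    obtain ⟨i, rfl⟩ : ∃ j, i = j + 1 := by
      rcases i with _ | j
      · simp at g2; omega
      · exact ⟨j, rfl⟩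
    refine ⟨i, rfl, ?_⟩
    have hpow : 2 ^ (i + 1) ≤ 2 ^ h := Nat.pow_le_pow_right (by norm_num) gi
    have ep : 2 ^ (i + 1 + 1) = 2 * 2 ^ (i + 1) := by ring
    have eq : 2 ^ (h + 1) = 2 * 2 ^ h := by ring
    generalize hv : σ'.word 10 = v at *
    set p := v / 2 with hp
    have hp1 : 1 ≤ p := by omega
    have hp2 : p < 2 ^ (i + 1) := by omega
    simp only [wp_seq, wp_wdiv, wp_wadd, wp_rload, wp_radd, wp_rstore, wp_wload, wp_wstore,
      wp_ite, wp_skip, wp_rmove, Test.Holds]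
    simp only [setWord_word, setWord_real, setWord_warr, setWord_rarr, setReal_real, setReal_word,
      setReal_warr, setReal_rarr, setRarr_rarr, setRarr_word, setRarr_real, setRarr_warr,
      setWarr_word, setWarr_warr, setWarr_rarr, hv, e3, e5, ← hp]
    norm_num
    have t1 := gtag (p + p) (by omega)
    have t2 := gtag (p + p + 1) (by omega)
    -- Both outcomes of the comparison end in this situation: `p` is consistent, only its parent may
    -- have become inconsistent, and no leaf has changed.
    have hfin : ∀ (b : ℝ) (g : ℕ), b = max (σ'.rarr 6 (p + p) + σ'.rarr 5 (p + p + 1)) (σ'.rarr 6 (p + p + 1)) →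
        g = (if σ'.rarr 6 (p + p + 1) < σ'.rarr 6 (p + p) + σ'.rarr 5 (p + p + 1) then σ'.warr 1 (p + p)
          else σ'.warr 1 (p + p + 1)) → 
        (∀ u, 1 ≤ u → u < 2 ^ h → ¬ u = p / 2 →
          NodeOK (Function.update (σ'.rarr 5) p (σ'.rarr 5 (p + p) + σ'.rarr 5 (p + p + 1)))
            (Function.update (σ'.rarr 6) p b) (Function.update (σ'.warr 1) p g) u) ∧
        (∀ v, v < 2 ^ (h + 1) → Function.update (σ'.warr 1) p g v < W) ∧
        ∀ y, 2 ^ h ≤ y → Function.update (σ'.rarr 5) p (σ'.rarr 5 (p + p) + σ'.rarr 5 (p + p + 1)) y = σ.rarr 5 y ∧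
          Function.update (σ'.rarr 6) p b y = σ.rarr 6 y ∧ Function.update (σ'.warr 1) p g y = σ.warr 1 y := by
      intro b g hb hg
      refine ⟨fun u hu1 hu2 hu3 => ?_, fun v hv => ?_, fun y hy => ?_⟩
      · by_cases hup : u = p
        · rw [hup]
          have q1 : 2 * p ≠ p := by omega
          have q2 : 2 * p + 1 ≠ p := by omega
          simp only [NodeOK, Function.update_self, Function.update_of_ne q1, Function.update_of_ne q2, hb, hg]
          simp only [two_mul, and_self]
        · refine (gok u hu1 hu2 hup).congr fun w hw => ?_
          have : w ≠ p := by omega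
          simp [Function.update_of_ne this]
      · by_cases hvp : v = p
        · subst hvp
          rw [Function.update_self, hg]
          split_ifs <;> assumption
        · rw [Function.update_of_ne hvp]; exact gtag v hv
      · have : y ≠ p := by omega
        simp only [Function.update_of_ne this]
        exact glf y hy
    have b1 : p < W := by omega
    have b2 : p + p < W := by omega
    have b3 : p + p + 1 < W := by omega
    have b4 : p < s := by omega
    have b5 : p + p < s := by omega
    have b6 : p + p + 1 < s := by omega
    have n1 : p + p ≠ p := by omega
    have n2 : p + p + 1 ≠ p := by omega
    refine ⟨b1, b2, b3, b5, b6, b4, b5, b6, ⟨b6, t2⟩, fun hlt => ⟨⟨b5, t1⟩, b4, ⟨b4, t1⟩, hp1, hp2, by omega, ?_⟩,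
      fun hlt => ⟨b4, ⟨b4, t2⟩, hp1, hp2, by omega, ?_⟩⟩
    · exact hfin _ _ (by rw [max_eq_left hlt.le]) (by rw [if_pos hlt])
    · exact hfin _ _ (by rw [max_eq_right hlt]) (by rw [if_neg (not_lt.2 hlt)])
  · rintro t i σ' ht hF ⟨g1, g2, gi, gok, gtag, glf⟩ hb
    have e3 : σ'.word 3 = 1 := (hF.w 3 (by decide)).trans hc.w3
    simp only [Test.Holds, e3] at hb
    -- The current node is the root 1, and its "parent" 1 / 2 = 0 is not a node, so the exception is
    -- void.
    refine ⟨by omega, ⟨fun v h1 h2 => gok v h1 h2 (by omega), gtag⟩, glf⟩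

/-- Prefix query at the leaf in the word register `10`; the real register `14` receives the maximum,
the word register `14` the tag. -/
def query : Prog :=
  .seq (.instr (.rload 15 5 10)) <|
  .seq (.instr (.rload 14 6 10)) <|
  .seq (.instr (.wload 14 1 10)) <|
  .loop (.wlt 3 10)
    (.seq (.instr (.wop .div 11 10 5)) <|
     .seq (.instr (.wop .add 12 11 11)) <|
     .seq (.ite (.weq 12 10) .skip
       (.seq (.instr (.rload 10 6 12)) <|
        .seq (.instr (.rop .add 10 10 15)) <|
        .seq (.instr (.rload 11 5 12)) <|
        .seq (.instr (.rop .add 15 11 15)) <|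
        .ite (.rlt 14 10) (.seq (.instr (.rmove 14 10)) (.instr (.wload 14 1 12))) .skip)) <|
     .instr (.wmove 10 11))

/-- On the way up, the registers summarize the leaves from the leftmost descendant of the current
node up to `x`. Moving up from a left child does not change this interval; moving up from a right
child prepends the interval of its sibling. At the root the interval is the whole prefix. -/
lemma query_spec {h W s : ℕ} {σ : State} (hc : Consts h W s σ) (hT : Tree h W σ) {x : ℕ}
    (hx : σ.word 10 = x) (h1 : 2 ^ h ≤ x) (h2 : x < 2 ^ (h + 1)) :
    wp W s query σ fun t σ' => t ≤ 12 * h + 4 ∧ σ'.word 14 < W ∧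
      ∃ sv, Seg (σ.rarr 5) (σ.rarr 6) (σ.warr 1) (2 ^ h) (x + 1) sv (σ'.real 14) (σ'.word 14) := by
  have hlW := hc.lW
  have hls := hc.ls
  unfold query
  simp only [wp_seq, wp_rload, wp_wload]
  simp only [setReal_word, setReal_warr, setReal_rarr, hx]
  refine ⟨by omega, by omega, ⟨by omega, hT.tag _ h2⟩, ?_⟩
  refine wp_loop (fun i σ' => i ≤ h ∧ 2 ^ i ≤ σ'.word 10 ∧ σ'.word 10 < 2 ^ (i + 1) ∧
    σ'.word 14 < W ∧
    Seg (σ.rarr 5) (σ.rarr 6) (σ.warr 1) (σ'.word 10 * 2 ^ (h - i)) (x + 1) (σ'.real 15)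
      (σ'.real 14) (σ'.word 14)) 11 h ?_ ?_ ?_
  · have := Seg.leaf (σ.rarr 5) (σ.rarr 6) (σ.warr 1) x
    simpa [hx, h1, h2, hT.tag _ h2] using this
  · rintro i σ' hF ⟨gi, g1, g2, gW, gS⟩ hb
    have e3 : σ'.word 3 = 1 := (hF.w 3 (by decide)).trans (by simp [hc.w3])
    have e5 : σ'.word 5 = 2 := (hF.w 5 (by decide)).trans (by simp [hc.w5])
    have a5 : σ'.rarr 5 = σ.rarr 5 := (hF.ra 5 (by decide)).trans (by simp)
    have a6 : σ'.rarr 6 = σ.rarr 6 := (hF.ra 6 (by decide)).trans (by simp)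
    have a1 : σ'.warr 1 = σ.warr 1 := (hF.wa 1 (by decide)).trans (by simp)
    simp only [Test.Holds, e3] at hb
    obtain ⟨i, rfl⟩ : ∃ j, i = j + 1 := by
      rcases i with _ | j
      · simp at g2; omega
      · exact ⟨j, rfl⟩
    refine ⟨i, rfl, ?_⟩
    generalize hv : σ'.word 10 = v at *
    obtain ⟨l, hl⟩ : ∃ l, h = i + 1 + l := ⟨h - (i + 1), by omega⟩
    have el : h - (i + 1) = l := by omega
    have el' : h - i = l + 1 := by omega
    rw [el] at gS
    have hpow : 2 ^ (i + 1) ≤ 2 ^ h := Nat.pow_le_pow_right (by norm_num) gi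
    have ep : 2 ^ (i + 1 + 1) = 2 * 2 ^ (i + 1) := by ring
    have ep' : 2 ^ (i + 1) = 2 * 2 ^ i := by ring
    have eq : 2 ^ (h + 1) = 2 * 2 ^ h := by ring
    set p := v / 2 with hp
    have hp1 : 2 ^ i ≤ p := by omega
    have hp2 : p < 2 ^ (i + 1) := by omega
    have hpos : 0 < 2 ^ i := by positivity
    have hv2 : v < 2 ^ (h + 1) := by omega
    simp only [wp_seq, wp_wdiv, wp_wadd, wp_rload, wp_radd, wp_wload, wp_wmove,
      wp_ite, wp_skip, wp_rmove, Test.Holds]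
    simp only [setWord_word, setWord_real, setWord_warr, setWord_rarr, setReal_real, setReal_word,
      setReal_warr, setReal_rarr, hv, e5, a5, a6, a1, el']
    norm_num
    have b1 : p < W := by omega
    have b2 : p + p < W := by omega
    have b5 : p + p < s := by omega
    have hlow : p * 2 ^ (l + 1) = (p + p) * 2 ^ l := by ring
    refine ⟨b1, b2, fun hev => ⟨b1, by omega, hp1, hp2, gW, ?_⟩, fun hod => ⟨b5, ?_⟩⟩
    · rw [hlow, hev]; exact gS
    · have hvp : v = p + p + 1 := by omega
      -- The left sibling covers exactly the leaves before those of `v`.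
      have hsib : Seg (σ.rarr 5) (σ.rarr 6) (σ.warr 1) ((p + p) * 2 ^ l) (v * 2 ^ l) (σ.rarr 5 (p + p))
          (σ.rarr 6 (p + p)) (σ.warr 1 (p + p)) := by
        rw [hvp]
        refine seg_of_nodeOK hT.ok l (p + p) ?_ ?_ Nat.one_le_two_pow
        · have : 2 ^ h = 2 ^ (i + 1) * 2 ^ l := by rw [hl, pow_add]
          rw [this]; exact Nat.mul_le_mul_right _ (by omega)
        · have : 2 * 2 ^ h = 2 ^ (i + 1 + 1) * 2 ^ l := by rw [← eq, hl, ← pow_add]; congr 1; omega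
          rw [this]; exact Nat.mul_le_mul_right _ (by omega)
      have happ := hsib.append gS
      have ht := hT.tag (p + p) (by omega)
      refine ⟨fun hlt => ⟨⟨b5, ht⟩, b1, by omega, hp1, hp2, ht, ?_⟩, fun hlt => ⟨b1, by omega, hp1, hp2, gW, ?_⟩⟩
      · rw [max_eq_left hlt.le, if_pos hlt] at happ
        rw [hlow]; exact happ
      · rw [max_eq_right hlt, if_neg (not_lt.2 hlt)] at happ
        rw [hlow]; exact happ
  · rintro t i σ' ht hF ⟨gi, g1, g2, gW, gS⟩ hb
    have e3 : σ'.word 3 = 1 := (hF.w 3 (by decide)).trans (by simp [hc.w3])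
    simp only [Test.Holds, e3, not_lt] at hb
    have hi : i = 0 := by
      by_contra hne
      have := Nat.pow_le_pow_right (n := 2) (by norm_num) (Nat.one_le_iff_ne_zero.2 hne)
      omega
    subst hi
    have h10 : σ'.word 10 = 1 := by simp at g1; omega
    rw [h10] at gS
    refine ⟨by omega, gW, _, by simpa using gS⟩

/-- Reset the tree: all sums are `0`, all maxima the contents of the real register `16`. -/
def initTree : Prog :=
  .seq (.instr (.wconst 15 0)) <|
  forLoop 15 7
    (.seq (.instr (.rstore 17 5 15)) <|
     .seq (.instr (.rstore 16 6 15)) <|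
     .instr (.wstore 4 1 15))

lemma initTree_spec {h W s : ℕ} {σ : State} (hc : Consts h W s σ) :
    wp W s initTree σ fun t σ' => t ≤ 5 * 2 ^ (h + 1) + 2 ∧ Tree h W σ' ∧
      ∀ y, y < 2 ^ (h + 1) → σ'.rarr 5 y = 0 ∧ σ'.rarr 6 y = σ.real 16 ∧ σ'.warr 1 y = 0 := by
  have hlW := hc.lW
  have hls := hc.ls
  have hW0 : 0 < W := (Nat.zero_le _).trans_lt hlW
  unfold initTree
  rw [wp_seq, wp_wconst]
  refine ⟨by omega, ?_⟩
  refine wp_for (fun x σ' => ∀ y, y < x → σ'.rarr 5 y = 0 ∧ σ'.rarr 6 y = σ.real 16 ∧ σ'.warr 1 y = 0)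
    (fun _ => 3) (lo := 0) (hi := 2 ^ (h + 1)) (by simp) (by simp [hc.w7]) (by simp)
    (by simp [hc.w3]) hlW (by decide) (by decide) (by decide) (by simp) ?_ ?_
  · intro x σ' _ hx hF hi hI
    have e4 : σ'.word 4 = 0 := (hF.w 4 (by decide)).trans (by simp [hc.w4])
    have e16 : σ'.real 16 = σ.real 16 := (hF.r 16 (by decide)).trans (by simp)
    have e17 : σ'.real 17 = 0 := (hF.r 17 (by decide)).trans (by simp [hc.r17])
    simp [wp_seq, wp_rstore, wp_wstore, hi, e4, e16, e17]
    refine ⟨by omega, by omega, fun y hy => ?_⟩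
    by_cases hyx : y = x
    · simp [hyx]
    · simp only [Function.update_of_ne hyx]
      exact hI y (by omega)
  · intro t σ' ht hF hi hI
    simp at ht
    have eq : 2 ^ (h + 1) = 2 * 2 ^ h := by ring
    refine ⟨by omega, ⟨fun v h1 h2 => ?_, fun v hv => ?_⟩, hI⟩
    · obtain ⟨a1, a2, a3⟩ := hI v (by omega)
      obtain ⟨b1, b2, b3⟩ := hI (2 * v) (by omega)
      obtain ⟨c1, c2, c3⟩ := hI (2 * v + 1) (by omega)
      simp [NodeOK, *]
    · rw [(hI v hv).2.2]; omega

end RealRAM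

/-! ### Sorting by repeated extraction of the maximum -/

namespace RealRAM

/-- Recomputing the ancestors after a change of the leaf `x`. -/
lemma climb_leaf {h W s : ℕ} {σ σ' : State} (hT : Tree h W σ) (hc : Consts h W s σ') {x : ℕ}
    (hx : σ'.word 10 = x) (h1 : 2 ^ h ≤ x) (h2 : x < 2 ^ (h + 1))
    (hag : ∀ y, y ≠ x → σ'.rarr 5 y = σ.rarr 5 y ∧ σ'.rarr 6 y = σ.rarr 6 y ∧
      σ'.warr 1 y = σ.warr 1 y) (htag : σ'.warr 1 x < W) :
    wp W s climb σ' fun t σ'' => t ≤ 18 * h + 1 ∧ Tree h W σ'' ∧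
      ∀ y, 2 ^ h ≤ y → σ''.rarr 5 y = σ'.rarr 5 y ∧ σ''.rarr 6 y = σ'.rarr 6 y ∧
        σ''.warr 1 y = σ'.warr 1 y := by
  have hpos : 1 ≤ 2 ^ h := Nat.one_le_two_pow
  refine climb_spec hc hx (by omega) h2 (fun u h3 h4 h5 => ?_) (fun v hv => ?_)
  · refine (hT.ok u h3 h4).congr fun w hw => hag w ?_
    omega
  · by_cases hvx : v = x
    · rw [hvx]; exact htag
    · rw [(hag v hvx).2.2]; exact hT.tag v hv

/-- The first `m` cells of `f` list the indices below `m` by decreasing key. -/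
structure SortedIdx (m : ℕ) (key : ℕ → ℝ) (f : ℕ → ℕ) : Prop where
  lt : ∀ a, a < m → f a < m
  inj : ∀ a b, a < m → b < m → f a = f b → a = b
  le : ∀ a b, a < b → b < m → key (f b) ≤ key (f a)

lemma SortedIdx.surj {m : ℕ} {key : ℕ → ℝ} {f : ℕ → ℕ} (h : SortedIdx m key f) {i : ℕ}
    (hi : i < m) : ∃ a, a < m ∧ f a = i := by
  have := Finset.surj_on_of_inj_on_of_card_le (s := Finset.range m) (t := Finset.range m)
    (fun a _ => f a) (fun a ha => by simpa using h.lt a (by simpa using ha))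
    (fun a b ha hb hab => h.inj a b (by simpa using ha) (by simpa using hb) hab) le_rfl i
    (by simpa using hi)
  obtain ⟨a, ha, hai⟩ := this
  exact ⟨a, by simpa using ha, hai.symm⟩

/-- The real register `16` receives a strict lower bound of the keys. -/
def lowerBound (src : ℕ) : Prog :=
  .seq (.instr (.wconst 20 0)) <|
  .seq (.instr (.rconst 16 0)) <|
  .seq (forLoop 20 1
    (.seq (.instr (.rload 18 src 20)) <|
     .ite (.rlt 18 16) (.instr (.rmove 16 18)) .skip)) <|
  .seq (.instr (.rconst 18 1)) <|
  .instr (.rop .sub 16 16 18)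

/-- The running minimum may start at 0, since only a lower bound is needed; subtracting 1 makes it
strict. -/
lemma lowerBound_spec {h W s m src : ℕ} {σ : State} (hc : Consts h W s σ) (hm : σ.word 1 = m)
    (hms : m ≤ 2 ^ h) :
    wp W s (lowerBound src) σ fun t σ' => t ≤ 5 * m + 5 ∧
      ∀ i, i < m → σ'.real 16 < σ.rarr src i := by
  have hlW := hc.lW
  have hls := hc.ls
  have hW0 : 0 < W := (Nat.zero_le _).trans_lt hlW
  have hpos : 1 ≤ 2 ^ h := Nat.one_le_two_pow
  have eq : 2 ^ (h + 1) = 2 * 2 ^ h := by ring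
  unfold lowerBound
  rw [wp_seq, wp_wconst]
  refine ⟨hW0, ?_⟩
  rw [wp_seq, wp_rconst, wp_seq]
  refine wp_for (fun x σ' => ∀ i, i < x → σ'.real 16 ≤ σ.rarr src i)
    (fun _ => 3) (lo := 0) (hi := m) (by simp) (by simp [hm]) (by simp)
    (by simp [hc.w3]) (by omega) (by simp [Prog.collect, Instr.ww])
    (by simp [Prog.collect, Instr.ww]) (by simp [Prog.collect, Instr.ww]) (by simp) ?_ ?_
  · intro x σ' _ hx hF hi hI
    have ea : σ'.rarr src = σ.rarr src := (hF.ra src (by simp [forLoop, Prog.collect, Instr.raw])).trans (by simp)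
    simp only [wp_seq, wp_rload, wp_ite, wp_rmove, wp_skip, Test.Holds]
    simp [hi, ea]
    refine ⟨by omega, fun hlt i hi => ?_, fun hle i hi => ?_⟩
    · rcases Nat.lt_succ_iff_lt_or_eq.1 (Nat.lt_succ_of_le hi) with h' | h'
      · exact hlt.le.trans (hI i h')
      · rw [h']
    · rcases Nat.lt_succ_iff_lt_or_eq.1 (Nat.lt_succ_of_le hi) with h' | h'
      · exact hI i h'
      · rw [h']; exact hle
  · intro t σ' ht hF hi hI
    rw [wp_seq, wp_rconst, wp_rsub]
    simp at ht ⊢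
    refine ⟨by omega, fun i hi => ?_⟩
    have := hI i hi
    linarith

/-- Write the indices of the array `src` by decreasing contents into the word array `dst`. -/
def sortDesc (src dst : ℕ) : Prog :=
  .seq (lowerBound src) <|
  .seq initTree <|
  .seq (.instr (.wconst 20 0)) <|
  .seq (forLoop 20 1
    (.seq (.instr (.wop .add 10 6 20)) <|
     .seq (.instr (.rload 18 src 20)) <|
     .seq (.instr (.rstore 18 6 10)) <|
     .seq (.instr (.wstore 20 1 10)) <|
     climb)) <|
  .seq (.instr (.wconst 20 0)) <|
  forLoop 20 1
    (.seq (.instr (.wload 21 1 3)) <|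
     .seq (.instr (.wstore 21 dst 20)) <|
     .seq (.instr (.wop .add 10 6 21)) <|
     .seq (.instr (.rstore 16 6 10)) <|
     climb)

/-- With all sums equal to zero the root holds the largest leaf value together with the index of its
leaf, so the tree acts as a priority queue. An extracted leaf is lowered to a value below all keys
and is not chosen again. -/
lemma sortDesc_spec {h W s m src dst : ℕ} {σ : State} (hc : Consts h W s σ) (hm : σ.word 1 = m)
    (hms : m ≤ 2 ^ h) (hs5 : src ≠ 5) (hs6 : src ≠ 6) (hd : dst ≠ 1) :
    wp W s (sortDesc src dst) σ fun t σ' => t ≤ 60 * (2 ^ h * (h + 1)) ∧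
      SortedIdx m (σ.rarr src) (σ'.warr dst) := by
  have hlW := hc.lW
  have hls := hc.ls
  have hW0 : 0 < W := (Nat.zero_le _).trans_lt hlW
  have hpos : 1 ≤ 2 ^ h := Nat.one_le_two_pow
  have eq : 2 ^ (h + 1) = 2 * 2 ^ h := by ring
  unfold sortDesc
  rw [wp_seq]
  refine wp_call (lowerBound_spec (src := src) hc hm hms) ?_
  rintro t₁ σ₁ ⟨ht₁, hneg⟩ hF₁
  have hc₁ : Consts h W s σ₁ := hc.frame hF₁ (by simp [lowerBound, forLoop, Prog.collect, Instr.ww])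
    (by simp [lowerBound, forLoop, Prog.collect, Instr.rw])
  have hm₁ : σ₁.word 1 = m := (hF₁.w 1 (by simp [lowerBound, forLoop, Prog.collect, Instr.ww])).trans hm
  have hk₁ : σ₁.rarr src = σ.rarr src := hF₁.ra src (by simp [lowerBound, forLoop, Prog.collect, Instr.raw])
  rw [wp_seq]
  refine wp_call (initTree_spec hc₁) ?_
  rintro t₂ σ₂ ⟨ht₂, hT₂, hl₂⟩ hF₂
  have hc₂ : Consts h W s σ₂ := hc₁.frame hF₂ (by decide) (by decide)
  have hm₂ : σ₂.word 1 = m := (hF₂.w 1 (by decide)).trans hm₁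
  have hk₂ : σ₂.rarr src = σ.rarr src := (hF₂.ra src (by simp [initTree, forLoop, Prog.collect, Instr.raw, hs5, hs6])).trans hk₁
  have hn₂ : σ₂.real 16 = σ₁.real 16 := hF₂.r 16 (by decide)
  generalize hN : σ₁.real 16 = neg at *
  generalize hK : σ.rarr src = key at *
  rw [wp_seq, wp_wconst]
  refine ⟨hW0, ?_⟩
  rw [wp_seq]
  refine wp_for (fun x σ' => Tree h W σ' ∧ (∀ y, y < 2 ^ h → σ'.rarr 5 (2 ^ h + y) = 0 ∧
      σ'.rarr 6 (2 ^ h + y) = (if y < x then key y else neg) ∧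
      (y < x → σ'.warr 1 (2 ^ h + y) = y)))
    (fun _ => 18 * h + 5) (lo := 0) (hi := m) (by simp) (by simp [hm₂]) (by simp)
    (by simp [hc₂.w3]) (by omega) (by simp [Prog.collect, Instr.ww, climb])
    (by simp [Prog.collect, Instr.ww, climb]) (by simp [Prog.collect, Instr.ww, climb]) ?_ ?_ ?_
  · refine ⟨⟨hT₂.ok, hT₂.tag⟩, fun y hy => ?_⟩
    have := hl₂ (2 ^ h + y) (by omega)
    simp [this]
  · rintro x σ' _ hx hF hi ⟨hT, hl⟩
    have hc' : Consts h W s σ' := (hc₂.congr (σ' := σ₂.setWord 20 0) (fun r _ _ => by simp; omega) (by simp)).frame hF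
      (by simp [forLoop, climb, Prog.collect, Instr.ww]) (by simp [forLoop, climb, Prog.collect, Instr.rw])
    have hk' : σ'.rarr src = key := (hF.ra src (by simp [climb, forLoop, Prog.collect, Instr.raw, hs5, hs6])).trans (by simp [hk₂])
    simp only [wp_seq, wp_wadd, wp_rload, wp_rstore, wp_wstore]
    simp [hi, hc'.w6, hk']
    refine ⟨by omega, by omega, by omega, ⟨by omega, by omega⟩, ?_⟩
    refine wp_mono (climb_leaf (x := 2 ^ h + x) hT (hc'.congr (fun r _ _ => by simp; omega) (by simp)) (by simp) (by omega) (by omega) 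
      (fun y hy => by simp [hy]) (by simp; omega)) ?_
    rintro t σ'' ⟨ht, hT'', hl''⟩
    refine ⟨by omega, ⟨hT''.ok, hT''.tag⟩, fun y hy => ?_⟩
    obtain ⟨g1, g2, g3⟩ := hl'' (2 ^ h + y) (by omega)
    obtain ⟨k1, k2, k3⟩ := hl y hy
    rw [g1, g2, g3]
    by_cases hyx : y = x
    · subst hyx; simp [k1]
    · have : 2 ^ h + y ≠ 2 ^ h + x := by omega
      simp [hyx, k1, k2]
      refine ⟨?_, fun hle => k3 (by omega)⟩
      congr 1
      exact propext ⟨fun _ => by omega, fun _ => by omega⟩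
  · rintro t₃ σ₃ ht₃ hF₃ hi₃ ⟨hT₃, hl₃⟩
    have hc₃ : Consts h W s σ₃ := (hc₂.congr (σ' := σ₂.setWord 20 0) (fun r _ _ => by simp; omega) (by simp)).frame hF₃
      (by simp [forLoop, climb, Prog.collect, Instr.ww]) (by simp [forLoop, climb, Prog.collect, Instr.rw])
    have hm₃ : σ₃.word 1 = m := (hF₃.w 1 (by simp [climb, forLoop, Prog.collect, Instr.ww])).trans (by simp [hm₂])
    have hn₃ : σ₃.real 16 = neg := (hF₃.r 16 (by simp [climb, forLoop, Prog.collect, Instr.rw])).trans (by simp [hn₂])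
    rw [wp_seq, wp_wconst]
    refine ⟨hW0, ?_⟩
    -- The last clause, that an index not yet listed never has a larger key than a listed one, makes
    -- the next extraction continue the order.
    refine wp_for (fun x σ' => Tree h W σ' ∧ (∀ y, y < 2 ^ h → σ'.rarr 5 (2 ^ h + y) = 0 ∧
        (m ≤ y → σ'.rarr 6 (2 ^ h + y) = neg) ∧
        (y < m → σ'.warr 1 (2 ^ h + y) = y ∧
          ((∃ a, a < x ∧ σ'.warr dst a = y) → σ'.rarr 6 (2 ^ h + y) = neg) ∧
          ((∀ a, a < x → σ'.warr dst a ≠ y) → σ'.rarr 6 (2 ^ h + y) = key y))) ∧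
        (∀ a, a < x → σ'.warr dst a < m) ∧
        (∀ a b, a < b → b < x → σ'.warr dst a ≠ σ'.warr dst b ∧
          key (σ'.warr dst b) ≤ key (σ'.warr dst a)) ∧
        (∀ a i, a < x → i < m → (∀ b, b < x → σ'.warr dst b ≠ i) → key i ≤ key (σ'.warr dst a)))
      (fun _ => 18 * h + 5) (lo := 0) (hi := m) (by simp) (by simp [hm₃]) (by simp)
      (by simp [hc₃.w3]) (by omega) (by simp [Prog.collect, Instr.ww, climb])
      (by simp [Prog.collect, Instr.ww, climb]) (by simp [Prog.collect, Instr.ww, climb]) ?_ ?_ ?_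
    · refine ⟨⟨hT₃.ok, hT₃.tag⟩, fun y hy => ?_, by simp, by simp, by simp⟩
      obtain ⟨k1, k2, k3⟩ := hl₃ y hy
      refine ⟨k1, fun hmy => ?_, fun hym => ⟨k3 hym, by simp, fun _ => ?_⟩⟩
      · simpa [not_lt.2 hmy] using k2
      · simpa [hym] using k2
    · rintro x σ' _ hx hF hi ⟨hT, hl, hlt, hord, hrest⟩
      have hc' : Consts h W s σ' := (hc₃.congr (σ' := σ₃.setWord 20 0) (fun r _ _ => by simp; omega) (by simp)).frame hF
        (by simp [forLoop, climb, Prog.collect, Instr.ww]) (by simp [forLoop, climb, Prog.collect, Instr.rw])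
      have hn' : σ'.real 16 = neg := (hF.r 16 (by simp [climb, forLoop, Prog.collect, Instr.rw])).trans (by simp [hn₃])
      have hroot := seg_of_nodeOK hT.ok h 1 (by omega) (by omega) hpos
      rw [one_mul] at hroot
      obtain ⟨z, hz1, hz2, hz3, hz4⟩ := hroot.ex
      have hzero : ∀ z, 2 ^ h ≤ z → z < (1 + 1) * 2 ^ h → ∑ y ∈ Finset.Ico (z + 1) ((1 + 1) * 2 ^ h), σ'.rarr 5 y = 0 := by
        intro z hz _
        refine Finset.sum_eq_zero fun y hy => ?_
        rw [Finset.mem_Ico] at hy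
        have := (hl (y - 2 ^ h) (by omega)).1
        rwa [show 2 ^ h + (y - 2 ^ h) = y by omega] at this
      have hub : ∀ i, i < 2 ^ h → σ'.rarr 6 (2 ^ h + i) ≤ σ'.rarr 6 1 := fun i hi => by
        have := hroot.ub (2 ^ h + i) (by omega) (by omega)
        rwa [hzero _ (by omega) (by omega), add_zero] at this
      rw [hzero z hz1 hz2, add_zero] at hz3
      obtain ⟨g, rfl⟩ : ∃ g, z = 2 ^ h + g := ⟨z - 2 ^ h, by omega⟩
      -- By counting, some index is still unlisted, so the root exceeds the artificial lower bound.
      -- Its tag is therefore a genuine, unlisted index.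
      obtain ⟨i₀, hi₀, hfree⟩ : ∃ i, i < m ∧ ∀ a, a < x → σ'.warr dst a ≠ i := by
        by_contra! hcon
        have : (Finset.range m) ⊆ (Finset.range x).image (σ'.warr dst) := fun i hi => by
          obtain ⟨a, ha, he⟩ := hcon i (by simpa using hi)
          exact Finset.mem_image.2 ⟨a, by simpa using ha, he⟩
        have := (Finset.card_le_card this).trans Finset.card_image_le
        simp at this
        omega
      have hbig : neg < σ'.rarr 6 1 := by
        have := hub i₀ (by omega)
        rw [((hl i₀ (by omega)).2.2 hi₀).2.2 hfree] at this
        exact (hneg i₀ hi₀).trans_le this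
      obtain ⟨k1, k2, k3⟩ := hl g (by omega)
      have hgm : g < m := by
        by_contra hcon
        have := k2 (by omega)
        rw [hz3, this] at hbig
        exact lt_irrefl _ hbig
      obtain ⟨k3, k4, k5⟩ := k3 hgm
      have hgfree : ∀ a, a < x → σ'.warr dst a ≠ g := by
        intro a ha he
        have := k4 ⟨a, ha, he⟩
        rw [hz3, this] at hbig
        exact lt_irrefl _ hbig
      have hkey : σ'.rarr 6 1 = key g := by rw [hz3, k5 hgfree]
      have htag1 : σ'.warr 1 1 = g := by rw [hz4, k3]
      have h1d : (1 : ℕ) ≠ dst := hd.symm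
      simp only [wp_seq, wp_wadd, wp_wload, wp_rstore, wp_wstore]
      simp [hi, hc'.w6, hc'.w3, hn', htag1]
      refine ⟨⟨by omega, by omega⟩, ⟨by omega, by omega⟩, by omega, by omega, ?_⟩
      refine wp_call (climb_leaf (x := 2 ^ h + g) hT (hc'.congr (fun r _ _ => by interval_cases r <;> simp) (by simp)) (by simp) (by omega) (by omega)
        (fun y hy => by simp [hy, h1d]) (by simp [h1d]; exact hT.tag _ (by omega))) ?_
      rintro t σ'' ⟨ht, hT'', hl''⟩ hF''
      have hdst : σ''.warr dst = Function.update (σ'.warr dst) x g :=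
        (hF''.wa dst (by simp [climb, Prog.collect, Instr.waw, hd])).trans (by simp)
      have hd1 : ∀ a, a < x → σ''.warr dst a = σ'.warr dst a := fun a ha => by
        rw [hdst, Function.update_of_ne (by omega)]
      have hd2 : σ''.warr dst x = g := by rw [hdst]; simp
      refine ⟨by omega, ⟨hT''.ok, hT''.tag⟩, fun y hy => ?_, fun a ha => ?_, fun a b hab hb => ?_, fun a i ha him hfr => ?_⟩
      · obtain ⟨g1, g2, g3⟩ := hl'' (2 ^ h + y) (by omega)
        obtain ⟨l1, l2, l3⟩ := hl y hy
        rw [g1, g2, g3]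
        by_cases hyx : y = g
        · subst hyx
          simp [k1, h1d, k3]
          intro _ hcon
          exact absurd hd2 (hcon x le_rfl)
        · simp [hyx, l1, h1d]
          refine ⟨l2, fun hym => ⟨(l3 hym).1, fun a ha hay => (l3 hym).2.1 ?_, fun hfr => (l3 hym).2.2 fun a ha => ?_⟩⟩
          · rcases Nat.lt_or_eq_of_le ha with h' | rfl
            · exact ⟨a, h', by rw [← hd1 a h', hay]⟩
            · exact absurd (hay.symm.trans hd2) hyx
          · rw [← hd1 a ha]; exact hfr a ha.le
      · rcases Nat.lt_or_eq_of_le ha with h' | rfl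
        · rw [hd1 a h']; exact hlt a h'
        · rw [hd2]; exact hgm
      · rw [hd1 a (by omega)]
        rcases Nat.lt_or_eq_of_le hb with h' | rfl
        · rw [hd1 b h']; exact hord a b hab h'
        · rw [hd2]; exact ⟨hgfree a hab, hrest a g hab hgm hgfree⟩
      · have hfr' : ∀ b, b < x → σ'.warr dst b ≠ i := fun b hb => by
          rw [← hd1 b hb]; exact hfr b (by omega)
        rcases Nat.lt_or_eq_of_le ha with h' | rfl
        · rw [hd1 a h']; exact hrest a i h' him hfr'
        · rw [hd2, ← hkey, ← ((hl i (by omega)).2.2 him).2.2 hfr']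
          exact hub i (by omega)
    · rintro t₄ σ₄ ht₄ hF₄ hi₄ ⟨hT₄, hl₄, hlt, hord, hrest⟩
      refine ⟨?_, hlt, fun a b ha hb hab => ?_, fun a b hab hb => (hord a b hab hb).2⟩
      · simp only [Finset.sum_const, Nat.card_Ico, smul_eq_mul, tsub_zero] at ht₃ ht₄
        have : m * (18 * h + 5 + 2) ≤ 2 ^ h * (18 * h + 5 + 2) := Nat.mul_le_mul_right _ hms
        nlinarith [Nat.zero_le h]
      · rcases lt_trichotomy a b with h' | h' | h'
        · exact absurd hab (hord a b h' hb).1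
        · exact h'
        · exact absurd hab.symm (hord b a h' ha).1

end RealRAM

namespace RealRAM

/-! ### Binary search -/

open Classical in
/-- The number of keys that are at least `v`. -/
noncomputable def countGe (m : ℕ) (key : ℕ → ℝ) (f : ℕ → ℕ) (v : ℝ) : ℕ :=
  ((Finset.range m).filter fun j => v ≤ key (f j)).card

lemma countGe_eq {m : ℕ} {key : ℕ → ℝ} {f : ℕ → ℕ} {v : ℝ} {r : ℕ} (hr : r ≤ m)
    (h : ∀ j, j < m → (v ≤ key (f j) ↔ j < r)) : countGe m key f v = r := by
  classical
  unfold countGe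
  rw [show ((Finset.range m).filter fun j => v ≤ key (f j)) = Finset.range r from ?_]
  · simp
  · ext j
    simp only [Finset.mem_filter, Finset.mem_range]
    constructor
    · rintro ⟨h1, h2⟩; exact (h j h1).1 h2
    · intro h1; exact ⟨by omega, (h j (by omega)).2 h1⟩

/-- The keys do not increase along `f`, so those that are at least `v` form an initial segment, and
their number is its length. Ties need no care. -/
lemma SortedIdx.le_iff {m : ℕ} {key : ℕ → ℝ} {f : ℕ → ℕ} (hs : SortedIdx m key f) (v : ℝ) :
    countGe m key f v ≤ m ∧ ∀ j, j < m → (v ≤ key (f j) ↔ j < countGe m key f v) := by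
  classical
  have hex : ∃ r, m ≤ r ∨ key (f r) < v := ⟨m, Or.inl le_rfl⟩
  have hle : Nat.find hex ≤ m := Nat.find_min' hex (Or.inl le_rfl)
  have key' : ∀ j, j < m → (v ≤ key (f j) ↔ j < Nat.find hex) := by
    intro j hj
    constructor
    · intro h
      by_contra hcon
      rw [not_lt] at hcon
      rcases Nat.find_spec hex with h1 | h1
      · omega
      · rcases Nat.lt_or_eq_of_le hcon with h2 | h2
        · have := hs.le _ _ h2 hj
          linarith
        · rw [h2] at h1; linarith
    · intro h
      have := Nat.find_min hex h
      push Not at this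
      exact this.2
  rw [countGe_eq hle key']
  exact ⟨hle, key'⟩

/-- The word register `22` receives the number of keys in the sorted sequence that are at least the
contents of the real register `18`. -/
def search (src idx : ℕ) : Prog :=
  .seq (.instr (.wconst 22 0)) <|
  .seq (.instr (.wmove 23 1)) <|
  .loop (.wlt 22 23)
    (.seq (.instr (.wop .add 24 22 23)) <|
     .seq (.instr (.wop .div 24 24 5)) <|
     .seq (.instr (.wload 25 idx 24)) <|
     .seq (.instr (.rload 19 src 25)) <|
     .ite (.rle 18 19) (.instr (.wop .add 22 24 3)) (.instr (.wmove 23 24)))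

/-- Bisection: the keys before register 22 are known to be at least the value, those from register
23 on are known to be smaller, and with `i` iterations left the gap is less than `2 ^ i`. -/
lemma search_spec {h W s m src idx : ℕ} {σ : State} (hc : Consts h W s σ) (hm : σ.word 1 = m)
    (hms : m < 2 ^ h) (hs : SortedIdx m (σ.rarr src) (σ.warr idx)) :
    wp W s (search src idx) σ fun t σ' => t ≤ 7 * h + 3 ∧
      σ'.word 22 = countGe m (σ.rarr src) (σ.warr idx) (σ.real 18) := by
  have hlW := hc.lW
  have hls := hc.ls
  have hW0 : 0 < W := (Nat.zero_le _).trans_lt hlW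
  have eq : 2 ^ (h + 1) = 2 * 2 ^ h := by ring
  unfold search
  rw [wp_seq, wp_wconst]
  refine ⟨hW0, ?_⟩
  rw [wp_seq, wp_wmove]
  refine ⟨by simp [hm]; omega, ?_⟩
  refine wp_loop (fun i σ' => σ'.word 22 ≤ σ'.word 23 ∧ σ'.word 23 ≤ m ∧
    σ'.word 23 - σ'.word 22 < 2 ^ i ∧ (∀ j, j < σ'.word 22 → σ.real 18 ≤ σ.rarr src (σ.warr idx j)) ∧
    ∀ j, σ'.word 23 ≤ j → j < m → σ.rarr src (σ.warr idx j) < σ.real 18) 6 h ?_ ?_ ?_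
  · simp [hm, hms]
    intro j h1 h2; omega
  · rintro i σ' hF ⟨g1, g2, g3, g4, g5⟩ hb
    have e3 : σ'.word 3 = 1 := (hF.w 3 (by simp [Prog.collect, Instr.ww])).trans (by simp [hc.w3])
    have e5 : σ'.word 5 = 2 := (hF.w 5 (by simp [Prog.collect, Instr.ww])).trans (by simp [hc.w5])
    have ea : σ'.rarr src = σ.rarr src := (hF.ra src (by simp [Prog.collect, Instr.raw])).trans (by simp)
    have ei : σ'.warr idx = σ.warr idx := (hF.wa idx (by simp [Prog.collect, Instr.waw])).trans (by simp)
    have ev : σ'.real 18 = σ.real 18 := (hF.r 18 (by simp [Prog.collect, Instr.rw])).trans (by simp)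
    simp only [Test.Holds] at hb
    obtain ⟨i, rfl⟩ : ∃ j, i = j + 1 := by
      rcases i with _ | j
      · simp at g3; omega
      · exact ⟨j, rfl⟩
    refine ⟨i, rfl, ?_⟩
    rw [pow_succ] at g3
    simp only [wp_seq, wp_wadd, wp_wdiv, wp_wload, wp_rload, wp_ite, wp_wmove, Test.Holds]
    simp only [setWord_word, setWord_real, setWord_warr, setWord_rarr, setReal_real, setReal_word, e3, e5, ea, ei, ev]
    generalize σ'.word 22 = lo at *
    generalize σ'.word 23 = hi at *
    norm_num
    have hmid := hs.lt ((lo + hi) / 2) (by omega)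
    refine ⟨by omega, by omega, ⟨by omega, by omega⟩, by omega, fun hle => ⟨by omega, by omega, g2, by omega, fun j hj => ?_, g5⟩,
      fun hlt => ⟨by omega, by omega, by omega, by omega, g4, fun j hj hjm => ?_⟩⟩
    · rcases Nat.lt_or_eq_of_le (show j ≤ (lo + hi) / 2 by omega) with h' | h'
      · exact hle.trans (hs.le _ _ h' (by omega))
      · rw [h']; exact hle
    · rcases Nat.lt_or_eq_of_le hj with h' | h'
      · exact (hs.le _ _ h' hjm).trans_lt hlt
      · rw [← h']; exact hlt
  · rintro t i σ' ht hF ⟨g1, g2, g3, g4, g5⟩ hb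
    simp only [Test.Holds] at hb
    refine ⟨by omega, ?_⟩
    symm
    refine countGe_eq (by omega) fun j hj => ⟨fun hle => ?_, fun hlt => g4 j hlt⟩
    by_contra hcon
    exact absurd hle (not_le.2 (g5 j (by omega) hj))

/-! ### Ranks of the weighted points and their aggregation in cells -/

/-- Adding the weight `w` to a cell changes a weighted sum over the cells by one term. -/
lemma sum_cells_update {N c a b : ℕ} {CA CT : ℕ → ℕ} {CW : ℕ → ℝ} {w : ℝ} (hc : c < N)
    (h : CW c = 0 ∨ (CA c = a ∧ CT c = b)) (g : ℕ → ℕ → ℝ) :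
    ∑ x ∈ Finset.range N, g (Function.update CA c a x) (Function.update CT c b x) *
        Function.update CW c (CW c + w) x =
      ∑ x ∈ Finset.range N, g (CA x) (CT x) * CW x + g a b * w := by
  have hmem : c ∈ Finset.range N := by simpa using hc
  rw [← Finset.add_sum_erase _ _ hmem, ← Finset.add_sum_erase _ (fun x => g (CA x) (CT x) * CW x) hmem]
  rw [Finset.sum_congr rfl (g := fun x => g (CA x) (CT x) * CW x)]
  · simp only [Function.update_self]
    rcases h with h | ⟨h1, h2⟩
    · rw [h]; ring
    · rw [h1, h2]; ring
  · intro x hx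
    have : x ≠ c := (Finset.mem_erase.1 hx).1
    simp [Function.update_of_ne this]

/-- The column of a point with abscissa `v`. -/
noncomputable def colOf (m : ℕ) (key : ℕ → ℝ) (f : ℕ → ℕ) (v : ℝ) : ℕ := m + 1 - countGe m key f v

/-- Choose the number of cells: the word register `9` receives the number of cells, the word register
`26` tells whether the cells are pairs of ranks. -/
def chooseCells : Prog :=
  .seq (.instr (.wop .mul 9 8 8)) <|
  .ite (.wlt 0 9) (.seq (.instr (.wmove 9 0)) (.instr (.wconst 26 0))) (.instr (.wconst 26 1))

/-- Add the weight of the point in the word register `20` to its cell: word arrays `7` and `8` hold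
column and row of a cell, the real array `8` its weight. -/
def addToCell : Prog :=
  .seq (.instr (.rload 18 0 20)) <|
  .seq (search 3 2) <|
  .seq (.instr (.wop .sub 27 8 22)) <|
  .seq (.instr (.rload 18 1 20)) <|
  .seq (search 4 3) <|
  .seq (.instr (.wmove 28 22)) <|
  .seq (.ite (.weq 26 3)
    (.seq (.instr (.wop .mul 29 28 8)) <|
     .seq (.instr (.wop .add 29 29 27)) <|
     .instr (.wop .sub 29 29 3))
    (.instr (.wmove 29 20))) <|
  .seq (.instr (.wstore 27 7 29)) <|
  .seq (.instr (.wstore 28 8 29)) <|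
  .seq (.instr (.rload 18 2 20)) <|
  .seq (.instr (.rload 19 8 29)) <|
  .seq (.instr (.rop .add 19 19 18)) <|
  .instr (.rstore 19 8 29)

/-- Compute the ranks of the weighted points and aggregate the weights in the cells. -/
def aggregate : Prog :=
  .seq chooseCells <|
  .seq (.instr (.wconst 20 0)) <|
  forLoop 20 0 addToCell

/-- The shorter indexing is taken, one cell per point or one per pair of ranks. This is the origin
of the term m² in the running time. -/
lemma chooseCells_spec {W s n m : ℕ} {σ : State} (hn : σ.word 0 = n) (h8 : σ.word 8 = m + 1)
    (hmW : (m + 1) * (m + 1) < W) :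
    wp W s chooseCells σ fun t σ' => t ≤ 4 ∧ σ'.word 9 = min n ((m + 1) * (m + 1)) ∧
      (σ'.word 26 = 1 ∧ σ'.word 9 = (m + 1) * (m + 1) ∨ σ'.word 26 = 0 ∧ σ'.word 9 = n) := by
  have hW1 : 1 < W ∨ m = 0 := by
    rcases Nat.eq_zero_or_pos m with h | h
    · exact Or.inr h
    · left; nlinarith
  have hsq : 1 ≤ (m + 1) * (m + 1) := Nat.mul_pos (by omega) (by omega)
  unfold chooseCells
  by_cases hlt : n < (m + 1) * (m + 1)
  · simp [wp_seq, wp_wmul, wp_ite, wp_wmove, wp_wconst, Test.Holds, h8, hn, hlt]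
    omega
  · simp [wp_seq, wp_wmul, wp_ite, wp_wmove, wp_wconst, Test.Holds, h8, hn, hlt]
    omega

/-- Since columns range over 1, …, m + 1 and rows over 0, …, m, the number `b * (m + 1) + a - 1`
enumerates the pairs of ranks from 0 on. -/
lemma addToCell_spec {h W s m i a b c : ℕ} {σ : State} (hc : Consts h W s σ)
    (hm : σ.word 1 = m) (h8 : σ.word 8 = m + 1) (hms : m + 2 ≤ 2 ^ h) (hsW : s < W)
    (hmW : (m + 1) * (m + 1) < W) (hi : σ.word 20 = i) (his : i < s)
    (hX : SortedIdx m (σ.rarr 3) (σ.warr 2)) (hY : SortedIdx m (σ.rarr 4) (σ.warr 3))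
    (ha : a = colOf m (σ.rarr 3) (σ.warr 2) (σ.rarr 0 i))
    (hb : b = countGe m (σ.rarr 4) (σ.warr 3) (σ.rarr 1 i))
    (hcell : c = if σ.word 26 = 1 then b * (m + 1) + a - 1 else i) (hcs : c < s) :
    wp W s addToCell σ fun t σ' => t ≤ 14 * h + 21 ∧
      σ'.warr 7 = Function.update (σ.warr 7) c a ∧
      σ'.warr 8 = Function.update (σ.warr 8) c b ∧
      σ'.rarr 8 = Function.update (σ.rarr 8) c (σ.rarr 8 c + σ.rarr 2 i) := by
  have hlW := hc.lW
  have hls := hc.ls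
  have eq : 2 ^ (h + 1) = 2 * 2 ^ h := by ring
  have hbm : b ≤ m := hb ▸ (hY.le_iff _).1
  have ham : a ≤ m + 1 := by rw [ha, colOf]; omega
  unfold addToCell
  rw [wp_seq, wp_rload]
  refine ⟨by omega, ?_⟩
  rw [wp_seq]
  refine wp_call (search_spec (h := h) (m := m) (src := 3) (idx := 2)
    (hc.congr (fun r _ _ => by simp) (by simp)) (by simp [hm]) (by omega) (by simpa using hX)) ?_
  rintro t₁ σ₁ ⟨ht₁, hr₁⟩ hF₁
  simp only [setReal_rarr, setReal_warr, setReal_real, if_true, hi] at hr₁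
  have hc₁ : Consts h W s σ₁ := (hc.congr (fun r _ _ => by simp) (by simp)).frame hF₁
    (by decide) (by decide)
  have w₁ : ∀ r, r ∉ [22, 23, 24, 25] → σ₁.word r = σ.word r := fun r hr => by
    simpa using hF₁.w r (by simp at hr; simp [search, Prog.collect, Instr.ww]; tauto)
  have ra₁ : σ₁.rarr = σ.rarr := funext fun r => by
    simpa using hF₁.ra r (by simp [search, Prog.collect, Instr.raw])
  have wa₁ : σ₁.warr = σ.warr := funext fun r => by
    simpa using hF₁.wa r (by simp [search, Prog.collect, Instr.waw])
  rw [wp_seq, wp_wsub, w₁ 8 (by simp), h8, hr₁]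
  refine ⟨by omega, ?_⟩
  rw [wp_seq, wp_rload]
  refine ⟨by simp [w₁, hi]; omega, ?_⟩
  rw [wp_seq]
  refine wp_call (search_spec (h := h) (m := m) (src := 4) (idx := 3)
    (hc₁.congr (fun r _ _ => by simp; omega) (by simp)) (by simp [w₁, hm]) (by omega)
    (by simpa [ra₁, wa₁] using hY)) ?_
  rintro t₂ σ₂ ⟨ht₂, hr₂⟩ hF₂
  simp [w₁, hi, ra₁, wa₁, ← hb] at hr₂
  have w₂ : ∀ r, r ∉ [22, 23, 24, 25, 27] → σ₂.word r = σ.word r := fun r hr => by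
    have h1 := hF₂.w r (by simp at hr; simp [search, Prog.collect, Instr.ww]; tauto)
    have h2 := w₁ r (by simp at hr; simp; tauto)
    have : r ≠ 27 := by simp at hr; tauto
    simpa [h2, this] using h1
  have ra₂ : σ₂.rarr = σ.rarr := funext fun r => by
    simpa [ra₁] using hF₂.ra r (by simp [search, Prog.collect, Instr.raw])
  have wa₂ : σ₂.warr = σ.warr := funext fun r => by
    simpa [wa₁] using hF₂.wa r (by simp [search, Prog.collect, Instr.waw])
  have h27 : σ₂.word 27 = a := by
    rw [hF₂.w 27 (by decide), ha]
    simp [colOf]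
  have hbc : b * (m + 1) ≤ m * (m + 1) := Nat.mul_le_mul_right _ hbm
  have hmm : (m + 1) * (m + 1) = m * (m + 1) + (m + 1) := by ring
  simp only [wp_seq, wp_wmove, wp_ite, wp_wmul, wp_wadd, wp_wsub, wp_wstore, wp_rload, wp_radd,
    wp_rstore, Test.Holds]
  simp [hr₂, h27, w₂, ra₂, wa₂, hi, h8, hc.w3]
  refine ⟨by omega, fun hf => ?_, fun hf => ?_⟩
  · rw [if_pos hf] at hcell
    rw [← hcell]
    refine ⟨by omega, by omega, by omega, ⟨hcs, by omega⟩, ⟨hcs, by omega⟩, his, hcs, ?_, rfl, rfl, rfl⟩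
    omega
  · rw [if_neg hf] at hcell
    rw [hcell] at *
    refine ⟨by omega, ⟨his, by omega⟩, ⟨his, by omega⟩, his, ?_, rfl, rfl, rfl⟩
    omega

/-- Every point lies in the cell of its ranks; the cells carry the total weight of their points. -/
structure Aggregated (n m np : ℕ) (A T : ℕ → ℕ) (w : ℕ → ℝ) (CA CT : ℕ → ℕ) (CW : ℕ → ℝ) :
    Prop where
  col : ∀ c, c < np → CA c ≤ m + 1
  row : ∀ c, c < np → CT c ≤ m
  sum : ∀ g : ℕ → ℕ → ℝ, ∑ c ∈ Finset.range np, g (CA c) (CT c) * CW c =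
    ∑ i ∈ Finset.range n, g (A i) (T i) * w i

/-- The ranks stored in a cell are overwritten by every point that enters it. This is harmless
because a cell of nonzero weight either belongs to a single earlier point or has the number of its
own pair of ranks, so `sum_cells_update` applies. -/
lemma aggregate_spec {h W s n m : ℕ} {σ : State} (hc : Consts h W s σ) (hn : σ.word 0 = n)
    (hm : σ.word 1 = m) (h8 : σ.word 8 = m + 1) (hms : m + 2 ≤ 2 ^ h) (hns : n ≤ s) (hsW : s < W)
    (hmW : (m + 1) * (m + 1) < W)
    (hX : SortedIdx m (σ.rarr 3) (σ.warr 2)) (hY : SortedIdx m (σ.rarr 4) (σ.warr 3))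
    (h7 : σ.warr 7 = fun _ => 0) (h8' : σ.warr 8 = fun _ => 0) (hr8 : σ.rarr 8 = fun _ => 0) :
    wp W s aggregate σ fun t σ' => t ≤ 14 * (n * (h + 2)) + 7 ∧
      σ'.word 9 = min n ((m + 1) * (m + 1)) ∧
      Aggregated n m (σ'.word 9)
        (fun i => colOf m (σ.rarr 3) (σ.warr 2) (σ.rarr 0 i))
        (fun i => countGe m (σ.rarr 4) (σ.warr 3) (σ.rarr 1 i)) (σ.rarr 2)
        (σ'.warr 7) (σ'.warr 8) (σ'.rarr 8) := by
  have hlW := hc.lW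
  have hls := hc.ls
  have hW0 : 0 < W := (Nat.zero_le _).trans_lt hlW
  have eq : 2 ^ (h + 1) = 2 * 2 ^ h := by ring
  unfold aggregate
  rw [wp_seq]
  refine wp_call (chooseCells_spec hn h8 hmW) ?_
  rintro t₁ σ₁ ⟨ht₁, hnp, hfl⟩ hF₁
  rw [wp_seq, wp_wconst]
  refine ⟨hW0, ?_⟩
  have w₁ : ∀ r, r ∉ [9, 26] → σ₁.word r = σ.word r := fun r hr => by
    have := hF₁.w r (by simp at hr; simp [chooseCells, Prog.collect, Instr.ww]; tauto)
    simpa using this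
  have ra₁ : σ₁.rarr = σ.rarr := funext fun r => hF₁.ra r (by simp [chooseCells, Prog.collect, Instr.raw])
  have wa₁ : σ₁.warr = σ.warr := funext fun r => hF₁.wa r (by simp [chooseCells, Prog.collect, Instr.waw])
  have hc₁ : Consts h W s σ₁ := hc.frame hF₁ (by decide) (by decide)
  generalize hN : σ₁.word 9 = np at *
  set A : ℕ → ℕ := fun i => colOf m (σ.rarr 3) (σ.warr 2) (σ.rarr 0 i) with hA
  set T : ℕ → ℕ := fun i => countGe m (σ.rarr 4) (σ.warr 3) (σ.rarr 1 i) with hT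
  have hA1 : ∀ i, 1 ≤ A i ∧ A i ≤ m + 1 := fun i => by
    have := (hX.le_iff (σ.rarr 0 i)).1
    simp only [hA, colOf]; omega
  have hT1 : ∀ i, T i ≤ m := fun i => (hY.le_iff (σ.rarr 1 i)).1
  refine wp_for (fun x σ' => Aggregated x m np A T (σ.rarr 2) (σ'.warr 7) (σ'.warr 8) (σ'.rarr 8) ∧
      ∀ c, c < np → σ'.rarr 8 c = 0 ∨ (σ₁.word 26 = 0 → c < x) ∧
        (σ₁.word 26 = 1 → 1 ≤ σ'.warr 7 c ∧ c = σ'.warr 8 c * (m + 1) + σ'.warr 7 c - 1))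
    (fun _ => 14 * h + 21) (lo := 0) (hi := n) (by simp) (by simp [w₁, hn]) (by simp)
    (by simp [hc₁.w3]) (by omega) (by decide) (by decide) (by decide) ?_ ?_ ?_
  · refine ⟨⟨?_, ?_, ?_⟩, ?_⟩ <;> simp [wa₁, ra₁, h7, h8', hr8]
  · rintro x σ' _ hx hF hi ⟨⟨j1, j2, j3⟩, j4⟩
    have hc' : Consts h W s σ' := (hc₁.congr (σ' := σ₁.setWord 20 0) (fun r _ _ => by simp; omega) (by simp)).frame hF
      (by decide) (by decide)
    have hw : ∀ r, r ∈ [1, 8] → σ'.word r = σ.word r := fun r hr => by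
      fin_cases hr
      · rw [hF.w 1 (by decide)]; simp [w₁]
      · rw [hF.w 8 (by decide)]; simp [w₁]
    have h26 : σ'.word 26 = σ₁.word 26 := (hF.w 26 (by decide)).trans (by simp)
    have hra : ∀ r, r ≠ 8 → σ'.rarr r = σ.rarr r := fun r hr =>
      (hF.ra r (by simpa [forLoop, addToCell, search, Prog.collect, Instr.raw] using hr)).trans (by simp [ra₁])
    have hwa : ∀ r, r ≠ 7 → r ≠ 8 → σ'.warr r = σ.warr r := fun r hr hr' =>
      (hF.wa r (by simp [forLoop, addToCell, search, Prog.collect, Instr.waw, hr, hr'])).trans (by simp [wa₁])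
    have hcnp : (if σ'.word 26 = 1 then T x * (m + 1) + A x - 1 else x) < np := by
      have q1 := hA1 x
      have q2 := Nat.mul_le_mul_right (m + 1) (hT1 x)
      have hmm : (m + 1) * (m + 1) = m * (m + 1) + (m + 1) := by ring
      rw [h26]
      rcases hfl with ⟨f1, f2⟩ | ⟨f1, f2⟩
      · rw [if_pos f1]; omega
      · rw [if_neg (by omega)]; omega
    refine wp_mono (addToCell_spec (m := m) (i := x) (a := A x) (b := T x) hc' (by rw [hw 1 (by simp), hm])
      (by rw [hw 8 (by simp), h8]) hms hsW hmW hi (by omega)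
      (by rw [hra 3 (by simp), hwa 2 (by simp) (by simp)]; exact hX)
      (by rw [hra 4 (by simp), hwa 3 (by simp) (by simp)]; exact hY)
      (by rw [hra 3 (by simp), hwa 2 (by simp) (by simp), hra 0 (by simp)])
      (by rw [hra 4 (by simp), hwa 3 (by simp) (by simp), hra 1 (by simp)]) rfl (by omega)) ?_
    rintro t σ'' ⟨ht, k7, k8, kr⟩
    simp only [setWord_warr, setWord_rarr]
    rw [k7, k8, kr, hra 2 (by simp), h26]
    rw [h26] at hcnp
    generalize hcdef : (if σ₁.word 26 = 1 then T x * (m + 1) + A x - 1 else x) = c at *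
    have hold : σ'.rarr 8 c = 0 ∨ (σ'.warr 7 c = A x ∧ σ'.warr 8 c = T x) := by
      rcases j4 c hcnp with q | ⟨q1, q2⟩
      · exact Or.inl q
      · rcases hfl with ⟨f1, f2⟩ | ⟨f1, f2⟩
        · right
          rw [if_pos f1] at hcdef
          obtain ⟨q3, q4⟩ := q2 f1
          have p1 := hA1 x
          have p2 := j1 c hcnp
          -- Quotient and remainder modulo `m + 1` recover the row and the column from the number of
          -- the cell.
          have e1 : (m + 1) * σ'.warr 8 c + (σ'.warr 7 c - 1) = (m + 1) * T x + (A x - 1) := by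
            rw [Nat.mul_comm, Nat.mul_comm (m + 1) (T x)]; omega
          have e2 : σ'.warr 8 c = T x := by
            have := congrArg (· / (m + 1)) e1
            simpa [Nat.mul_add_div, Nat.div_eq_of_lt (show σ'.warr 7 c - 1 < m + 1 by omega),
              Nat.div_eq_of_lt (show A x - 1 < m + 1 by omega)] using this
          rw [e2] at e1
          exact ⟨by omega, e2⟩
        · rw [if_neg (by omega)] at hcdef
          have := q1 f1
          omega
    refine ⟨ht, ⟨fun d hd => ?_, fun d hd => ?_, fun g => ?_⟩, fun d hd => ?_⟩
    · by_cases hdc : d = c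
      · simp [hdc, (hA1 x).2]
      · simp [hdc, j1 d hd]
    · by_cases hdc : d = c
      · simp [hdc, hT1 x]
      · simp [hdc, j2 d hd]
    · rw [sum_cells_update hcnp hold g, j3 g, Finset.sum_range_succ]
    · by_cases hdc : d = c
      · right
        subst hdc
        simp only [Function.update_self]
        refine ⟨fun f => ?_, fun f => ⟨(hA1 x).1, ?_⟩⟩
        · rw [if_neg (by omega)] at hcdef; omega
        · rw [if_pos f] at hcdef; exact hcdef.symm
      · simp only [Function.update_of_ne hdc]
        rcases j4 d hd with q | ⟨q1, q2⟩
        · exact Or.inl q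
        · exact Or.inr ⟨fun f => by have := q1 f; omega, q2⟩
  · rintro t σ' ht hF hi ⟨hagg, _⟩
    have h9 : σ'.word 9 = np := (hF.w 9 (by decide)).trans (by simp [hN])
    simp only [Finset.sum_const, Nat.card_Ico, smul_eq_mul, tsub_zero] at ht
    rw [h9]
    refine ⟨?_, hnp, hagg⟩
    nlinarith [Nat.zero_le h, Nat.zero_le n]

end RealRAM

namespace RealRAM

/-! ### Buckets -/

/-- `p` heads a linked list with the elements `l`; pointers are shifted by one, `0` is the empty
list. -/
def IsList (nxt : ℕ → ℕ) : ℕ → List ℕ → Prop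
  | p, [] => p = 0
  | p, c :: l => p = c + 1 ∧ IsList nxt (nxt c) l

lemma IsList.congr {nxt nxt' : ℕ → ℕ} {p : ℕ} {l : List ℕ} (h : IsList nxt p l)
    (hl : ∀ c ∈ l, nxt' c = nxt c) : IsList nxt' p l := by
  induction l generalizing p with
  | nil => exact h
  | cons c l ih =>
    refine ⟨h.1, ?_⟩
    rw [hl c (by simp)]
    exact ih h.2 fun d hd => hl d (by simp [hd])

/-- The cells below `N` in the row `t`, in reverse order. -/
def bucket (CT : ℕ → ℕ) (N t : ℕ) : List ℕ := ((List.range N).filter fun c => CT c = t).reverse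

lemma bucket_succ (CT : ℕ → ℕ) (N t : ℕ) :
    bucket CT (N + 1) t = if CT N = t then N :: bucket CT N t else bucket CT N t := by
  unfold bucket
  rw [List.range_succ, List.filter_append, List.reverse_append]
  by_cases h : CT N = t <;> simp [h]

lemma mem_bucket {CT : ℕ → ℕ} {N t c : ℕ} : c ∈ bucket CT N t ↔ c < N ∧ CT c = t := by
  simp [bucket]

lemma bucket_nodup (CT : ℕ → ℕ) (N t : ℕ) : (bucket CT N t).Nodup := by
  simp [bucket, List.nodup_range.filter]

/-- Each cell lies in exactly one row. This amortizes a sweep: all removals of one layer together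
touch every cell once. -/
lemma sum_length_bucket {CT : ℕ → ℕ} {N M : ℕ} (h : ∀ c, c < N → CT c < M) :
    ∑ t ∈ Finset.range M, (bucket CT N t).length = N := by
  induction N with
  | zero => simp [bucket]
  | succ N ih =>
    have : ∀ t, (bucket CT (N + 1) t).length = (bucket CT N t).length + if CT N = t then 1 else 0 := by
      intro t
      rw [bucket_succ]
      split_ifs <;> simp
    simp only [this, Finset.sum_add_distrib]
    rw [ih fun c hc => h c (by omega)]
    simp [h N (by omega)]

/-- Distribute the cells over linked lists according to their rows: the word array `9` holds the
heads, the word array `10` the links. -/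
def buildBuckets : Prog :=
  .seq (.instr (.wconst 20 0)) <|
  forLoop 20 9
    (.seq (.instr (.wload 21 8 20)) <|
     .seq (.instr (.wload 22 9 21)) <|
     .seq (.instr (.wstore 22 10 20)) <|
     .seq (.instr (.wop .add 22 20 3)) <|
     .instr (.wstore 22 9 21))

/-- Pointers are shifted by one so that the zeroed array of heads represents empty lists. Pushing a
cell to the front matches `bucket_succ`; the bound on the heads keeps the words in range. -/
lemma buildBuckets_spec {h W s m np : ℕ} {σ : State} (hc : Consts h W s σ) (h9 : σ.word 9 = np)
    (hms : m + 2 ≤ 2 ^ h) (hns : np ≤ s) (hsW : s < W) (hrow : ∀ c, c < np → σ.warr 8 c ≤ m)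
    (hz : σ.warr 9 = fun _ => 0) :
    wp W s buildBuckets σ fun t σ' => t ≤ 7 * np + 2 ∧
      ∀ t, t ≤ m → IsList (σ'.warr 10) (σ'.warr 9 t) (bucket (σ.warr 8) np t) := by
  have hlW := hc.lW
  have hls := hc.ls
  have hW0 : 0 < W := (Nat.zero_le _).trans_lt hlW
  have eq : 2 ^ (h + 1) = 2 * 2 ^ h := by ring
  unfold buildBuckets
  rw [wp_seq, wp_wconst]
  refine ⟨hW0, ?_⟩
  refine wp_for (fun x σ' => ∀ t, t ≤ m → σ'.warr 9 t ≤ x ∧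
      IsList (σ'.warr 10) (σ'.warr 9 t) (bucket (σ.warr 8) x t))
    (fun _ => 5) (lo := 0) (hi := np) (by simp) (by simp [h9]) (by simp)
    (by simp [hc.w3]) (by omega) (by decide) (by decide) (by decide) ?_ ?_ ?_
  · intro t _
    simp [hz, bucket, IsList]
  · intro x σ' _ hx hF hi hI
    have e3 : σ'.word 3 = 1 := (hF.w 3 (by decide)).trans (by simp [hc.w3])
    have e8 : σ'.warr 8 = σ.warr 8 := (hF.wa 8 (by decide)).trans (by simp)
    have hr := hrow x hx
    simp only [wp_seq, wp_wload, wp_wstore, wp_wadd]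
    simp [hi, e3, e8]
    have hh := hI _ hr
    refine ⟨⟨by omega, by omega⟩, ⟨by omega, by omega⟩, ⟨by omega, by omega⟩, by omega,
      ⟨by omega, by omega⟩, fun t ht => ?_⟩
    rw [bucket_succ]
    have hne : ∀ t, ∀ c ∈ bucket (σ.warr 8) x t, 
        Function.update (σ'.warr 10) x (σ'.warr 9 (σ.warr 8 x)) c = σ'.warr 10 c := fun t c hc => by
      rw [mem_bucket] at hc
      rw [Function.update_of_ne (by omega)]
    by_cases htx : t = σ.warr 8 x
    · subst htx
      simp only [Function.update_self, if_true, le_refl, IsList, true_and]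
      exact hh.2.congr (hne _)
    · rw [Function.update_of_ne htx, if_neg (Ne.symm htx)]
      exact ⟨by have := (hI t ht).1; omega, (hI t ht).2.congr (hne _)⟩
  · intro t σ' ht hF hi hI
    simp at ht
    exact ⟨by omega, fun t ht => (hI t ht).2⟩

/-! ### Positions -/

/-- The word array `11` lists the positions (by abscissa) of the points by decreasing ordinate,
followed by the position of the final point. -/
def buildPositions : Prog :=
  .seq (.instr (.wconst 20 0)) <|
  .seq (forLoop 20 1
    (.seq (.instr (.wload 21 2 20)) <|
     .seq (.instr (.wop .sub 22 1 20)) <|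
     .instr (.wstore 22 4 21))) <|
  .seq (.instr (.wconst 20 0)) <|
  .seq (forLoop 20 1
    (.seq (.instr (.wload 21 3 20)) <|
     .seq (.instr (.wload 22 4 21)) <|
     .instr (.wstore 22 11 20))) <|
  .instr (.wstore 8 11 1)

/-- The abscissas are sorted decreasingly, so entry `j` of that order has position `m - j`. Array 4
inverts the order, and composing it with the order of the ordinates lists the positions by time. -/
lemma buildPositions_spec {h W s m : ℕ} {σ : State} {kx ky : ℕ → ℝ} (hc : Consts h W s σ)
    (hm : σ.word 1 = m) (h8 : σ.word 8 = m + 1) (hms : m + 2 ≤ 2 ^ h)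
    (hX : SortedIdx m kx (σ.warr 2)) (hY : SortedIdx m ky (σ.warr 3)) :
    wp W s buildPositions σ fun t σ' => t ≤ 10 * m + 5 ∧ σ'.warr 11 m = m + 1 ∧
      ∀ t, t < m → 1 ≤ σ'.warr 11 t ∧ σ'.warr 11 t ≤ m ∧
        σ.warr 2 (m - σ'.warr 11 t) = σ.warr 3 t := by
  have hlW := hc.lW
  have hls := hc.ls
  have hW0 : 0 < W := (Nat.zero_le _).trans_lt hlW
  have eq : 2 ^ (h + 1) = 2 * 2 ^ h := by ring
  unfold buildPositions
  rw [wp_seq, wp_wconst]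
  refine ⟨hW0, ?_⟩
  rw [wp_seq]
  refine wp_for (fun x σ' => ∀ j, j < x → σ'.warr 4 (σ.warr 2 j) = m - j)
    (fun _ => 3) (lo := 0) (hi := m) (by simp) (by simp [hm]) (by simp)
    (by simp [hc.w3]) (by omega) (by decide) (by decide) (by decide) (by simp) ?_ ?_
  · intro x σ' _ hx hF hi hI
    have e1 : σ'.word 1 = m := (hF.w 1 (by decide)).trans (by simp [hm])
    have e2 : σ'.warr 2 = σ.warr 2 := (hF.wa 2 (by decide)).trans (by simp)
    have hlt := hX.lt x hx
    simp only [wp_seq, wp_wload, wp_wstore, wp_wsub]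
    simp [hi, e1, e2]
    refine ⟨⟨by omega, by omega⟩, by omega, ⟨by omega, by omega⟩, fun j hj => ?_⟩
    rcases Nat.lt_or_eq_of_le hj with h' | h'
    · rw [Function.update_of_ne, hI j h']
      intro hcon
      have := hX.inj _ _ (by omega) hx hcon
      omega
    · rw [h', Function.update_self]
  · intro t₁ σ₁ ht₁ hF₁ hi₁ hI₁
    have f1 : σ₁.word 1 = m := (hF₁.w 1 (by decide)).trans (by simp [hm])
    have f8 : σ₁.word 8 = m + 1 := (hF₁.w 8 (by decide)).trans (by simp [h8])
    have f3 : σ₁.word 3 = 1 := (hF₁.w 3 (by decide)).trans (by simp [hc.w3])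
    have a3 : σ₁.warr 3 = σ.warr 3 := (hF₁.wa 3 (by decide)).trans (by simp)
    have hpos : ∀ t, t < m → ∃ j, j < m ∧ σ.warr 2 j = σ.warr 3 t ∧ σ₁.warr 4 (σ.warr 3 t) = m - j := by
      intro t ht
      obtain ⟨j, hj, hje⟩ := hX.surj (hY.lt t ht)
      exact ⟨j, hj, hje, by rw [← hje]; exact hI₁ j hj⟩
    rw [wp_seq, wp_wconst]
    refine ⟨hW0, ?_⟩
    rw [wp_seq]
    refine wp_for (fun x σ' => ∀ t, t < x → σ'.warr 11 t = σ₁.warr 4 (σ.warr 3 t))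
      (fun _ => 3) (lo := 0) (hi := m) (by simp) (by simp [f1]) (by simp)
      (by simp [f3]) (by omega) (by decide) (by decide) (by decide) (by simp) ?_ ?_
    · intro x σ' _ hx hF hi hI
      have e3 : σ'.warr 3 = σ.warr 3 := (hF.wa 3 (by decide)).trans (by simp [a3])
      have e4 : σ'.warr 4 = σ₁.warr 4 := (hF.wa 4 (by decide)).trans (by simp)
      have hlt := hY.lt x hx
      obtain ⟨j, hj, _, hje⟩ := hpos x hx
      simp only [wp_seq, wp_wload, wp_wstore]
      simp [hi, e3, e4]
      refine ⟨⟨by omega, by omega⟩, ⟨by omega, by omega⟩, ⟨by omega, by omega⟩, fun t ht => ?_⟩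
      rcases Nat.lt_or_eq_of_le ht with h' | h'
      · rw [Function.update_of_ne (by omega), hI t h']
      · rw [h', Function.update_self]
    · intro t₂ σ₂ ht₂ hF₂ hi₂ hI₂
      have k1 : σ₂.word 1 = m := (hF₂.w 1 (by decide)).trans (by simp [f1])
      have k8 : σ₂.word 8 = m + 1 := (hF₂.w 8 (by decide)).trans (by simp [f8])
      rw [wp_wstore]
      simp [k1, k8] at ht₁ ht₂ ⊢
      refine ⟨⟨by omega, by omega⟩, by omega, fun t ht => ?_⟩
      rw [Function.update_of_ne (by omega), hI₂ t ht]
      obtain ⟨j, hj, h1, h2⟩ := hpos t ht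
      rw [h2, ← h1, show m - (m - j) = j by omega]
      exact ⟨by omega, by omega, rfl⟩

/-- The real register `16` receives `-(1 + 2 ∑ |w|)`, where `w` runs over the weights of the
cells. -/
def buildPenalty : Prog :=
  .seq (.instr (.wconst 20 0)) <|
  .seq (.instr (.rconst 16 (-1))) <|
  forLoop 20 9
    (.seq (.instr (.rload 18 8 20)) <|
     .ite (.rle 17 18) (.seq (.instr (.rop .sub 16 16 18)) (.instr (.rop .sub 16 16 18)))
      (.seq (.instr (.rop .add 16 16 18)) (.instr (.rop .add 16 16 18))))

lemma buildPenalty_spec {h W s np : ℕ} {σ : State} (hc : Consts h W s σ) (h9 : σ.word 9 = np)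
    (hns : np ≤ s) (hsW : s < W) :
    wp W s buildPenalty σ fun t σ' => t ≤ 6 * np + 3 ∧
      σ'.real 16 = -(1 + 2 * ∑ c ∈ Finset.range np, |σ.rarr 8 c|) := by
  have hW0 : 0 < W := by omega
  unfold buildPenalty
  rw [wp_seq, wp_wconst]
  refine ⟨hW0, ?_⟩
  rw [wp_seq, wp_rconst]
  refine wp_for (fun x σ' => σ'.real 16 = -(1 + 2 * ∑ c ∈ Finset.range x, |σ.rarr 8 c|))
    (fun _ => 4) (lo := 0) (hi := np) (by simp) (by simp [h9]) (by simp)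
    (by simp [hc.w3]) (by omega) (by decide) (by decide) (by decide) (by simp) ?_ ?_
  · intro x σ' _ hx hF hi hI
    have e8 : σ'.rarr 8 = σ.rarr 8 := (hF.ra 8 (by decide)).trans (by simp)
    have e17 : σ'.real 17 = 0 := (hF.r 17 (by decide)).trans (by simp [hc.r17])
    simp only [wp_seq, wp_rload, wp_ite, wp_radd, wp_rsub, Test.Holds]
    simp [hi, e8, e17, hI, Finset.sum_range_succ]
    refine ⟨by omega, fun hle => ?_, fun hlt => ?_⟩
    · rw [abs_of_nonneg hle]; ring
    · rw [abs_of_neg hlt]; ring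
  · intro t σ' ht hF hi hI
    simp at ht
    exact ⟨by omega, hI⟩

end RealRAM

namespace MaxDominance

/-! ### Chains of positions

The points of `Q` have positions `1, …, m` by increasing abscissa and times `1, …, m` by decreasing
ordinate (`τ`); the position `0` is the start and the position `m + 1` the end of all chains. The
cells are the weighted points, given by column, row and weight. -/

/-- The data of an instance in terms of ranks. -/
structure Ranks where
  m : ℕ
  np : ℕ
  τ : ℕ → ℕ
  CA : ℕ → ℕ
  CT : ℕ → ℕ
  CW : ℕ → ℝ

namespace Ranks
variable (I : Ranks)

/-- The weight in the column `y` of the cells with row at least `r`. -/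
def col (r y : ℕ) : ℝ := ∑ c ∈ Finset.range I.np, if I.CA c = y ∧ r ≤ I.CT c then I.CW c else 0

/-- The additional weight that `x` dominates, if `x'` is its predecessor in a chain. -/
def cost (x' x : ℕ) : ℝ := ∑ y ∈ Finset.Ico (x' + 1) (x + 1), I.col (I.τ x) y

/-- The total absolute weight. -/
def tot : ℝ := ∑ c ∈ Finset.range I.np, |I.CW c|

/-- The absolute weight in a column. -/
def acol (y : ℕ) : ℝ := ∑ c ∈ Finset.range I.np, if I.CA c = y then |I.CW c| else 0

/-- The absolute weight in the columns up to `x`. -/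
def pot (x : ℕ) : ℝ := ∑ y ∈ Finset.range (x + 1), I.acol y

/-- The penalty. -/
def pen : ℝ := 1 + 2 * I.tot

lemma acol_nonneg (y : ℕ) : 0 ≤ I.acol y :=
  Finset.sum_nonneg fun c _ => by split_ifs <;> positivity

lemma pot_nonneg (x : ℕ) : 0 ≤ I.pot x := Finset.sum_nonneg fun y _ => I.acol_nonneg y

lemma tot_nonneg : 0 ≤ I.tot := Finset.sum_nonneg fun _ _ => abs_nonneg _

lemma pen_pos : 0 < I.pen := by have := I.tot_nonneg; unfold pen; linarith

lemma pot_le_tot (x : ℕ) : I.pot x ≤ I.tot := by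
  unfold pot acol tot
  rw [Finset.sum_comm]
  refine Finset.sum_le_sum fun c _ => ?_
  rw [Finset.sum_ite_eq]
  split_ifs
  · exact le_rfl
  · positivity

lemma abs_col_le (r y : ℕ) : |I.col r y| ≤ I.acol y := by
  refine (Finset.abs_sum_le_sum_abs _ _).trans (Finset.sum_le_sum fun c _ => ?_)
  by_cases h : I.CA c = y <;> by_cases h' : r ≤ I.CT c <;> simp [h, h']

lemma sum_acol {x' x : ℕ} (h : x' ≤ x) :
    ∑ y ∈ Finset.Ico (x' + 1) (x + 1), I.acol y = I.pot x - I.pot x' := by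
  rw [Finset.sum_Ico_eq_sub _ (by omega)]
  rfl

/-- Bounds by differences of `pot` telescope along a chain and also survive the removal of rows.
They keep every value at `x` below `pot x`. -/
lemma sum_col_le {x' x : ℕ} (r : ℕ) (h : x' ≤ x) :
    ∑ y ∈ Finset.Ico (x' + 1) (x + 1), I.col r y ≤ I.pot x - I.pot x' := by
  rw [← I.sum_acol h]
  exact Finset.sum_le_sum fun y _ => (le_abs_self _).trans (I.abs_col_le r y)

lemma le_cost {x' x : ℕ} (h : x' ≤ x) : -(I.pot x - I.pot x') ≤ I.cost x' x := by
  unfold cost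
  rw [← I.sum_acol h, ← Finset.sum_neg_distrib]
  exact Finset.sum_le_sum fun y _ => neg_le_of_abs_le (I.abs_col_le _ y)

/-- `I.Reach d c j x v`: a chain from `c` to `x` has the total cost `v`; it leaves `c` at layer `d` or
later and reaches `x` at the layer `j`. -/
inductive Reach (d c : ℕ) : ℕ → ℕ → ℝ → Prop
  | base (j : ℕ) (h : d ≤ j) : Reach d c j c 0
  | step (j x y : ℕ) (v : ℝ) (h : Reach d c j x v) (hxy : x < y) (ht : I.τ x < I.τ y) :
      Reach d c (j + 1) y (v + I.cost x y)

variable {I}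

lemma Reach.eq_or {d c j x : ℕ} {v : ℝ} (h : I.Reach d c j x v) :
    d ≤ j ∧ (x = c ∧ v = 0 ∨ c < x ∧ I.τ c < I.τ x ∧ d < j) := by
  induction h with
  | base j h => exact ⟨h, Or.inl ⟨rfl, rfl⟩⟩
  | step j x y v _ hxy ht ih =>
    rcases ih with ⟨h1, ⟨rfl, _⟩ | ⟨h2, h3, h4⟩⟩
    · exact ⟨by omega, Or.inr ⟨hxy, ht, by omega⟩⟩
    · exact ⟨by omega, Or.inr ⟨by omega, by omega, by omega⟩⟩

/-- By telescoping `le_cost`. A genuine chain is thus never worse than `-tot`, whereas a value that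
has absorbed a penalty is at most `-1 - tot`. -/
lemma Reach.ge {d c j x : ℕ} {v : ℝ} (h : I.Reach d c j x v) : -I.pot x ≤ v := by
  induction h with
  | base j h => simpa using I.pot_nonneg c
  | step j x y v _ hxy ht ih =>
    have := I.le_cost hxy.le
    linarith

variable (I) in
/-- The milestones `mil` of the chains under construction form a chain from `0` to `m + 1`, in which
`nx` is the successor. -/
structure Miles (mil : ℕ → Prop) (nx : ℕ → ℕ) : Prop where
  zero : mil 0
  last : mil (I.m + 1)
  le : ∀ c, mil c → c ≤ I.m + 1
  next : ∀ c, mil c → c ≠ I.m + 1 → mil (nx c) ∧ c < nx c ∧ I.τ c < I.τ (nx c)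
  sep : ∀ c c', mil c → mil c' → c < c' → nx c ≤ c' ∧ I.τ (nx c) ≤ I.τ c'

variable (I) in
/-- The position `x` lies between the milestone `c` and its successor. -/
structure Between (mil : ℕ → Prop) (nx : ℕ → ℕ) (c x : ℕ) : Prop where
  mil : mil c
  ne : c ≠ I.m + 1
  lt : c < x
  le : x ≤ nx c
  tlt : I.τ c < I.τ x
  tle : I.τ x ≤ I.τ (nx c)

/-- The layer at which chains may leave the milestone `c`. -/
def delay (δ c : ℕ) : ℕ := if c = 0 then δ else 0

open Classical in
variable (I) in
/-- The value of the leaf `y` of the tree at time `t` in the layer `j`. -/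
noncomputable def leafB (mil : ℕ → Prop) (nx : ℕ → ℕ) (δ j : ℕ) (F : ℕ → ℝ) (t y : ℕ) : ℝ :=
  if y = 0 then (if δ < j then 0 else -I.pen)
  else if I.τ y ≤ t ∧ mil y then 0
  else if I.τ y ≤ t ∧ ∃ c, I.Between mil nx c y then F y
  else -I.pen

open Classical in
variable (I) in
/-- The sum at the leaf `y` of the tree at time `t`, when the rows below `r` are removed. -/
noncomputable def leafS (mil : ℕ → Prop) (r t y : ℕ) : ℝ :=
  I.col r y - if 0 < y ∧ mil y ∧ I.τ y ≤ t then I.pen else 0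

open Classical in
/-- The tag of the leaf `y` of the tree. -/
noncomputable def leafG (mil : ℕ → Prop) (A : ℕ → ℕ) (y : ℕ) : ℕ :=
  if mil y then y else A y

variable (I) in
/-- What the tree query for `x'` contributes to the value at `x`. -/
noncomputable def contrib (mil : ℕ → Prop) (nx : ℕ → ℕ) (δ j : ℕ) (F : ℕ → ℝ) (x x' : ℕ) : ℝ :=
  I.leafB mil nx δ j F (I.τ x - 1) x' +
    ∑ y ∈ Finset.Ico (x' + 1) (x + 1), I.leafS mil (I.τ x) (I.τ x - 1) y

variable (I) in
/-- The value `f` and the tag `a` are the result of the layer `j` at the position `x`. -/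
def LayerAt (mil : ℕ → Prop) (nx : ℕ → ℕ) (δ h j : ℕ) (F : ℕ → ℝ) (A : ℕ → ℕ) (x : ℕ) (f : ℝ)
    (a : ℕ) : Prop :=
  (∃ x', x' ≤ x ∧ f = I.contrib mil nx δ j F x x' ∧ (j ≤ h → a = x) ∧
    (h < j → (x' = 0 ∨ I.τ x' < I.τ x ∧ (mil x' ∨ ∃ c, I.Between mil nx c x')) →
      a = leafG mil A x')) ∧
  ∀ x', x' ≤ x → I.contrib mil nx δ j F x x' ≤ f

variable (I) in
/-- A chain from `c` to `x` of cost `v` passes through `a` at the layer `h`. -/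
def Split (mil : ℕ → Prop) (nx : ℕ → ℕ) (δ h c j x : ℕ) (v : ℝ) (a : ℕ) : Prop :=
  (a = c ∧ I.Reach (delay δ c - h) c (j - h) x v) ∨
  (I.Between mil nx c a ∧ (h < j → a < x) ∧
    ∃ v₁ v₂, I.Reach (delay δ c) c h a v₁ ∧ I.Reach 0 a (j - h) x v₂ ∧ v = v₁ + v₂)

variable (I) in
/-- The values and tags after the layer `j`. -/
structure LayerInv (mil : ℕ → Prop) (nx : ℕ → ℕ) (δ h j : ℕ) (F : ℕ → ℝ) (A : ℕ → ℕ) : Prop where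
  up : ∀ c x v, I.Between mil nx c x → I.Reach (delay δ c) c j x v → v ≤ F x
  bd : ∀ c x, I.Between mil nx c x → F x ≤ I.pot x
  att : ∀ c x, I.Between mil nx c x → F x ≤ -I.pen + I.pot x ∨
    (I.Reach (delay δ c) c j x (F x) ∧ (h ≤ j → I.Split mil nx δ h c j x (F x) (A x)))

section Layer
variable {mil : ℕ → Prop} {nx : ℕ → ℕ} {δ h j : ℕ} {F : ℕ → ℝ} {A : ℕ → ℕ}

/-- A chain that has moved away from its milestone has used at least one layer, so at layer 0 all
values are penalized and nothing is claimed about the tags. -/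
lemma LayerInv.init (hF : ∀ c x, I.Between mil nx c x → F x = -I.pen) :
    I.LayerInv mil nx δ h 0 F A := by
  refine ⟨fun c x v hb hr => ?_, fun c x hb => ?_, fun c x hb => ?_⟩
  · have h1 := hr.eq_or
    have := hb.lt
    omega
  · rw [hF c x hb]
    have := I.pen_pos
    have := I.pot_nonneg x
    linarith
  · left
    rw [hF c x hb]
    have := I.pot_nonneg x
    linarith

lemma sum_leafS_le {r t x' x : ℕ} (h : x' ≤ x) :
    ∑ y ∈ Finset.Ico (x' + 1) (x + 1), I.leafS mil r t y ≤ I.pot x - I.pot x' := by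
  refine le_trans (Finset.sum_le_sum fun y _ => ?_) (I.sum_col_le r h)
  unfold leafS
  have := I.pen_pos
  split_ifs <;> linarith

/-- A milestone that the sweep has passed carries the penalty in its sum, and every predecessor to
its left sums over it. The milestone itself as predecessor does not, because the sums start one leaf
further right. -/
lemma sum_leafS_le_of_barrier {r t x' x b : ℕ} (h1 : x' < b) (h2 : b ≤ x) (hb : mil b)
    (ht : I.τ b ≤ t) :
    ∑ y ∈ Finset.Ico (x' + 1) (x + 1), I.leafS mil r t y ≤ -I.pen + (I.pot x - I.pot x') := by
  classical
  have hle : ∑ y ∈ Finset.Ico (x' + 1) (x + 1), I.leafS mil r t y ≤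
      ∑ y ∈ Finset.Ico (x' + 1) (x + 1), (I.col r y - if y = b then I.pen else 0) := by
    refine Finset.sum_le_sum fun y _ => ?_
    unfold leafS
    have := I.pen_pos
    by_cases hy : y = b
    · subst hy
      rw [if_pos ⟨by omega, hb, ht⟩, if_pos rfl]
    · rw [if_neg hy]
      split_ifs <;> linarith
  refine hle.trans ?_
  rw [Finset.sum_sub_distrib, Finset.sum_ite_eq', if_pos (by simp; omega)]
  have := I.sum_col_le r (show x' ≤ x by omega)
  linarith

/-- To the right of `c`, every further milestone has time at least that of `nx c`, hence at least
that of `x`. It has not been passed when `x` is visited, so no penalty enters. -/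
lemma sum_leafS_eq (hM : I.Miles mil nx) {c x x' : ℕ} (hb : I.Between mil nx c x) (hx : c ≤ x') :
    ∑ y ∈ Finset.Ico (x' + 1) (x + 1), I.leafS mil (I.τ x) (I.τ x - 1) y = I.cost x' x := by
  refine Finset.sum_congr rfl fun y hy => ?_
  rw [Finset.mem_Ico] at hy
  unfold leafS
  rw [if_neg, sub_zero]
  rintro ⟨_, h2, h3⟩
  have := hM.sep c y hb.mil h2 (by omega)
  have h4 := hb.tle
  have h5 := hb.tlt
  omega

/-- The predecessors that matter are the milestone and the active positions after it. -/
lemma contrib_cases (hj : 0 < j) (hM : I.Miles mil nx) (ht0 : I.τ 0 = 0) (hI : ∀ c x, I.Between mil nx c x → F x ≤ I.pot x)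
    {c x x' : ℕ} (hb : I.Between mil nx c x) (hx : x' ≤ x) :
    (x' = c ∧ delay δ c < j ∧ I.contrib mil nx δ j F x x' = I.cost c x) ∨
    (I.Between mil nx c x' ∧ x' < x ∧ I.τ x' < I.τ x ∧ ¬ mil x' ∧
      I.contrib mil nx δ j F x x' = F x' + I.cost x' x) ∨
    I.contrib mil nx δ j F x x' ≤ -I.pen + I.pot x := by
  have hpen := I.pen_pos
  have hpot := I.pot_nonneg x'
  have htx := hb.tlt
  -- First source of a penalty: the leaf of the predecessor is not active.
  have hg : I.leafB mil nx δ j F (I.τ x - 1) x' = -I.pen →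
      I.contrib mil nx δ j F x x' ≤ -I.pen + I.pot x := fun e => by
    unfold contrib
    rw [e]
    have := sum_leafS_le (I := I) (mil := mil) (r := I.τ x) (t := I.τ x - 1) hx
    linarith
  -- Second source: a milestone already passed separates the predecessor from `x`.
  have hbar : ∀ b, x' < b → b ≤ x → mil b → I.τ b < I.τ x →
      I.leafB mil nx δ j F (I.τ x - 1) x' ≤ I.pot x' →
      I.contrib mil nx δ j F x x' ≤ -I.pen + I.pot x := fun b h1 h2 h3 h4 e => by
    unfold contrib
    have := sum_leafS_le_of_barrier (I := I) (mil := mil) (r := I.τ x) (t := I.τ x - 1) h1 h2 h3 (by omega)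
    linarith
  by_cases hmil : mil x' ∧ I.τ x' < I.τ x
  · obtain ⟨hm, ht⟩ := hmil
    by_cases hxc : x' = c
    · subst hxc
      by_cases hd : delay δ x' < j
      · left
        refine ⟨rfl, hd, ?_⟩
        unfold contrib
        rw [sum_leafS_eq hM hb le_rfl]
        unfold leafB
        by_cases h0 : x' = 0
        · subst h0
          simp [delay] at hd
          simp [hd]
        · rw [if_neg h0, if_pos ⟨by omega, hm⟩, zero_add]
      · right; right
        apply hg
        have h0 : x' = 0 := by
          by_contra h0
          simp [delay, h0] at hd
          omega
        unfold leafB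
        rw [if_pos h0, if_neg]
        simpa [delay, h0] using hd
    · right; right
      have hlt : x' < c := by
        by_contra hcon
        have := hM.sep c x' hb.mil hm (by omega)
        have := hb.tle
        omega
      refine hbar c hlt hb.lt.le hb.mil hb.tlt ?_
      unfold leafB
      by_cases h0 : x' = 0
      · rw [if_pos h0]
        split_ifs <;> linarith
      · rw [if_neg h0, if_pos ⟨by omega, hm⟩]
        exact hpot
  · have h0 : x' ≠ 0 := by
      rintro rfl
      exact hmil ⟨hM.zero, by omega⟩
    by_cases hact : I.τ x' < I.τ x ∧ ∃ c', I.Between mil nx c' x'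
    · obtain ⟨ht, c', hb'⟩ := hact
      have hm : ¬ mil x' := fun h => hmil ⟨h, ht⟩
      have hB : I.leafB mil nx δ j F (I.τ x - 1) x' = F x' := by
        unfold leafB
        rw [if_neg h0, if_neg (by tauto), if_pos ⟨by omega, c', hb'⟩]
      rcases lt_trichotomy c' c with hlt | rfl | hlt
      -- A predecessor from an earlier segment lies to the left of `c`, and `c` has been passed.
      · right; right
        have h1 := hM.sep c' c hb'.mil hb.mil hlt
        have h2 := hb'.le
        have h3 : x' ≠ c := fun e => hm (e ▸ hb.mil)
        refine hbar c (by omega) hb.lt.le hb.mil hb.tlt ?_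
        rw [hB]
        exact hI c' x' hb'
      · right; left
        have hne : x' ≠ x := fun e => by rw [e] at ht; omega
        refine ⟨hb', by omega, ht, hm, ?_⟩
        unfold contrib
        rw [hB, sum_leafS_eq hM hb hb'.lt.le]
      -- A later segment begins after `x` in time, so none of its positions can be active yet.
      · exfalso
        have h1 := hM.sep c c' hb.mil hb'.mil hlt
        have h2 := hb.tle
        have h3 := hb'.tlt
        omega
    · right; right
      apply hg
      unfold leafB
      rw [if_neg h0, if_neg (fun hh => hmil ⟨hh.2, by omega⟩), if_neg (fun hh => hact ⟨by omega, hh.2⟩)]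

lemma Between.cases {c x y : ℕ} (hb : I.Between mil nx c y) (hx : c < x) (hxy : x ≤ y)
    (ht : I.τ c < I.τ x) (hty : I.τ x ≤ I.τ y) : I.Between mil nx c x :=
  ⟨hb.mil, hb.ne, hx, hxy.trans hb.le, ht, hty.trans hb.tle⟩

/-- For the bound `up`, the last step of a chain starts at `c` or at a position between `c` and its
successor, and there the query sees at least the value of the shorter chain. For `att`, the
maximizer of the query is classified by `contrib_cases`: it extends a genuine chain, or the result
is penalized. The tag is the position itself up to the layer `h` and is inherited from the maximizer
afterwards. -/
lemma LayerInv.step (hM : I.Miles mil nx) (ht0 : I.τ 0 = 0) (hI : I.LayerInv mil nx δ h j F A)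
    {F' : ℕ → ℝ} {A' : ℕ → ℕ}
    (hL : ∀ c x, I.Between mil nx c x → I.LayerAt mil nx δ h (j + 1) F A x (F' x) (A' x)) :
    I.LayerInv mil nx δ h (j + 1) F' A' := by
  have hpen := I.pen_pos
  refine ⟨fun c x v hb hr => ?_, fun c x hb => ?_, fun c x hb => ?_⟩
  · obtain ⟨_, hub⟩ := hL c x hb
    cases hr with
    | base _ _ => exact absurd hb.lt (lt_irrefl _)
    | step _ x₀ _ v₀ hr hlt ht =>
      refine le_trans ?_ (hub x₀ hlt.le)
      rcases hr.eq_or with ⟨hd, ⟨rfl, rfl⟩ | ⟨h1, h2, _⟩⟩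
      · unfold contrib
        rw [sum_leafS_eq hM hb le_rfl]
        gcongr
        unfold leafB
        by_cases h0 : x₀ = 0
        · subst h0
          simp only [delay, if_true] at hd
          rw [if_pos rfl, if_pos (by omega)]
        · rw [if_neg h0, if_pos ⟨by omega, hb.mil⟩]
      · have hb' := hb.cases h1 hlt.le h2 ht.le
        have hm : ¬ mil x₀ := fun hm => by
          have := hM.sep c x₀ hb.mil hm h1
          have := hb.le
          omega
        unfold contrib
        rw [sum_leafS_eq hM hb h1.le]
        gcongr
        unfold leafB
        rw [if_neg (by omega), if_neg (by tauto), if_pos ⟨by omega, c, hb'⟩]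
        exact hI.up c x₀ v₀ hb' hr
  · obtain ⟨⟨x', hx', hf, _, _⟩, _⟩ := hL c x hb
    rw [hf]
    rcases contrib_cases (δ := δ) (j := j + 1) (by omega) hM ht0 hI.bd hb hx' with ⟨_, _, e⟩ | ⟨hb', hlt, _, _, e⟩ | e
    · rw [e]
      have := I.sum_col_le (I.τ x) hb.lt.le
      have := I.pot_nonneg c
      unfold cost
      linarith
    · rw [e]
      have := I.sum_col_le (I.τ x) hlt.le
      have := hI.bd c x' hb'
      unfold cost
      linarith
    · linarith
  · obtain ⟨⟨x', hx', hf, hA1, hA2⟩, _⟩ := hL c x hb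
    rcases contrib_cases (δ := δ) (j := j + 1) (by omega) hM ht0 hI.bd hb hx' with ⟨rfl, hd, e⟩ | ⟨hb', hlt, htlt, hm, e⟩ | e
    · right
      rw [← hf] at e
      have hr : I.Reach (delay δ x') x' (j + 1) x (F' x) := by
        rw [e, ← zero_add (I.cost x' x)]
        exact .step _ _ _ _ (.base j (by omega)) hb.lt hb.tlt
      refine ⟨hr, fun hj => ?_⟩
      rcases Nat.lt_or_eq_of_le hj with hj | rfl
      -- The chain leaves `c` only in the last step, so at the layer `h` it still waits at `c`;
      -- accordingly the tag of a milestone is the milestone itself.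
      · left
        refine ⟨?_, ?_⟩
        · rw [hA2 hj (Or.inr ⟨hb.tlt, Or.inl hb.mil⟩), leafG, if_pos hb.mil]
        · rw [e, ← zero_add (I.cost x' x), show j + 1 - h = (j - h) + 1 by omega]
          exact .step _ _ _ _ (.base _ (by omega)) hb.lt hb.tlt
      -- This is the middle layer: the tag is the current position, and the second half of the chain
      -- is empty.
      · right
        rw [hA1 le_rfl]
        refine ⟨hb, fun hcon => absurd hcon (lt_irrefl _), F' x, 0, hr, ?_, by simp⟩
        rw [Nat.sub_self]
        exact .base _ le_rfl
    · rw [← hf] at e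
      -- A penalized value stays penalized, since a step adds at most the increase of `pot`.
      rcases hI.att c x' hb' with hgar | ⟨hr, hs⟩
      · left
        rw [e]
        have := I.sum_col_le (I.τ x) hlt.le
        unfold cost
        linarith
      · right
        have hr' : I.Reach (delay δ c) c (j + 1) x (F' x) := by
          rw [e]
          exact .step _ _ _ _ hr hlt htlt
        refine ⟨hr', fun hj => ?_⟩
        rcases Nat.lt_or_eq_of_le hj with hj | rfl
        · rw [hA2 hj (Or.inr ⟨htlt, Or.inr ⟨c, hb'⟩⟩), leafG, if_neg hm]
          rcases hs (by omega) with ⟨ha, hr1⟩ | ⟨hba, _, v₁, v₂, hr1, hr2, hv⟩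
          · left
            refine ⟨ha, ?_⟩
            rw [e, show j + 1 - h = (j - h) + 1 by omega]
            exact .step _ _ _ _ hr1 hlt htlt
          · right
            have hax := hr2.eq_or
            refine ⟨hba, fun _ => by omega, v₁, v₂ + I.cost x' x, hr1, ?_, ?_⟩
            · rw [show j + 1 - h = (j - h) + 1 by omega]
              exact .step _ _ _ _ hr2 hlt htlt
            · rw [e, hv, add_assoc]
        · right
          rw [hA1 le_rfl]
          refine ⟨hb, fun hcon => absurd hcon (lt_irrefl _), F' x, 0, hr', ?_, by simp⟩
          rw [Nat.sub_self]
          exact .base _ le_rfl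
    · left
      rw [hf]
      exact e

/-- If there is a chain at all, then the value is that of an optimal chain. -/
lemma LayerInv.exact {c x : ℕ} {v : ℝ} (hI : I.LayerInv mil nx δ h j F A)
    (hb : I.Between mil nx c x) (hr : I.Reach (delay δ c) c j x v) (hj : h ≤ j) :
    v ≤ F x ∧ I.Reach (delay δ c) c j x (F x) ∧ I.Split mil nx δ h c j x (F x) (A x) := by
  have h1 := hI.up c x v hb hr
  rcases hI.att c x hb with hgar | ⟨h2, h3⟩
  -- The penalized alternative gives `F x ≤ -1 - 2 * tot + pot x ≤ -1 - tot`, but a chain exists and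
  -- costs at least `-tot`.
  · exfalso
    have := hr.ge
    have := I.pot_le_tot x
    unfold pen at hgar
    linarith
  · exact ⟨h1, h2, h3 hj⟩

end Layer
end Ranks
end MaxDominance

/-! ### Unrolling a loop once -/

namespace RealRAM

lemma wp_loop_true {W s : ℕ} {σ : State} {b : Test} {c : Prog} {Q : ℕ → State → Prop}
    (hb : b.Holds σ)
    (h : wp W s c σ fun t σ' => wp W s (.loop b c) σ' fun u σ'' => Q (1 + t + u) σ'') :
    wp W s (.loop b c) σ Q := by
  obtain ⟨t, σ', hr, u, σ'', hr', hq⟩ := h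
  exact ⟨_, _, .loop_true _ _ _ _ _ _ _ hb hr hr', hq⟩

lemma wp_loop_false {W s : ℕ} {σ : State} {b : Test} {c : Prog} {Q : ℕ → State → Prop}
    (hb : ¬ b.Holds σ) (h : Q 1 σ) : wp W s (.loop b c) σ Q :=
  ⟨_, _, .loop_false _ _ _ hb, h⟩

end RealRAM

/-! ### Milestones in the order of time, and the removal of rows -/

namespace MaxDominance

namespace Ranks

/-- The times enumerate the positions. -/
structure Valid (I : Ranks) (PI : ℕ → ℕ) : Prop where
  tau_zero : I.τ 0 = 0
  pos : ∀ t, t ≤ I.m → 1 ≤ PI t ∧ PI t ≤ I.m + 1 ∧ I.τ (PI t) = t + 1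
  surj : ∀ x, 1 ≤ x → x ≤ I.m + 1 → ∃ t, t ≤ I.m ∧ PI t = x
  last : PI I.m = I.m + 1
  col : ∀ c, c < I.np → I.CA c ≤ I.m + 1
  row : ∀ c, c < I.np → I.CT c ≤ I.m

variable {I : Ranks} {PI : ℕ → ℕ}

lemma Valid.tau_pos (hV : I.Valid PI) {x : ℕ} (h1 : 1 ≤ x) (h2 : x ≤ I.m + 1) :
    1 ≤ I.τ x ∧ I.τ x ≤ I.m + 1 := by
  obtain ⟨t, ht, rfl⟩ := hV.surj x h1 h2
  rw [(hV.pos t ht).2.2]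
  omega

lemma Valid.tau_inj (hV : I.Valid PI) {x y : ℕ} (hx : x ≤ I.m + 1) (hy : y ≤ I.m + 1)
    (h : I.τ x = I.τ y) : x = y := by
  rcases Nat.eq_zero_or_pos x with rfl | hx0 <;> rcases Nat.eq_zero_or_pos y with rfl | hy0
  · rfl
  · have := hV.tau_pos hy0 hy
    rw [← h, hV.tau_zero] at this
    omega
  · have := hV.tau_pos hx0 hx
    rw [h, hV.tau_zero] at this
    omega
  · obtain ⟨t, ht, rfl⟩ := hV.surj x hx0 hx
    obtain ⟨u, hu, rfl⟩ := hV.surj y hy0 hy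
    rw [(hV.pos t ht).2.2, (hV.pos u hu).2.2] at h
    have : t = u := by omega
    rw [this]

lemma Valid.tau_last (hV : I.Valid PI) : I.τ (I.m + 1) = I.m + 1 := by
  have := (hV.pos I.m le_rfl).2.2
  rwa [hV.last] at this

/-- The times of consecutive milestones cut the time axis into disjoint half-open intervals, so the
time of `x` determines its segment. Hence the sweep needs to remember only one current milestone. -/
lemma Miles.unique {mil : ℕ → Prop} {nx : ℕ → ℕ} (hM : I.Miles mil nx) {c c' x : ℕ}
    (hb : I.Between mil nx c x) (hc' : mil c') (h1 : I.τ c' < I.τ x) (h2 : I.τ x ≤ I.τ (nx c')) :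
    c = c' := by
  have h3 := hb.tlt
  have h4 := hb.tle
  rcases lt_trichotomy c c' with h | h | h
  · have := hM.sep c c' hb.mil hc' h
    omega
  · exact h
  · have := hM.sep c' c hc' hb.mil h
    omega

/-- The milestone that the sweep meets next is the successor of the current one. -/
lemma Miles.eq_next {mil : ℕ → Prop} {nx : ℕ → ℕ} (hM : I.Miles mil nx) (hV : I.Valid PI)
    {c x : ℕ} (hc : mil c) (hne : c ≠ I.m + 1) (hx : mil x) (h1 : I.τ c < I.τ x)
    (h2 : I.τ x ≤ I.τ (nx c)) : x = nx c := by
  have hlt : c < x := by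
    by_contra hcon
    rcases Nat.lt_or_eq_of_le (not_lt.1 hcon) with h | rfl
    · have h3 := hM.sep x c hx hc h
      have h4 := hM.next x hx (by have := hM.le c hc; omega)
      omega
    · omega
  have h3 := hM.sep c x hc hx hlt
  exact hV.tau_inj (hM.le x hx) (hM.le _ (hM.next c hc hne).1) (by omega)

lemma col_succ (t y : ℕ) : I.col (t + 1) y = I.col t y -
    ((bucket I.CT I.np t).map fun c => if I.CA c = y then I.CW c else 0).sum := by
  have : ((bucket I.CT I.np t).map fun c => if I.CA c = y then I.CW c else 0).sum =
      ∑ c ∈ Finset.range I.np, if I.CT c = t then (if I.CA c = y then I.CW c else 0) else 0 := by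
    rw [← Finset.sum_filter, ← List.sum_toFinset _ (bucket_nodup _ _ _)]
    refine Finset.sum_congr ?_ fun _ _ => rfl
    ext c
    simp [mem_bucket]
  rw [this, col, col, ← Finset.sum_sub_distrib]
  refine Finset.sum_congr rfl fun c _ => ?_
  by_cases h1 : I.CA c = y
  · rcases lt_trichotomy (I.CT c) t with h | h | h
    · simp [h1, show ¬ t + 1 ≤ I.CT c by omega, show ¬ t ≤ I.CT c by omega, h.ne]
    · simp [h1, h]
    · simp [h1, show t + 1 ≤ I.CT c by omega, show t ≤ I.CT c by omega, h.ne']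
  · simp [h1]

end Ranks

/-! ### One layer on the machine -/

/-- The part of the memory that stays fixed after the preparation. -/
structure Env (I : Ranks) (h W s : ℕ) (σ : State) : Prop where
  consts : Consts h W s σ
  valid : I.Valid (σ.warr 11)
  w1 : σ.word 1 = I.m
  w8 : σ.word 8 = I.m + 1
  w9 : σ.word 9 = I.np
  CA : σ.warr 7 = I.CA
  CW : σ.rarr 8 = I.CW
  lists : ∀ t, t ≤ I.m → IsList (σ.warr 10) (σ.warr 9 t) (bucket I.CT I.np t)
  pen : σ.real 16 = -I.pen
  hm : I.m + 2 ≤ 2 ^ h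
  hnp : I.np ≤ s
  hsW : s < W

lemma Env.congr {I : Ranks} {h W s : ℕ} {σ σ' : State} (hE : Env I h W s σ)
    (hw : ∀ r ∈ [1, 3, 4, 5, 6, 7, 8, 9], σ'.word r = σ.word r)
    (hr : ∀ r ∈ [16, 17], σ'.real r = σ.real r)
    (hwa : ∀ r ∈ [7, 9, 10, 11], σ'.warr r = σ.warr r) (hra : σ'.rarr 8 = σ.rarr 8) :
    Env I h W s σ' := by
  refine ⟨hE.consts.congr (fun r _ _ => hw r (by interval_cases r <;> simp)) (hr 17 (by simp)), ?_, ?_, ?_, ?_, ?_, ?_, ?_, ?_, hE.hm, hE.hnp, hE.hsW⟩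
  · rw [hwa 11 (by simp)]; exact hE.valid
  · rw [hw 1 (by simp)]; exact hE.w1
  · rw [hw 8 (by simp)]; exact hE.w8
  · rw [hw 9 (by simp)]; exact hE.w9
  · rw [hwa 7 (by simp)]; exact hE.CA
  · rw [hra]; exact hE.CW
  · rw [hwa 10 (by simp), hwa 9 (by simp)]; exact hE.lists
  · rw [hr 16 (by simp)]; exact hE.pen

lemma Env.frame {I : Ranks} {h W s : ℕ} {σ σ' : State} {c : Prog} (hE : Env I h W s σ)
    (hF : Frame c σ σ') (hw : ∀ r ∈ [1, 3, 4, 5, 6, 7, 8, 9], r ∉ c.collect Instr.ww)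
    (hr : ∀ r ∈ [16, 17], r ∉ c.collect Instr.rw)
    (hwa : ∀ r ∈ [7, 9, 10, 11], r ∉ c.collect Instr.waw) (hra : 8 ∉ c.collect Instr.raw) :
    Env I h W s σ' :=
  hE.congr (fun r h => hF.w r (hw r h)) (fun r h => hF.r r (hr r h)) (fun r h => hF.wa r (hwa r h))
    (hF.ra 8 hra)

/-- Fill the tree with the column sums of all cells and activate the start. -/
def layerInit : Prog :=
  .seq initTree <|
  .seq (.instr (.wconst 20 0)) <|
  .seq (forLoop 20 9
    (.seq (.instr (.wload 10 7 20)) <|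
     .seq (.instr (.wop .add 10 6 10)) <|
     .seq (.instr (.rload 18 8 20)) <|
     .seq (.instr (.rload 19 5 10)) <|
     .seq (.instr (.rop .add 19 19 18)) <|
     .seq (.instr (.rstore 19 5 10)) <|
     climb)) <|
  .ite (.wlt 31 30)
    (.seq (.instr (.wmove 10 6)) <|
     .seq (.instr (.rstore 17 6 10)) <|
     climb)
    .skip

/-- A step into the layer `j` departs at the layer `j - 1`, and the start may be left from the layer
`δ` on; this is the condition `δ < j` for activating leaf 0. -/
lemma layerInit_spec {I : Ranks} {h W s δ j : ℕ} {σ : State} (hE : Env I h W s σ)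
    (hj : σ.word 30 = j) (hδ : σ.word 31 = δ) :
    wp W s layerInit σ fun t σ' => t ≤ I.np * (18 * h + 9) + 10 * 2 ^ h + 18 * h + 10 ∧
      Tree h W σ' ∧ ∀ y, y < 2 ^ h → σ'.rarr 5 (2 ^ h + y) = I.col 0 y ∧
        σ'.rarr 6 (2 ^ h + y) = (if y = 0 ∧ δ < j then 0 else -I.pen) ∧
        σ'.warr 1 (2 ^ h + y) = 0 := by
  have hc := hE.consts
  have hlW := hc.lW
  have hls := hc.ls
  have hW0 : 0 < W := (Nat.zero_le _).trans_lt hlW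
  have hpos : 1 ≤ 2 ^ h := Nat.one_le_two_pow
  have eq : 2 ^ (h + 1) = 2 * 2 ^ h := by ring
  have hm := hE.hm
  unfold layerInit
  rw [wp_seq]
  refine wp_call (initTree_spec hc) ?_
  rintro t₁ σ₁ ⟨ht₁, hT₁, hl₁⟩ hF₁
  have hE₁ : Env I h W s σ₁ := hE.frame hF₁ (by decide) (by decide) (by decide) (by decide)
  have a1 : σ₁.word 30 = j := (hF₁.w 30 (by decide)).trans hj
  have a2 : σ₁.word 31 = δ := (hF₁.w 31 (by decide)).trans hδ
  rw [wp_seq, wp_wconst]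
  refine ⟨hW0, ?_⟩
  rw [wp_seq]
  refine wp_for (fun x σ' => Tree h W σ' ∧ ∀ y, y < 2 ^ h →
      σ'.rarr 5 (2 ^ h + y) = ∑ c ∈ Finset.range x, (if I.CA c = y then I.CW c else 0) ∧
        σ'.rarr 6 (2 ^ h + y) = -I.pen ∧ σ'.warr 1 (2 ^ h + y) = 0)
    (fun _ => 18 * h + 7) (lo := 0) (hi := I.np) (by simp) (by simp [hE₁.w9]) (by simp)
    (by simp [hE₁.consts.w3]) (by have := hE.hnp; have := hE.hsW; omega) (by decide) (by decide) (by decide) ?_ ?_ ?_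
  · refine ⟨⟨hT₁.ok, hT₁.tag⟩, fun y hy => ?_⟩
    have := hl₁ (2 ^ h + y) (by omega)
    simp [this, hE.pen]
  · rintro x σ' _ hx hF hi ⟨hT, hl⟩
    have hE' : Env I h W s σ' := (hE₁.congr (σ' := σ₁.setWord 20 0) (fun r hr => by fin_cases hr <;> simp) (by simp) (by simp) (by simp)).frame hF
      (by decide) (by decide) (by decide) (by decide)
    have hcol := hE.valid.col x hx
    have hnp := hE.hnp
    have hsW := hE.hsW
    simp only [wp_seq, wp_wadd, wp_wload, wp_rload, wp_radd, wp_rstore]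
    simp [hi, hE'.consts.w6, hE'.CA, hE'.CW]
    refine ⟨⟨by omega, by omega⟩, by omega, by omega, by omega, ?_⟩
    refine wp_mono (climb_leaf (x := 2 ^ h + I.CA x) hT (hE'.consts.congr (fun r _ _ => by interval_cases r <;> simp) (by simp)) (by simp) (by omega) (by omega)
      (fun y hy => by simp [hy]) (by simp; exact hT.tag _ (by omega))) ?_
    rintro t σ'' ⟨ht, hT'', hl''⟩
    refine ⟨by omega, ⟨hT''.ok, hT''.tag⟩, fun y hy => ?_⟩
    obtain ⟨g1, g2, g3⟩ := hl'' (2 ^ h + y) (by omega)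
    obtain ⟨k1, k2, k3⟩ := hl y hy
    rw [g1, g2, g3, Finset.sum_range_succ, ← k1]
    by_cases hyx : I.CA x = y
    · subst hyx; simp [k2, k3]
    · simp [hyx, Ne.symm hyx, k2, k3]
  · rintro t₂ σ₂ ht₂ hF₂ hi₂ ⟨hT₂, hl₂⟩
    have hE₂ : Env I h W s σ₂ := (hE₁.congr (σ' := σ₁.setWord 20 0) (fun r hr => by fin_cases hr <;> simp) (by simp) (by simp) (by simp)).frame hF₂
      (by decide) (by decide) (by decide) (by decide)
    have b1 : σ₂.word 30 = j := (hF₂.w 30 (by decide)).trans (by simp [a1])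
    have b2 : σ₂.word 31 = δ := (hF₂.w 31 (by decide)).trans (by simp [a2])
    have hS : ∀ y, ∑ c ∈ Finset.range I.np, (if I.CA c = y then I.CW c else 0) = I.col 0 y := fun y => by simp [Ranks.col]
    simp only [Finset.sum_const, Nat.card_Ico, smul_eq_mul, tsub_zero] at ht₂
    have eT : 18 * h + 7 + 2 = 18 * h + 9 := by omega
    rw [eT] at ht₂
    simp only [wp_ite, wp_seq, wp_wmove, wp_rstore, wp_skip, Test.Holds, b1, b2]
    refine ⟨fun hlt => ?_, fun hlt => ?_⟩
    · simp [hE₂.consts.w6, hE₂.consts.r17]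
      refine ⟨by omega, by omega, ?_⟩
      refine wp_mono (climb_leaf (x := 2 ^ h) hT₂ (hE₂.consts.congr (fun r _ _ => by interval_cases r <;> simp) (by simp)) (by simp) (by omega) (by omega)
        (fun y hy => by simp [hy]) (by simp; exact hT₂.tag _ (by omega))) ?_
      rintro t σ'' ⟨ht, hT'', hl''⟩
      refine ⟨by omega, ⟨hT''.ok, hT''.tag⟩, fun y hy => ?_⟩
      obtain ⟨g1, g2, g3⟩ := hl'' (2 ^ h + y) (by omega)
      obtain ⟨k1, k2, k3⟩ := hl₂ y hy
      rw [g1, g2, g3]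
      by_cases hy0 : y = 0
      · subst hy0; simp at k1 k3; simp [k1, k3, hS, hlt]
      · simp [hy0, k1, k2, k3, hS]
    · refine ⟨by omega, ⟨hT₂.ok, hT₂.tag⟩, fun y hy => ?_⟩
      obtain ⟨k1, k2, k3⟩ := hl₂ y hy
      simp [k1, k2, k3, hS, hlt]

/-- Remove the cells of the row in the word register `35` from the tree. -/
def removeRow : Prog :=
  .seq (.instr (.wload 37 9 35)) <|
  .loop (.wlt 4 37)
    (.seq (.instr (.wop .sub 37 37 3)) <|
     .seq (.instr (.wload 10 7 37)) <|
     .seq (.instr (.wop .add 10 6 10)) <|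
     .seq (.instr (.rload 18 8 37)) <|
     .seq (.instr (.rload 19 5 10)) <|
     .seq (.instr (.rop .sub 19 19 18)) <|
     .seq (.instr (.rstore 19 5 10)) <|
     .seq (.instr (.wload 37 10 37)) <|
     climb)

lemma removeRow_spec {I : Ranks} {h W s t₀ : ℕ} {σ : State} (hE : Env I h W s σ)
    (hT : Tree h W σ) (ht : σ.word 35 = t₀) (htm : t₀ ≤ I.m) :
    wp W s removeRow σ fun t σ' => t ≤ (bucket I.CT I.np t₀).length * (18 * h + 10) + 2 ∧
      Tree h W σ' ∧ ∀ y, y < 2 ^ h →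
        σ'.rarr 5 (2 ^ h + y) = σ.rarr 5 (2 ^ h + y) - (I.col t₀ y - I.col (t₀ + 1) y) ∧
        σ'.rarr 6 (2 ^ h + y) = σ.rarr 6 (2 ^ h + y) ∧
        σ'.warr 1 (2 ^ h + y) = σ.warr 1 (2 ^ h + y) := by
  have hc := hE.consts
  have hlW := hc.lW
  have hls := hc.ls
  have hpos : 1 ≤ 2 ^ h := Nat.one_le_two_pow
  have eq : 2 ^ (h + 1) = 2 * 2 ^ h := by ring
  have hm := hE.hm
  have hnp := hE.hnp
  have hsW := hE.hsW
  have hle : ∀ p l, IsList (σ.warr 10) p l → (∀ c ∈ l, c < I.np) → p ≤ I.np := by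
    intro p l hl hlt
    cases l with
    | nil => rw [show p = 0 from hl]; omega
    | cons c l => have := hlt c (by simp); have := hl.1; omega
  have hlist := hE.lists t₀ htm
  have hmem : ∀ c ∈ bucket I.CT I.np t₀, c < I.np := fun c hc => (mem_bucket.1 hc).1
  have hcs : ∀ y, I.col t₀ y - I.col (t₀ + 1) y =
    ((bucket I.CT I.np t₀).map fun c => if I.CA c = y then I.CW c else 0).sum := fun y => by
      rw [Ranks.col_succ]; ring
  simp only [hcs]
  generalize bucket I.CT I.np t₀ = l at *
  unfold removeRow
  rw [wp_seq, wp_wload, ht]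
  refine ⟨⟨by omega, by have := hle _ _ hlist hmem; omega⟩, ?_⟩
  -- The loop follows a linked list, so the induction runs over the list that the pointer heads;
  -- this makes the time proportional to its length.
  have key : ∀ l (σ₁ : State), Env I h W s σ₁ → Tree h W σ₁ → σ₁.warr 10 = σ.warr 10 →
      IsList (σ.warr 10) (σ₁.word 37) l → (∀ c ∈ l, c < I.np) →
      wp W s (.loop (.wlt 4 37)
        (.seq (.instr (.wop .sub 37 37 3)) <|
         .seq (.instr (.wload 10 7 37)) <|
         .seq (.instr (.wop .add 10 6 10)) <|
         .seq (.instr (.rload 18 8 37)) <|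
         .seq (.instr (.rload 19 5 10)) <|
         .seq (.instr (.rop .sub 19 19 18)) <|
         .seq (.instr (.rstore 19 5 10)) <|
         .seq (.instr (.wload 37 10 37)) <|
         climb)) σ₁ fun t σ' => t ≤ l.length * (18 * h + 10) + 1 ∧
        Tree h W σ' ∧ ∀ y, y < 2 ^ h →
        σ'.rarr 5 (2 ^ h + y) = σ₁.rarr 5 (2 ^ h + y) - (l.map fun c => if I.CA c = y then I.CW c else 0).sum ∧
        σ'.rarr 6 (2 ^ h + y) = σ₁.rarr 6 (2 ^ h + y) ∧
        σ'.warr 1 (2 ^ h + y) = σ₁.warr 1 (2 ^ h + y) := by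
    clear hlist hmem hcs l
    intro l
    induction l with
    | nil =>
      intro σ₁ hE₁ hT₁ _ hl _
      have h0 : σ₁.word 37 = 0 := hl
      refine wp_loop_false (by simp [Test.Holds, h0]) ⟨by simp, hT₁, by simp⟩
    | cons c l ih =>
      intro σ₁ hE₁ hT₁ h10 hl hlt
      obtain ⟨hp, hl⟩ := hl
      have hcn := hlt c (by simp)
      have hcol := hE.valid.col c hcn
      have hnx := hle _ _ hl fun d hd => hlt d (by simp [hd])
      refine wp_loop_true (by simp [Test.Holds, hp, hE₁.consts.w4]) ?_
      simp only [wp_seq, wp_wadd, wp_wsub, wp_wload, wp_rload, wp_rsub, wp_rstore]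
      simp [hp, hE₁.consts.w3, hE₁.consts.w6, hE₁.CA, hE₁.CW, h10]
      refine ⟨by omega, ⟨by omega, by omega⟩, by omega, by omega, by omega, ⟨by omega, by omega⟩, ?_⟩
      refine wp_call (climb_leaf (x := 2 ^ h + I.CA c) hT₁ (hE₁.consts.congr (fun r _ _ => by interval_cases r <;> simp) (by simp)) (by simp) (by omega) (by omega)
        (fun y hy => by simp [hy]) (by simp; exact hT₁.tag _ (by omega))) ?_
      rintro t σ₂ ⟨ht, hT₂, hl₂⟩ hF₂
      have hE₂ : Env I h W s σ₂ := Env.frame (hE₁.congr (fun r hr => by fin_cases hr <;> simp) (fun r hr => by fin_cases hr <;> simp) (fun r hr => by fin_cases hr <;> simp) (by simp)) hF₂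
        (by decide) (by decide) (by decide) (by decide)
      refine wp_mono (ih σ₂ hE₂ hT₂ ((hF₂.wa 10 (by decide)).trans (by simp [h10])) ?_ fun d hd => hlt d (by simp [hd])) ?_
      · rw [hF₂.w 37 (by decide)]; simpa using hl
      · rintro t' σ' ⟨ht', hT', hl'⟩
        refine ⟨?_, hT', fun y hy => ?_⟩
        · have : (l.length + 1) * (18 * h + 10) = l.length * (18 * h + 10) + (18 * h + 10) := by ring
          omega
        · obtain ⟨k1, k2, k3⟩ := hl' y hy
          obtain ⟨g1, g2, g3⟩ := hl₂ (2 ^ h + y) (by omega)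
          rw [k1, k2, k3, g1, g2, g3]
          by_cases hyx : I.CA c = y
          · subst hyx; simp; ring
          · simp [hyx, Ne.symm hyx]
  refine wp_mono (key l _ (hE.congr (fun r hr => by fin_cases hr <;> simp) (by simp) (by simp) (by simp)) ⟨hT.ok, hT.tag⟩ (by simp) (by simpa using hlist) hmem) ?_
  rintro t σ' ⟨h1, h2, h3⟩
  exact ⟨by omega, h2, h3⟩

end MaxDominance

/-! ### The sweep through one layer -/

namespace MaxDominance

/-- The state of the sweep in a layer after the times up to `t` are processed and the rows below `r`
are removed. -/
structure SweepInv (I : Ranks) (h W : ℕ) (mil : ℕ → Prop) (nx : ℕ → ℕ) (δ g j : ℕ) (F : ℕ → ℝ)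
    (A : ℕ → ℕ) (r t : ℕ) (σ : State) : Prop where
  tree : Tree h W σ
  S : ∀ y, y ≤ I.m + 1 → σ.rarr 5 (2 ^ h + y) = I.leafS mil r t y
  B : ∀ y, y ≤ I.m + 1 → σ.rarr 6 (2 ^ h + y) = I.leafB mil nx δ j F t y
  G : ∀ y, y ≤ I.m + 1 → (y = 0 ∨ I.τ y ≤ t ∧ (mil y ∨ ∃ c, I.Between mil nx c y)) →
    σ.warr 1 (2 ^ h + y) = Ranks.leafG mil A y
  cur : t ≤ I.m → mil (σ.word 33) ∧ σ.word 33 ≠ I.m + 1 ∧ I.τ (σ.word 33) ≤ t ∧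
    t < I.τ (nx (σ.word 33)) ∧ σ.word 34 = nx (σ.word 33)
  res : ∀ c y, I.Between mil nx c y → I.τ y ≤ t →
    I.LayerAt mil nx δ g j F A y (σ.rarr 7 y) (σ.warr 5 y)
  keep : ∀ y, y ≤ I.m + 1 → (∀ c, I.Between mil nx c y → t < I.τ y) →
    σ.rarr 7 y = F y ∧ σ.warr 5 y = A y
  tag : ∀ y, y ≤ I.m + 1 → σ.warr 5 y < W

section
variable {I : Ranks} {h W s : ℕ} {mil : ℕ → Prop} {nx : ℕ → ℕ} {δ g j : ℕ} {F : ℕ → ℝ} {A : ℕ → ℕ}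
  {PI : ℕ → ℕ}

lemma Ranks.leafB_succ {t y : ℕ} (hy : I.τ y ≠ t + 1) :
    I.leafB mil nx δ j F (t + 1) y = I.leafB mil nx δ j F t y := by
  have : I.τ y ≤ t + 1 ↔ I.τ y ≤ t := by omega
  unfold Ranks.leafB
  split_ifs <;> first | rfl | (exfalso; tauto)

lemma Ranks.leafS_succ {r t y : ℕ} (hy : I.τ y ≠ t + 1) :
    I.leafS mil r (t + 1) y = I.leafS mil r t y := by
  have : I.τ y ≤ t + 1 ↔ I.τ y ≤ t := by omega
  unfold Ranks.leafS
  split_ifs <;> first | rfl | (exfalso; tauto)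

lemma Ranks.Between.le_last {c x : ℕ} (hM : I.Miles mil nx) (hb : I.Between mil nx c x) :
    x ≤ I.m + 1 := hb.le.trans (hM.le _ (hM.next c hb.mil hb.ne).1)

/-- A visit to the position `x` leads to the next state of the sweep. -/
lemma SweepInv.advance {t x c a : ℕ} {f : ℝ} {σ σ' : State} (hV : I.Valid PI) (hM : I.Miles mil nx)
    (hI : SweepInv I h W mil nx δ g j F A (t + 1) t σ) (hx : I.τ x = t + 1)
    (hb : I.Between mil nx c x) (hT : Tree h W σ')
    (hleaf : ∀ y, y ≤ I.m + 1 → y ≠ x → σ'.rarr 5 (2 ^ h + y) = σ.rarr 5 (2 ^ h + y) ∧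
      σ'.rarr 6 (2 ^ h + y) = σ.rarr 6 (2 ^ h + y) ∧ σ'.warr 1 (2 ^ h + y) = σ.warr 1 (2 ^ h + y))
    (hS : σ'.rarr 5 (2 ^ h + x) = I.leafS mil (t + 1) (t + 1) x)
    (hB : σ'.rarr 6 (2 ^ h + x) = I.leafB mil nx δ j F (t + 1) x)
    (hG : σ'.warr 1 (2 ^ h + x) = Ranks.leafG mil A x)
    (h7 : σ'.rarr 7 = Function.update (σ.rarr 7) x f)
    (h5 : σ'.warr 5 = Function.update (σ.warr 5) x a)
    (hL : I.LayerAt mil nx δ g j F A x f a) (ha : a < W)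
    (hcur : t + 1 ≤ I.m → mil (σ'.word 33) ∧ σ'.word 33 ≠ I.m + 1 ∧ I.τ (σ'.word 33) ≤ t + 1 ∧
      t + 1 < I.τ (nx (σ'.word 33)) ∧ σ'.word 34 = nx (σ'.word 33)) :
    SweepInv I h W mil nx δ g j F A (t + 1) (t + 1) σ' := by
  have hxm := hb.le_last hM
  have hne : ∀ y, y ≤ I.m + 1 → y ≠ x → I.τ y ≠ t + 1 := fun y hy hyx e =>
    hyx (hV.tau_inj hy hxm (e.trans hx.symm))
  refine ⟨hT, fun y hy => ?_, fun y hy => ?_, fun y hy hact => ?_, hcur, fun d y hd hy => ?_,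
    fun y hy hk => ?_, fun y hy => ?_⟩
  · by_cases hyx : y = x
    · rw [hyx, hS]
    · rw [(hleaf y hy hyx).1, hI.S y hy, Ranks.leafS_succ (hne y hy hyx)]
  · by_cases hyx : y = x
    · rw [hyx, hB]
    · rw [(hleaf y hy hyx).2.1, hI.B y hy, Ranks.leafB_succ (hne y hy hyx)]
  · by_cases hyx : y = x
    · rw [hyx, hG]
    · rw [(hleaf y hy hyx).2.2]
      refine hI.G y hy (hact.imp id fun h => ⟨?_, h.2⟩)
      have := hne y hy hyx
      omega
  · by_cases hyx : y = x
    · rw [hyx, h7, h5, Function.update_self, Function.update_self]; exact hL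
    · rw [h7, h5, Function.update_of_ne hyx, Function.update_of_ne hyx]
      have := hne y (hd.le_last hM) hyx
      exact hI.res d y hd (by omega)
  · have hyx : y ≠ x := by
      rintro rfl
      have := hk c hb
      omega
    rw [h7, h5, Function.update_of_ne hyx, Function.update_of_ne hyx]
    exact hI.keep y hy fun d hd => by have := hk d hd; omega
  · by_cases hyx : y = x
    · rw [hyx, h5, Function.update_self]; exact ha
    · rw [h5, Function.update_of_ne hyx]; exact hI.tag y hy

/-- A position between no milestones is passed over. -/
lemma SweepInv.skip {t x : ℕ} {σ : State} (hV : I.Valid PI) (hM : I.Miles mil nx)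
    (hI : SweepInv I h W mil nx δ g j F A (t + 1) t σ) (ht : t ≤ I.m) (hx : I.τ x = t + 1)
    (hxm : x ≤ I.m + 1) (hb : ¬ (σ.word 33 < x ∧ x ≤ σ.word 34)) :
    SweepInv I h W mil nx δ g j F A (t + 1) (t + 1) σ := by
  obtain ⟨c1, c2, c3, c4, c5⟩ := hI.cur ht
  rw [c5] at hb
  have hnb : ∀ c, ¬ I.Between mil nx c x := fun c hc => by
    have := hM.unique hc c1 (by omega) (by omega)
    subst this
    exact hb ⟨hc.lt, hc.le⟩
  have hnm : ¬ mil x := fun hm => by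
    have := hM.eq_next hV c1 c2 hm (by omega) (by omega)
    have h2 := hM.next _ c1 c2
    exact hb ⟨by omega, by omega⟩
  have hne : ∀ y, y ≤ I.m + 1 → y ≠ x → I.τ y ≠ t + 1 := fun y hy hyx e =>
    hyx (hV.tau_inj hy hxm (e.trans hx.symm))
  have hx0 : x ≠ 0 := by
    rintro rfl
    rw [hV.tau_zero] at hx
    omega
  refine ⟨hI.tree, fun y hy => ?_, fun y hy => ?_, fun y hy hact => ?_, fun ht' => ?_, fun d y hd hy => ?_,
    fun y hy hk => ?_, hI.tag⟩
  · rw [hI.S y hy]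
    by_cases hyx : y = x
    · simp [Ranks.leafS, hyx, hnm]
    · rw [Ranks.leafS_succ (hne y hy hyx)]
  · rw [hI.B y hy]
    by_cases hyx : y = x
    · simp [Ranks.leafB, hyx, hnm, hnb]
    · rw [Ranks.leafB_succ (hne y hy hyx)]
  · refine hI.G y hy (hact.imp id fun h => ⟨?_, h.2⟩)
    have hyx : y ≠ x := by
      rintro rfl
      rcases hact with h | ⟨_, h | ⟨c, h⟩⟩
      · exact hx0 h
      · exact hnm h
      · exact hnb c h
    have := hne y hy hyx
    omega
  · refine ⟨c1, c2, by omega, ?_, c5⟩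
    rcases Nat.lt_or_eq_of_le (show t + 1 ≤ I.τ (nx (σ.word 33)) by omega) with h | h
    · exact h
    · exfalso
      have h2 := hM.next _ c1 c2
      have := hV.tau_inj hxm (hM.le _ h2.1) (hx.trans h)
      exact hb ⟨by omega, by omega⟩
  · have hyx : y ≠ x := by
      rintro rfl
      exact hnb d hd
    have := hne y (hd.le_last hM) hyx
    exact hI.res d y hd (by omega)
  · exact hI.keep y hy fun d hd => by have := hk d hd; omega

/-- Update the tree and store the results of the query. -/
def finishVisit : Prog :=
  .seq climb <|
  .seq (.instr (.rstore 14 7 36)) <|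
  .ite (.wlt 32 30) (.instr (.wstore 14 5 36)) (.instr (.wstore 36 5 36))

/-- Advance the sweep to the time in the word register `35`. -/
def visit : Prog :=
  .seq (.instr (.wload 36 11 35)) <|
  .ite (.wlt 33 36)
    (.ite (.wlt 34 36) .skip
      (.seq (.instr (.wop .add 10 6 36)) <|
       .seq query <|
       .seq (.instr (.wop .add 10 6 36)) <|
       .seq (.ite (.weq 36 34)
         (.seq (.instr (.rload 18 5 10)) <|
          .seq (.instr (.rop .add 18 18 16)) <|
          .seq (.instr (.rstore 18 5 10)) <|
          .seq (.instr (.rstore 17 6 10)) <|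
          .seq (.instr (.wstore 36 1 10)) <|
          .seq (.instr (.wmove 33 34)) <|
          .instr (.wload 34 6 34))
         (.seq (.instr (.rload 18 7 36)) <|
          .seq (.instr (.rstore 18 6 10)) <|
          .seq (.instr (.wload 13 5 36)) <|
          .instr (.wstore 13 1 10))) <|
       finishVisit))
    .skip

/-- The result of a tree query. -/
lemma SweepInv.layerAt {t x gv : ℕ} {sv bv : ℝ} {σ : State}
    (hI : SweepInv I h W mil nx δ g j F A (t + 1) t σ) (hx : I.τ x = t + 1) (hxm : x ≤ I.m + 1)
    (hs : Seg (σ.rarr 5) (σ.rarr 6) (σ.warr 1) (2 ^ h) (2 ^ h + x + 1) sv bv gv) :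
    I.LayerAt mil nx δ g j F A x bv (if g < j then gv else x) := by
  have hval : ∀ x', x' ≤ x → σ.rarr 6 (2 ^ h + x') +
      ∑ y ∈ Finset.Ico (2 ^ h + x' + 1) (2 ^ h + x + 1), σ.rarr 5 y = I.contrib mil nx δ j F x x' := by
    intro x' hx'
    unfold Ranks.contrib
    rw [hx, Nat.add_sub_cancel, hI.B x' (by omega), add_assoc, add_assoc, 
      add_comm (2 ^ h) (x' + 1), add_comm (2 ^ h) (x + 1), ← Finset.sum_Ico_add]
    congr 1
    refine Finset.sum_congr rfl fun y hy => ?_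
    rw [Finset.mem_Ico] at hy
    exact hI.S y (by omega)
  refine ⟨?_, fun x' hx' => ?_⟩
  · obtain ⟨z, h1, h2, h3, h4⟩ := hs.ex
    obtain ⟨x', rfl⟩ : ∃ x', z = 2 ^ h + x' := ⟨z - 2 ^ h, by omega⟩
    refine ⟨x', by omega, by rw [h3, hval x' (by omega)], fun hj => if_neg (by omega), fun hj hact => ?_⟩
    rw [if_pos hj, h4]
    refine hI.G x' (by omega) (hact.imp id fun h => ⟨by omega, h.2⟩)
  · rw [← hval x' hx']
    exact hs.ub _ (by omega) (by omega)

/-- One table serves the old and the new layer: the entry at `x` is still the old one when `x` is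
visited (`keep`), it is copied into the tree, and only then overwritten by the result of the query.
Positions outside the current segment are skipped. -/
lemma visit_spec {t₀ : ℕ} {σ : State} (hE : Env I h W s σ) (hM : I.Miles mil nx)
    (hI : SweepInv I h W mil nx δ g j F A (t₀ + 1) t₀ σ) (ht : σ.word 35 = t₀) (htm : t₀ ≤ I.m)
    (hj : σ.word 30 = j) (hg : σ.word 32 = g) (hnx : σ.warr 6 = nx)
    (hnxW : ∀ y, y ≤ I.m + 1 → nx y < W) :
    wp W s visit σ fun t σ' => t ≤ 30 * h + 24 ∧
      SweepInv I h W mil nx δ g j F A (t₀ + 1) (t₀ + 1) σ' := by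
  have hc := hE.consts
  have hlW := hc.lW
  have hls := hc.ls
  have hpos : 1 ≤ 2 ^ h := Nat.one_le_two_pow
  have eq : 2 ^ (h + 1) = 2 * 2 ^ h := by ring
  have hm := hE.hm
  have hV := hE.valid
  obtain ⟨p1, p2, p3⟩ := hV.pos t₀ htm
  obtain ⟨c1, c2, c3, c4, c5⟩ := hI.cur htm
  obtain ⟨n1, n2, n3⟩ := hM.next _ c1 c2
  have n4 := hM.le _ n1
  unfold visit
  rw [wp_seq, wp_wload, ht]
  generalize hxdef : σ.warr 11 t₀ = x at *
  refine ⟨⟨by omega, by omega⟩, ?_⟩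
  have hI₁ : SweepInv I h W mil nx δ g j F A (t₀ + 1) t₀ (σ.setWord 36 x) :=
    ⟨⟨hI.tree.ok, hI.tree.tag⟩, hI.S, hI.B, hI.G, by simpa using hI.cur, hI.res, hI.keep, hI.tag⟩
  rw [wp_ite]
  simp only [Test.Holds, setWord_word]
  norm_num
  refine ⟨fun hlt => ?_, fun hle => ?_⟩
  swap
  · rw [wp_skip]
    exact ⟨by omega, hI₁.skip hV hM htm p3 p2 (by simp; omega)⟩
  rw [wp_ite]
  simp only [Test.Holds, setWord_word]
  norm_num
  refine ⟨fun hlt' => ?_, fun hle => ?_⟩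
  · rw [wp_skip]
    exact ⟨by omega, hI₁.skip hV hM htm p3 p2 (by simp; omega)⟩
  have hb : I.Between mil nx (σ.word 33) x := ⟨c1, c2, hlt, by omega, by omega, by omega⟩
  have hE₁ : Env I h W s (σ.setWord 36 x) := hE.congr (fun r hr => by fin_cases hr <;> simp) (by simp) (by simp) (by simp)
  rw [wp_seq, wp_wadd]
  simp only [setWord_word]
  norm_num
  rw [hc.w6]
  refine ⟨by omega, ?_⟩
  rw [wp_seq]
  have hE₂ : Env I h W s ((σ.setWord 36 x).setWord 10 (2 ^ h + x)) := hE₁.congr (fun r hr => by fin_cases hr <;> simp) (by simp) (by simp) (by simp)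
  refine wp_call (query_spec hE₂.consts (x := 2 ^ h + x) ⟨hI.tree.ok, hI.tree.tag⟩ (by simp) (by omega) (by omega)) ?_
  rintro t₁ σ₁ ⟨ht₁, hgW, sv, hseg⟩ hF₁
  -- The query precedes the activation of the leaf `x`, so only predecessors of strictly smaller
  -- time compete.
  have hL := hI.layerAt p3 p2 hseg
  have hE₃ : Env I h W s σ₁ := hE₂.frame hF₁ (by decide) (by decide) (by decide) (by decide)
  have w36 : σ₁.word 36 = x := (hF₁.w 36 (by decide)).trans (by simp)
  have w33 : σ₁.word 33 = σ.word 33 := (hF₁.w 33 (by decide)).trans (by simp)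
  have w34 : σ₁.word 34 = nx (σ.word 33) := (hF₁.w 34 (by decide)).trans (by simp [c5])
  have w30 : σ₁.word 30 = j := (hF₁.w 30 (by decide)).trans (by simp [hj])
  have w32 : σ₁.word 32 = g := (hF₁.w 32 (by decide)).trans (by simp [hg])
  have ra : σ₁.rarr = σ.rarr := funext fun r => hF₁.ra r (by simp [query, Prog.collect, Instr.raw])
  have wa : σ₁.warr = σ.warr := funext fun r => hF₁.wa r (by simp [query, Prog.collect, Instr.waw])
  have hT₁ : Tree h W σ₁ := by
    constructor
    · rw [ra, wa]; exact hI.tree.ok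
    · rw [wa]; exact hI.tree.tag
  have hx0 : x ≠ 0 := by omega
  -- A milestone and an ordinary position differ only in the new contents of the leaf and in the
  -- current milestone; the rest of the visit is shared.
  have hfin : ∀ σ₂ : State, Env I h W s σ₂ → σ₂.word 10 = 2 ^ h + x → σ₂.word 36 = x →
      σ₂.word 30 = j → σ₂.word 32 = g → σ₂.word 14 = σ₁.word 14 → σ₂.real 14 = σ₁.real 14 →
      σ₂.rarr 7 = σ.rarr 7 → σ₂.warr 5 = σ.warr 5 →
      (∀ y, y ≠ 2 ^ h + x → σ₂.rarr 5 y = σ₁.rarr 5 y ∧ σ₂.rarr 6 y = σ₁.rarr 6 y ∧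
        σ₂.warr 1 y = σ₁.warr 1 y) →
      σ₂.rarr 5 (2 ^ h + x) = I.leafS mil (t₀ + 1) (t₀ + 1) x →
      σ₂.rarr 6 (2 ^ h + x) = I.leafB mil nx δ j F (t₀ + 1) x →
      σ₂.warr 1 (2 ^ h + x) = Ranks.leafG mil A x → σ₂.warr 1 (2 ^ h + x) < W →
      (t₀ + 1 ≤ I.m → mil (σ₂.word 33) ∧ σ₂.word 33 ≠ I.m + 1 ∧ I.τ (σ₂.word 33) ≤ t₀ + 1 ∧
        t₀ + 1 < I.τ (nx (σ₂.word 33)) ∧ σ₂.word 34 = nx (σ₂.word 33)) →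
      wp W s finishVisit σ₂ fun t σ' => t ≤ 18 * h + 4 ∧ SweepInv I h W mil nx δ g j F A (t₀ + 1) (t₀ + 1) σ' := by
    intro σ₂ hE₂ e10 e36 e30 e32 e14 r14 r7 w5 hag hS hB hG hGW hcur
    unfold finishVisit
    rw [wp_seq]
    refine wp_call (climb_leaf hT₁ hE₂.consts e10 (by omega) (by omega) hag hGW) ?_
    rintro t₂ σ₃ ⟨ht₂, hT₃, hl₃⟩ hF₃
    have f36 : σ₃.word 36 = x := (hF₃.w 36 (by decide)).trans e36
    have f30 : σ₃.word 30 = j := (hF₃.w 30 (by decide)).trans e30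
    have f32 : σ₃.word 32 = g := (hF₃.w 32 (by decide)).trans e32
    have f33 : σ₃.word 33 = σ₂.word 33 := hF₃.w 33 (by decide)
    have f34 : σ₃.word 34 = σ₂.word 34 := hF₃.w 34 (by decide)
    have f14 : σ₃.word 14 = σ₁.word 14 := (hF₃.w 14 (by decide)).trans e14
    have g14 : σ₃.real 14 = σ₁.real 14 := (hF₃.r 14 (by decide)).trans r14
    have g7 : σ₃.rarr 7 = σ.rarr 7 := (hF₃.ra 7 (by decide)).trans r7
    have g5 : σ₃.warr 5 = σ.warr 5 := (hF₃.wa 5 (by decide)).trans w5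
    have hleaf : ∀ y, y ≤ I.m + 1 → y ≠ x → σ₃.rarr 5 (2 ^ h + y) = σ.rarr 5 (2 ^ h + y) ∧
        σ₃.rarr 6 (2 ^ h + y) = σ.rarr 6 (2 ^ h + y) ∧
        σ₃.warr 1 (2 ^ h + y) = σ.warr 1 (2 ^ h + y) := fun y _ hyx => by
      obtain ⟨k1, k2, k3⟩ := hl₃ (2 ^ h + y) (by omega)
      obtain ⟨l1, l2, l3⟩ := hag (2 ^ h + y) (by omega)
      rw [k1, k2, k3, l1, l2, l3, ra, wa]
      exact ⟨rfl, rfl, rfl⟩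
    obtain ⟨k1, k2, k3⟩ := hl₃ (2 ^ h + x) (by omega)
    simp only [wp_seq, wp_rstore, wp_ite, wp_wstore, Test.Holds, setRarr_word, f36, f30, f32, f14]
    refine ⟨by omega, fun hlt => ⟨⟨by omega, by omega⟩, by omega, ?_⟩, fun hlt => ⟨⟨by omega, by omega⟩, by omega, ?_⟩⟩
    · rw [if_pos hlt] at hL
      exact hI.advance (f := σ₁.real 14) (a := σ₁.word 14) hV hM p3 hb ⟨hT₃.ok, hT₃.tag⟩ hleaf (k1.trans hS) (k2.trans hB)
        (k3.trans hG) (by simp [g14, g7]) (by simp [g5]) hL (by omega) (by simpa [f33, f34] using hcur)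
    · rw [if_neg hlt] at hL
      exact hI.advance (f := σ₁.real 14) (a := x) hV hM p3 hb ⟨hT₃.ok, hT₃.tag⟩ hleaf (k1.trans hS) (k2.trans hB)
        (k3.trans hG) (by simp [g14, g7]) (by simp [g5]) hL (by omega) (by simpa [f33, f34] using hcur)
  rw [wp_seq, wp_wadd, hE₃.consts.w6, w36]
  refine ⟨by omega, ?_⟩
  rw [wp_seq, wp_ite]
  simp only [Test.Holds, wp_seq, wp_rload, wp_radd, wp_rstore, wp_wstore, wp_wmove, wp_wload]
  simp [w36, w34, ra, wa, hE₃.pen, hE₃.consts.r17, hnx]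
  refine ⟨fun hxn => ⟨by omega, ⟨by omega, by omega⟩, by omega, ⟨by omega, hnxW _ n4⟩, ?_⟩, fun hxn => ⟨by omega, by omega, ⟨by omega, hI.tag x p2⟩, ⟨by omega, hI.tag x p2⟩, ?_⟩⟩
  · have hmx : mil x := hxn ▸ n1
    refine wp_mono (hfin _ (hE₃.congr (fun r hr => by fin_cases hr <;> simp) (fun r hr => by fin_cases hr <;> simp)
      (fun r hr => by fin_cases hr <;> simp) (by simp)) (by simp) (by simp [w36]) (by simp [w30]) (by simp [w32])
      (by simp) (by simp) (by simp [ra]) (by simp [wa]) (fun y hy => by simp [hy]) ?_ ?_ ?_ ?_ ?_) ?_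
    · simp [hI.S x p2, Ranks.leafS, p3, hmx, Nat.pos_of_ne_zero hx0]
      ring
    · simp [Ranks.leafB, hx0, p3, hmx]
    · simp [Ranks.leafG, hmx]
    · simp; omega
    · intro ht'
      simp
      have hne : x ≠ I.m + 1 := by
        rintro rfl
        rw [hV.tau_last] at p3
        omega
      rw [← hxn]
      have := hM.next x hmx hne
      exact ⟨hmx, hne, by omega, by omega⟩
    · rintro t σ' ⟨h1, h2⟩
      exact ⟨by omega, h2⟩
  · have hnm : ¬ mil x := fun hm => hxn (hM.eq_next hV c1 c2 hm (by omega) (by omega))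
    obtain ⟨q1, q2⟩ := hI.keep x p2 fun c hc => by omega
    refine wp_mono (hfin _ (hE₃.congr (fun r hr => by fin_cases hr <;> simp) (fun r hr => by fin_cases hr <;> simp)
      (fun r hr => by fin_cases hr <;> simp) (by simp)) (by simp) (by simp [w36]) (by simp [w30]) (by simp [w32])
      (by simp) (by simp) (by simp [ra]) (by simp [wa]) (fun y hy => by simp [hy, ra, wa]) ?_ ?_ ?_ ?_ ?_) ?_
    · simp [hI.S x p2, Ranks.leafS, p3, hnm, ra]
    · simp [Ranks.leafB, hx0, p3, hnm, q1]
      intro hcon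
      exact absurd hb (hcon _)
    · simp [Ranks.leafG, hnm, q2]
    · simpa using hI.tag x p2
    · intro ht'
      simp [w33, w34]
      refine ⟨c1, c2, by omega, ?_⟩
      by_contra hcon
      exact hxn (hV.tau_inj p2 n4 (by omega))
    · rintro t σ' ⟨h1, h2⟩
      exact ⟨by omega, h2⟩

/-- One layer of the dynamic program. -/
def layer : Prog :=
  .seq layerInit <|
  .seq (.instr (.wconst 33 0)) <|
  .seq (.instr (.wload 34 6 4)) <|
  .seq (.instr (.wconst 35 0)) <|
  forLoop 35 8 (.seq removeRow visit)

/-- Row `t` is removed before the position of time `t + 1` is visited, so that the query sees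
exactly the rows from the time of that position on. -/
lemma layer_spec {σ : State} (hE : Env I h W s σ) (hM : I.Miles mil (σ.warr 6))
    (hj : σ.word 30 = j) (hδ : σ.word 31 = δ) (hg : σ.word 32 = g)
    (hnxW : ∀ y, y ≤ I.m + 1 → σ.warr 6 y < W) (hA : ∀ y, y ≤ I.m + 1 → σ.warr 5 y < W) :
    wp W s layer σ fun t σ' => t ≤ 160 * ((I.np + 2 ^ h) * (h + 1)) ∧
      (∀ c x, I.Between mil (σ.warr 6) c x →
        I.LayerAt mil (σ.warr 6) δ g j (σ.rarr 7) (σ.warr 5) x (σ'.rarr 7 x) (σ'.warr 5 x)) ∧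
      ∀ y, y ≤ I.m + 1 → σ'.warr 5 y < W := by
  have hc := hE.consts
  have hlW := hc.lW
  have hls := hc.ls
  have hpos : 1 ≤ 2 ^ h := Nat.one_le_two_pow
  have eq : 2 ^ (h + 1) = 2 * 2 ^ h := by ring
  have hm := hE.hm
  have hV := hE.valid
  have hW0 : 0 < W := (Nat.zero_le _).trans_lt hlW
  unfold layer
  rw [wp_seq]
  refine wp_call (layerInit_spec hE hj hδ) ?_
  rintro t₁ σ₁ ⟨ht₁, hT₁, hl₁⟩ hF₁
  have hE₁ : Env I h W s σ₁ := hE.frame hF₁ (by decide) (by decide) (by decide) (by decide)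
  have a30 : σ₁.word 30 = j := (hF₁.w 30 (by decide)).trans hj
  have a32 : σ₁.word 32 = g := (hF₁.w 32 (by decide)).trans hg
  have b6 : σ₁.warr 6 = σ.warr 6 := hF₁.wa 6 (by decide)
  have b5 : σ₁.warr 5 = σ.warr 5 := hF₁.wa 5 (by decide)
  have b7 : σ₁.rarr 7 = σ.rarr 7 := hF₁.ra 7 (by decide)
  generalize σ.warr 6 = nx at *
  generalize σ.warr 5 = A at *
  generalize σ.rarr 7 = F at *
  rw [wp_seq, wp_wconst]
  refine ⟨hW0, ?_⟩
  rw [wp_seq, wp_wload]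
  simp only [setWord_word, setWord_warr, hE₁.consts.w4, b6]
  norm_num
  refine ⟨⟨by omega, hnxW 0 (by omega)⟩, ?_⟩
  rw [wp_seq, wp_wconst]
  refine ⟨hW0, ?_⟩
  have hE₂ : Env I h W s (((σ₁.setWord 33 0).setWord 34 (nx 0)).setWord 35 0) :=
    hE₁.congr (fun r hr => by fin_cases hr <;> simp) (by simp) (by simp) (by simp)
  refine wp_for (fun x σ' => SweepInv I h W mil nx δ g j F A x x σ')
    (fun x => (bucket I.CT I.np x).length * (18 * h + 10) + 2 + (30 * h + 24)) (lo := 0) (hi := I.m + 1)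
    (by simp) (by simp [hE₁.w8]) (by simp)
    (by simp [hE₁.consts.w3]) (by omega) (by decide) (by decide) (by decide) ?_ ?_ ?_
  · have hτ : ∀ y, 0 < y → y ≤ I.m + 1 → ¬ I.τ y ≤ 0 := fun y h1 h2 => by
      have := hV.tau_pos h1 h2
      omega
    have hz : ∀ c y, I.Between mil nx c y → ¬ I.τ y ≤ 0 := fun c y hb => 
      hτ y (by have := hb.lt; omega) (hb.le_last hM)
    refine ⟨⟨hT₁.ok, hT₁.tag⟩, fun y hy => ?_, fun y hy => ?_, fun y hy hact => ?_, fun _ => ?_,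
      fun c y hb hy => absurd hy (hz c y hb), fun y hy _ => by simp [b7, b5], by simpa [b5] using hA⟩
    · simp only [setWord_rarr, (hl₁ y (by omega)).1, Ranks.leafS]
      rw [if_neg fun hcon => hτ y hcon.1 hy hcon.2.2, sub_zero]
    · simp [(hl₁ y (by omega)).2.1, Ranks.leafB]
      by_cases h0 : y = 0
      · simp [h0]
      · have := hτ y (by omega) hy
        simp only [nonpos_iff_eq_zero] at this
        simp [h0, this]
    · rcases hact with rfl | ⟨h1, _⟩
      · have := (hl₁ 0 (by omega)).2.2
        simp at this
        simp [this, Ranks.leafG, hM.zero]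
      · by_cases h0 : y = 0
        · subst h0
          have := (hl₁ 0 (by omega)).2.2
          simp at this
          simp [this, Ranks.leafG, hM.zero]
        · exact absurd h1 (hτ y (by omega) hy)
    · have := hM.next 0 hM.zero (by omega)
      simp [hM.zero, hV.tau_zero]
      omega
  · intro x σ' _ hx hF hi hI
    have hE' : Env I h W s σ' := hE₂.frame hF (by decide) (by decide) (by decide) (by decide)
    have e30 : σ'.word 30 = j := (hF.w 30 (by decide)).trans (by simp [a30])
    have e32 : σ'.word 32 = g := (hF.w 32 (by decide)).trans (by simp [a32])
    have e6 : σ'.warr 6 = nx := (hF.wa 6 (by decide)).trans (by simp [b6])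
    rw [wp_seq]
    refine wp_call (removeRow_spec hE' hI.tree hi (by omega)) ?_
    rintro t₂ σ₂ ⟨ht₂, hT₂, hl₂⟩ hF₂
    have hE₃ : Env I h W s σ₂ := hE'.frame hF₂ (by decide) (by decide) (by decide) (by decide)
    have hI₂ : SweepInv I h W mil nx δ g j F A (x + 1) x σ₂ := by
      refine ⟨hT₂, fun y hy => ?_, fun y hy => ?_, fun y hy hact => ?_, ?_, ?_, ?_, ?_⟩
      · rw [(hl₂ y (by omega)).1, hI.S y hy]
        unfold Ranks.leafS
        ring
      · rw [(hl₂ y (by omega)).2.1, hI.B y hy]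
      · rw [(hl₂ y (by omega)).2.2, hI.G y hy hact]
      · rw [hF₂.w 33 (by decide), hF₂.w 34 (by decide)]; exact hI.cur
      · rw [hF₂.ra 7 (by decide), hF₂.wa 5 (by decide)]; exact hI.res
      · rw [hF₂.ra 7 (by decide), hF₂.wa 5 (by decide)]; exact hI.keep
      · rw [hF₂.wa 5 (by decide)]; exact hI.tag
    refine wp_mono (visit_spec hE₃ hM hI₂ ((hF₂.w 35 (by decide)).trans hi) (by omega) ((hF₂.w 30 (by decide)).trans e30)
      ((hF₂.w 32 (by decide)).trans e32) ((hF₂.wa 6 (by decide)).trans e6) hnxW) ?_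
    rintro t₃ σ₃ ⟨ht₃, hI₃⟩
    exact ⟨by omega, ⟨⟨hI₃.tree.ok, hI₃.tree.tag⟩, hI₃.S, hI₃.B, hI₃.G, by simpa using hI₃.cur, hI₃.res, hI₃.keep, hI₃.tag⟩⟩
  · intro t σ' ht hF hi hI
    refine ⟨?_, fun c x hb => hI.res c x hb ?_, hI.tag⟩
    · have hsum : ∑ x ∈ Finset.Ico 0 (I.m + 1), ((bucket I.CT I.np x).length * (18 * h + 10) + 2 + (30 * h + 24) + 2) =
          I.np * (18 * h + 10) + (I.m + 1) * (30 * h + 28) := by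
        rw [Nat.Ico_zero_eq_range]
        simp only [add_assoc, Finset.sum_add_distrib, ← Finset.sum_mul]
        rw [sum_length_bucket (fun c hc => Nat.lt_succ_of_le (hV.row c hc))]
        simp
        ring
      rw [hsum] at ht
      have h1 : (I.m + 1) * (30 * h + 28) ≤ 2 ^ h * (30 * h + 28) := Nat.mul_le_mul_right _ (by omega)
      have h2 : h ≤ 2 ^ h * h := Nat.le_mul_of_pos_left _ hpos
      have h3 : 0 ≤ I.np * h := Nat.zero_le _
      have e1 : I.np * (18 * h + 9) = 18 * (I.np * h) + 9 * I.np := by ring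
      have e2 : I.np * (18 * h + 10) = 18 * (I.np * h) + 10 * I.np := by ring
      have e3 : 2 ^ h * (30 * h + 28) = 30 * (2 ^ h * h) + 28 * 2 ^ h := by ring
      have e4 : 160 * ((I.np + 2 ^ h) * (h + 1)) = 160 * (I.np * h) + 160 * I.np + 160 * (2 ^ h * h) + 160 * 2 ^ h := by ring
      omega
    · obtain h0 | h0 := Nat.eq_zero_or_pos x
      · have := hb.lt; omega
      · exact (hV.tau_pos h0 (hb.le_last hM)).2

end

end MaxDominance

namespace MaxDominance

namespace Ranks
variable (I : Ranks)

/-! ### Lists of milestones -/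

/-- The list `l` is a chain from `c` (exclusive) to `m + 1`, linked by `nx`. -/
def Path (nx : ℕ → ℕ) : ℕ → List ℕ → Prop
  | c, [] => c = I.m + 1
  | c, d :: l => nx c = d ∧ c < d ∧ I.τ c < I.τ d ∧ Path nx d l

/-- Every milestone in the list is reached from the preceding one within `L` layers; the costs add
up to `V`. -/
def Feasible (δ L : ℕ) : ℕ → List ℕ → ℝ → Prop
  | _, [], V => V = 0
  | c, d :: l, V => ∃ v V', I.Reach (delay δ c) c L d v ∧ Feasible δ L d l V' ∧ V = v + V'

/-- The sum of the costs along a list. -/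
def pathCost : ℕ → List ℕ → ℝ
  | _, [] => 0
  | c, d :: l => I.cost c d + pathCost d l

/-- Insert the tag of each element before it, unless it is the preceding element. -/
def refine (A : ℕ → ℕ) : ℕ → List ℕ → List ℕ
  | _, [] => []
  | c, d :: l => if A d = c then d :: refine A d l else A d :: d :: refine A d l

/-- The tag of each element is the preceding element or lies strictly between. -/
def MidOK (A : ℕ → ℕ) : ℕ → List ℕ → Prop
  | _, [] => True
  | c, d :: l => (A d = c ∨ c < A d ∧ A d < d) ∧ MidOK A d l

/-- The tags lie between the milestones in both orders. -/
def MidTau (A : ℕ → ℕ) : ℕ → List ℕ → Prop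
  | _, [] => True
  | c, d :: l => (A d ≠ c → I.τ c < I.τ (A d) ∧ I.τ (A d) < I.τ d) ∧ MidTau A d l

variable {I} {nx A : ℕ → ℕ} {c : ℕ} {l : List ℕ}

lemma Path.lt (h : I.Path nx c l) : ∀ y ∈ l, c < y ∧ I.τ c < I.τ y := by
  induction l generalizing c with
  | nil => simp
  | cons d l ih =>
    obtain ⟨_, h1, h2, h3⟩ := h
    intro y hy
    rcases List.mem_cons.1 hy with rfl | hy
    · exact ⟨h1, h2⟩
    · have := ih h3 y hy
      omega

lemma Path.le_last (h : I.Path nx c l) : ∀ y ∈ c :: l, y ≤ I.m + 1 := by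
  induction l generalizing c with
  | nil => simpa using le_of_eq h
  | cons d l ih =>
    obtain ⟨_, h1, h2, h3⟩ := h
    intro y hy
    rcases List.mem_cons.1 hy with rfl | hy
    · have := ih h3 d (by simp)
      omega
    · exact ih h3 y hy

lemma Path.length (h : I.Path nx c l) : c + l.length ≤ I.m + 1 := by
  induction l generalizing c with
  | nil => simpa using le_of_eq h
  | cons d l ih =>
    obtain ⟨_, h1, h2, h3⟩ := h
    have := ih h3
    simp
    omega

lemma Path.last_mem (h : I.Path nx c l) : I.m + 1 ∈ c :: l := by
  induction l generalizing c with
  | nil => simpa using h.symm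
  | cons d l ih => exact List.mem_cons_of_mem _ (ih h.2.2.2)

lemma Path.next (h : I.Path nx c l) : ∀ y ∈ c :: l, y ≠ I.m + 1 →
    nx y ∈ c :: l ∧ y < nx y ∧ I.τ y < I.τ (nx y) := by
  induction l generalizing c with
  | nil =>
    intro y hy hne
    simp at hy
    exact absurd (hy.trans h) hne
  | cons d l ih =>
    obtain ⟨h0, h1, h2, h3⟩ := h
    intro y hy hne
    rcases List.mem_cons.1 hy with rfl | hy
    · simp [h0, h1, h2]
    · have := ih h3 y hy hne
      exact ⟨List.mem_cons_of_mem _ this.1, this.2⟩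

lemma Path.sep (h : I.Path nx c l) : ∀ y ∈ c :: l, ∀ z ∈ c :: l, y < z →
    nx y ≤ z ∧ I.τ (nx y) ≤ I.τ z := by
  induction l generalizing c with
  | nil =>
    intro y hy z hz hyz
    simp at hy hz
    omega
  | cons d l ih =>
    have hlt := h.lt
    obtain ⟨h0, h1, h2, h3⟩ := h
    intro y hy z hz hyz
    rcases List.mem_cons.1 hy with rfl | hy'
    · rcases List.mem_cons.1 hz with rfl | hz
      · omega
      · rw [h0]
        rcases List.mem_cons.1 hz with rfl | hz
        · exact ⟨le_rfl, le_rfl⟩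
        · have := h3.lt z hz
          omega
    · rcases List.mem_cons.1 hz with rfl | hz
      · have := hlt y hy'
        omega
      · exact ih h3 y hy' z hz hyz

lemma Path.miles (h : I.Path nx 0 l) : I.Miles (· ∈ 0 :: l) nx :=
  ⟨by simp, h.last_mem, h.le_last, h.next, fun y z hy hz => h.sep y hy z hz⟩

lemma length_refine_le (A : ℕ → ℕ) (c : ℕ) (l : List ℕ) : (refine A c l).length ≤ 2 * l.length := by
  induction l generalizing c with
  | nil => simp [refine]
  | cons d l ih =>
    have := ih d
    unfold refine
    split_ifs <;> simp <;> omega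

/-- The milestone saved here pays for the reduction of the delay when the first segment is not
split. -/
lemma length_refine_lt {d : ℕ} (h : A d = c) :
    (refine A c (d :: l)).length + 1 ≤ 2 * (d :: l).length := by
  have := length_refine_le A d l
  simp [refine, h]
  omega

/-- The tags of an optimal layered computation refine the milestones without loss. -/
lemma Feasible.refine {mil : ℕ → Prop} {δ δ' g : ℕ} {F : ℕ → ℝ} (hg : 1 ≤ g)
    (hL : I.LayerInv mil nx δ g (2 * g) F A) (hδ : δ' = if A (nx 0) = 0 then δ - g else δ)
    {V : ℝ} (hP : I.Path nx c l) (hmil : ∀ y ∈ c :: l, mil y)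
    (hV : I.Feasible δ (2 * g) c l V) :
    MidOK A c l ∧ I.MidTau A c l ∧ ∃ V', V ≤ V' ∧ I.Feasible δ' g c (refine A c l) V' := by
  induction l generalizing c V with
  | nil => exact ⟨trivial, trivial, V, le_rfl, hV⟩
  | cons d l ih =>
    have hle := hP.le_last
    obtain ⟨h0, h1, h2, h3⟩ := hP
    obtain ⟨v, V', hr, hV', rfl⟩ := hV
    obtain ⟨hok, htau, V'', hV'', hfeas⟩ := ih h3 (fun y hy => hmil y (List.mem_cons_of_mem _ hy)) hV'
    have hb : I.Between mil nx c d :=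
      ⟨hmil c (by simp), by have := hle d (by simp); omega, h1, h0.ge, h2, by rw [h0]⟩
    obtain ⟨hvF, -, hs⟩ := hL.exact hb hr (by omega)
    rw [Split, show 2 * g - g = g by omega] at hs
    rcases hs with ⟨ha, hra⟩ | ⟨hba, had, v₁, v₂, hr1, hr2, hv⟩
    · refine ⟨⟨Or.inl ha, hok⟩, ⟨fun h => absurd ha h, htau⟩, F d + V'', by linarith, ?_⟩
      rw [Ranks.refine, if_pos ha]
      refine ⟨F d, V'', ?_, hfeas, rfl⟩
      convert hra using 1
      -- The chain has waited at `c` through the first `g` layers. At the start this uses up `g`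
      -- units of the delay; elsewhere there is no delay.
      by_cases hc : c = 0
      · subst hc
        rw [h0, if_pos ha] at hδ
        simp [delay, hδ]
      · simp [delay, hc]
    · have hlt := hba.lt
      have had := had (by omega)
      have hax := hr2.eq_or
      refine ⟨⟨Or.inr ⟨hlt, had⟩, hok⟩, ⟨fun _ => ⟨hba.tlt, by omega⟩, htau⟩, F d + V'', by linarith, ?_⟩
      rw [Ranks.refine, if_neg (by omega)]
      -- The segment splits at its tag. The delay stays with the first half, since the new milestone
      -- is not the start.
      refine ⟨v₁, v₂ + V'', ?_, ⟨v₂, V'', ?_, hfeas, rfl⟩, by rw [hv]; ring⟩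
      · convert hr1 using 1
        by_cases hc : c = 0
        · subst hc
          rw [h0, if_neg (by omega)] at hδ
          simp [delay, hδ]
        · simp [delay, hc]
      · convert hr2 using 1
        simp [delay]
        omega

/-- Within one layer only single steps are possible. -/
lemma Feasible.eq_pathCost {V : ℝ} (hP : I.Path nx c l) (hV : I.Feasible 0 1 c l V) :
    V = I.pathCost c l := by
  induction l generalizing c V with
  | nil => exact hV
  | cons d l ih =>
    obtain ⟨h0, h1, h2, h3⟩ := hP
    obtain ⟨v, V', hr, hV', rfl⟩ := hV
    rw [pathCost, ih h3 hV']
    congr 1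
    cases hr with
    | base _ _ => exact absurd h1 (lt_irrefl _)
    | step _ x _ v hr _ _ =>
      rcases hr.eq_or with ⟨_, ⟨rfl, rfl⟩ | ⟨_, _, h⟩⟩
      · simp
      · omega

lemma path_refine {nx' : ℕ → ℕ} {d : ℕ} (hd : I.Path nx' d (refine A d l))
    (hA : A d = c ∨ c < A d ∧ A d < d) (h1 : c < d) (h2 : I.τ c < I.τ d)
    (ht : A d ≠ c → I.τ c < I.τ (A d) ∧ I.τ (A d) < I.τ d)
    (hn : if A d = c then nx' c = d else nx' c = A d ∧ nx' (A d) = d) :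
    I.Path nx' c (refine A c (d :: l)) := by
  unfold refine
  split_ifs at hn ⊢ with h
  · exact ⟨hn, h1, h2, hd⟩
  · have := ht h
    exact ⟨hn.1, by omega, this.1, hn.2, by omega, this.2, hd⟩

end Ranks

/-! ### Refining the milestones on the machine -/

/-- Insert the tags into the list of milestones. -/
def refineLoop : Prog :=
  .loop (.wlt 20 8)
    (.seq (.instr (.wload 21 6 20)) <|
     .seq (.instr (.wload 22 5 21)) <|
     .seq (.ite (.weq 22 20) .skip
       (.seq (.instr (.wstore 22 6 20)) (.instr (.wstore 21 6 22)))) <|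
     .instr (.wmove 20 21))

lemma refineLoop_spec {I : Ranks} {W s : ℕ} {A : ℕ → ℕ} (hs : I.m + 2 ≤ s) (hW : I.m + 2 ≤ W)
    (l : List ℕ) : ∀ (c : ℕ) (σ : State), σ.word 20 = c → σ.word 8 = I.m + 1 → σ.warr 5 = A →
      I.Path (σ.warr 6) c l → Ranks.MidOK A c l → I.MidTau A c l →
      wp W s refineLoop σ fun t σ' => t ≤ 7 * l.length + 1 ∧
        I.Path (σ'.warr 6) c (Ranks.refine A c l) ∧ (∀ y, y < c → σ'.warr 6 y = σ.warr 6 y) ∧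
        ((∀ y, y ≤ I.m + 1 → σ.warr 6 y ≤ I.m + 1) → ∀ y, y ≤ I.m + 1 → σ'.warr 6 y ≤ I.m + 1) := by
  induction l with
  | nil =>
    intro c σ hc h8 hA hP _ _
    refine wp_loop_false ?_ ⟨by simp, hP, by simp, by simp⟩
    have : c = I.m + 1 := hP
    simp [Test.Holds, hc, h8, this]
  | cons d l ih =>
    intro c σ hc h8 hA hP hmid htau
    have hle := hP.le_last
    have hd := hle d (by simp)
    have hP₀ := hP
    obtain ⟨h0, h1, h2, h3⟩ := hP
    obtain ⟨m1, m2⟩ := hmid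
    obtain ⟨u1, u2⟩ := htau
    refine wp_loop_true (by simp [Test.Holds, hc, h8]; omega) ?_
    simp only [wp_seq, wp_wload, wp_ite, wp_skip, wp_wstore, wp_wmove, Test.Holds]
    simp [hc, h0, hA]
    refine ⟨⟨by omega, by omega⟩, ⟨by omega, by omega⟩, fun ha => ⟨by omega, ?_⟩,
      fun ha => ⟨⟨by omega, by omega⟩, ⟨by omega, by omega⟩, by omega, ?_⟩⟩
    · refine wp_mono (ih d _ (by simp) (by simp [h8]) (by simp [hA]) (by simpa using h3) m2 u2) ?_
      rintro t σ' ⟨ht, hp, hy, hbd⟩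
      refine ⟨by omega, Ranks.path_refine hp m1 h1 h2 u1 ?_, fun y hyc => ?_, by simpa using hbd⟩
      · rw [if_pos ha, hy c h1]; simp [h0]
      · rw [hy y (by omega)]; simp
    · have hca : c < A d ∧ A d < d := by tauto
      -- The two links written belong to positions smaller than `d`, so the remaining list, which
      -- starts at `d`, is untouched.
      have hpath : I.Path (Function.update (Function.update (σ.warr 6) c (A d)) (A d) d) d l := by
        have : ∀ (l : List ℕ) (d' : ℕ), d ≤ d' → I.Path (σ.warr 6) d' l →
            I.Path (Function.update (Function.update (σ.warr 6) c (A d)) (A d) d) d' l := by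
          intro l
          induction l with
          | nil => intro d' _ h; exact h
          | cons e l ih' =>
            rintro d' hd' ⟨q0, q1, q2, q3⟩
            refine ⟨?_, q1, q2, ih' e (by omega) q3⟩
            rw [Function.update_of_ne (by omega), Function.update_of_ne (by omega), q0]
        exact this l d le_rfl h3
      refine wp_mono (ih d _ (by simp) (by simp [h8]) (by simp [hA]) (by simpa using hpath) m2 u2) ?_
      rintro t σ' ⟨ht, hp, hy, hbd⟩
      refine ⟨by omega, Ranks.path_refine hp m1 h1 h2 u1 ?_, fun y hyc => ?_, fun hb y hym => ?_⟩
      · rw [if_neg ha, hy c h1, hy (A d) hca.2]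
        have : c ≠ A d := by omega
        simp [this]
      · rw [hy y (by omega)]
        have h4 : y ≠ A d := by omega
        have h5 : y ≠ c := by omega
        simp [h4, h5]
      · refine hbd (fun z hz => ?_) y hym
        simp only [setWord_warr, setWarr_warr, if_true, Function.update_apply]
        split_ifs
        · omega
        · omega
        · exact hb z hz

/-- Adjust the delay and insert the tags into the list of milestones. -/
def refineMiles : Prog :=
  .seq (.instr (.wload 20 6 4)) <|
  .seq (.instr (.wload 21 5 20)) <|
  .seq (.ite (.weq 21 4) (.instr (.wop .sub 31 31 32)) .skip) <|
  .seq (.instr (.wconst 20 0)) <|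
  refineLoop

lemma refineMiles_spec {I : Ranks} {h W s δ g : ℕ} {σ : State} {l : List ℕ} (hE : Env I h W s σ)
    (hP : I.Path (σ.warr 6) 0 l) (hmid : Ranks.MidOK (σ.warr 5) 0 l)
    (htau : I.MidTau (σ.warr 5) 0 l) (hδ : σ.word 31 = δ) (hg : σ.word 32 = g) (hδW : δ < W)
    (hA : ∀ y, y ≤ I.m + 1 → σ.warr 5 y < W) (hnx : ∀ y, y ≤ I.m + 1 → σ.warr 6 y ≤ I.m + 1) :
    wp W s refineMiles σ fun t σ' => t ≤ 7 * 2 ^ h + 6 ∧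
      I.Path (σ'.warr 6) 0 (Ranks.refine (σ.warr 5) 0 l) ∧
      (∀ y, y ≤ I.m + 1 → σ'.warr 6 y ≤ I.m + 1) ∧
      σ'.word 31 = if σ.warr 5 (σ.warr 6 0) = 0 then δ - g else δ := by
  have hc := hE.consts
  have hlW := hc.lW
  have hls := hc.ls
  have hm := hE.hm
  have hpos : 1 ≤ 2 ^ h := Nat.one_le_two_pow
  have eq : 2 ^ (h + 1) = 2 * 2 ^ h := by ring
  have hW0 : 0 < W := (Nat.zero_le _).trans_lt hlW
  have h1 := hnx 0 (by omega)
  have h2 := hA _ h1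
  have hlen := hP.length
  unfold refineMiles
  simp only [wp_seq, wp_wload, wp_ite, wp_wsub, wp_skip, wp_wconst, Test.Holds]
  simp [hc.w4, hδ, hg]
  refine ⟨⟨by omega, by omega⟩, ⟨by omega, by omega⟩, fun ha => ⟨by omega, hW0, ?_⟩, fun ha => ⟨hW0, ?_⟩⟩
  · refine wp_call (refineLoop_spec (A := σ.warr 5) (by omega) (by omega) l 0 _ (by simp) (by simp [hE.w8]) (by simp) (by simpa using hP) hmid htau) ?_
    rintro t σ' ⟨ht, hp, _, hb⟩ hF
    refine ⟨by omega, hp, hb (by simpa using hnx), ?_⟩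
    rw [hF.w 31 (by decide)]
    simp [ha]
  · refine wp_call (refineLoop_spec (A := σ.warr 5) (by omega) (by omega) l 0 _ (by simp) (by simp [hE.w8]) (by simp) (by simpa using hP) hmid htau) ?_
    rintro t σ' ⟨ht, hp, _, hb⟩ hF
    refine ⟨by omega, hp, hb (by simpa using hnx), ?_⟩
    rw [hF.w 31 (by decide)]
    simp [ha, hδ]

end MaxDominance

namespace MaxDominance

namespace Ranks
variable {I : Ranks}

/-- Each link of the list takes one layer. Thus a list of milestones is itself a competitor in the
maximization, which bounds its cost from above. -/
lemma Reach.append_path {nx : ℕ → ℕ} {d c j x : ℕ} {v : ℝ} {l : List ℕ} (h : I.Reach d c j x v)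
    (hP : I.Path nx x l) : I.Reach d c (j + l.length) (I.m + 1) (v + I.pathCost x l) := by
  induction l generalizing j x v with
  | nil =>
    obtain rfl : x = I.m + 1 := hP
    simpa [pathCost] using h
  | cons y l ih =>
    obtain ⟨_, h1, h2, h3⟩ := hP
    have := ih (.step _ _ _ _ h h1 h2) h3
    rw [pathCost, ← add_assoc]
    convert this using 1
    simp
    omega

/-- With a single layer per segment the first step must depart at layer 0, which leaves no room for
a delay. -/
lemma Feasible.delay_eq_zero {nx : ℕ → ℕ} {δ : ℕ} {l : List ℕ} {V : ℝ} (hP : I.Path nx 0 l)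
    (hV : I.Feasible δ 1 0 l V) : δ = 0 := by
  cases l with
  | nil => exact absurd (show (0 : ℕ) = I.m + 1 from hP) (by omega)
  | cons d l =>
    obtain ⟨_, h1, _⟩ := hP
    obtain ⟨v, _, hr, _⟩ := hV
    have := hr.eq_or
    simp [delay] at this
    omega

end Ranks

/-! ### Rounds -/

/-- All layers of a round. -/
def layers : Prog :=
  .seq (.instr (.wconst 20 0)) <|
  .seq (forLoop 20 6 (.instr (.rstore 16 7 20))) <|
  .seq (.instr (.wop .add 40 38 3)) <|
  .seq (.instr (.wconst 30 1)) <|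
  forLoop 30 40 layer

lemma layers_spec {I : Ranks} {h W s δ g L : ℕ} {mil : ℕ → Prop} {σ : State} (hE : Env I h W s σ)
    (hM : I.Miles mil (σ.warr 6)) (hL : σ.word 38 = L) (hδ : σ.word 31 = δ) (hg : σ.word 32 = g)
    (hL1 : 1 ≤ L) (hLW : L + 1 < W) (hnxW : ∀ y, y ≤ I.m + 1 → σ.warr 6 y < W)
    (hA : ∀ y, y ≤ I.m + 1 → σ.warr 5 y < W) :
    wp W s layers σ fun t σ' => t ≤ 167 * (L * ((I.np + 2 ^ h) * (h + 1))) ∧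
      I.LayerInv mil (σ.warr 6) δ g L (σ'.rarr 7) (σ'.warr 5) ∧
      ∀ y, y ≤ I.m + 1 → σ'.warr 5 y < W := by
  have hc := hE.consts
  have hlW := hc.lW
  have hls := hc.ls
  have hpos : 1 ≤ 2 ^ h := Nat.one_le_two_pow
  have eq : 2 ^ (h + 1) = 2 * 2 ^ h := by ring
  have hm := hE.hm
  have hW0 : 0 < W := (Nat.zero_le _).trans_lt hlW
  unfold layers
  rw [wp_seq, wp_wconst]
  refine ⟨hW0, ?_⟩
  rw [wp_seq]
  refine wp_for (fun x σ' => ∀ y, y < x → σ'.rarr 7 y = -I.pen) (fun _ => 1) (lo := 0)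
    (hi := 2 ^ h) (by simp) (by simp [hc.w6]) (by simp) (by simp [hc.w3]) (by omega) (by decide)
    (by decide) (by decide) (by simp) ?_ ?_
  · intro x σ' _ hx hF hi hI
    have h16 : σ'.real 16 = -I.pen := (hF.r 16 (by decide)).trans (by simp [hE.pen])
    rw [wp_rstore]
    simp [hi, h16]
    refine ⟨by omega, fun y hy => ?_⟩
    rw [Function.update_apply]
    split_ifs with h
    · rfl
    · exact hI y (by omega)
  · intro t₁ σ₁ ht₁ hF₁ _ hI₁
    have hE₁ : Env I h W s σ₁ := Env.frame (hE.congr (fun r hr => by fin_cases hr <;> simp) (by simp) (by simp) (by simp)) hF₁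
      (by decide) (by decide) (by decide) (by decide)
    have a38 : σ₁.word 38 = L := (hF₁.w 38 (by decide)).trans (by simp [hL])
    have a31 : σ₁.word 31 = δ := (hF₁.w 31 (by decide)).trans (by simp [hδ])
    have a32 : σ₁.word 32 = g := (hF₁.w 32 (by decide)).trans (by simp [hg])
    have b6 : σ₁.warr 6 = σ.warr 6 := (hF₁.wa 6 (by decide)).trans (by simp)
    have b5 : σ₁.warr 5 = σ.warr 5 := (hF₁.wa 5 (by decide)).trans (by simp)
    simp only [wp_seq, wp_wadd, wp_wconst, a38, hE₁.consts.w3]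
    refine ⟨hLW, by omega, ?_⟩
    -- The counter `x` names the layer about to be computed, so the tables describe the layer `x -
    -- 1`.
    refine wp_for (fun x σ' => I.LayerInv mil (σ.warr 6) δ g (x - 1) (σ'.rarr 7) (σ'.warr 5) ∧
        ∀ y, y ≤ I.m + 1 → σ'.warr 5 y < W)
      (fun _ => 160 * ((I.np + 2 ^ h) * (h + 1))) (lo := 1) (hi := L + 1) (by simp) (by simp)
      (by omega) (by simp [hE₁.consts.w3]) hLW (by decide) (by decide) (by decide) ?_ ?_ ?_
    · refine ⟨Ranks.LayerInv.init fun c x hb => ?_, by simpa [b5] using hA⟩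
      have h1 := hM.le _ (hM.next c hb.mil hb.ne).1
      have h2 := hb.le
      simpa using hI₁ x (by omega)
    · rintro x σ' hx hxL hF hi ⟨hI, hA'⟩
      have hE' : Env I h W s σ' := Env.frame (hE₁.congr (fun r hr => by fin_cases hr <;> simp) (by simp) (by simp) (by simp)) hF
        (by decide) (by decide) (by decide) (by decide)
      have c6 : σ'.warr 6 = σ.warr 6 := (hF.wa 6 (by decide)).trans (by simp [b6])
      refine wp_mono (layer_spec (mil := mil) (δ := δ) (g := g) (j := x) hE' (by rw [c6]; exact hM) hi
        ((hF.w 31 (by decide)).trans (by simp [a31])) ((hF.w 32 (by decide)).trans (by simp [a32]))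
        (by rw [c6]; exact hnxW) hA') ?_
      rintro t σ'' ⟨ht, hat, hA''⟩
      refine ⟨ht, ?_, by simpa using hA''⟩
      obtain ⟨j, rfl⟩ : ∃ j, x = j + 1 := ⟨x - 1, by omega⟩
      rw [c6] at hat
      simpa using hI.step hM hE.valid.tau_zero (by simpa using hat)
    · rintro t₂ σ₂ ht₂ hF₂ _ ⟨hI₂, hA₂⟩
      refine ⟨?_, by simpa using hI₂, hA₂⟩
      simp at ht₁ ht₂
      have h1 : 2 ^ h ≤ (I.np + 2 ^ h) * (h + 1) := by nlinarith [Nat.zero_le (I.np * (h + 1)), Nat.zero_le (2 ^ h * h)]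
      generalize (I.np + 2 ^ h) * (h + 1) = X at *
      nlinarith

/-- Halve the number of layers between milestones. -/
def round : Prog :=
  .seq (.instr (.wop .div 32 38 5)) <|
  .seq layers <|
  .seq (.ite (.weq 38 41) (.instr (.rload 0 7 8)) .skip) <|
  .seq refineMiles <|
  .instr (.wmove 38 32)

/-- The milestones at the beginning of a round with `L` layers. -/
structure RoundInv (I : Ranks) (h W s δ L : ℕ) (l : List ℕ) (σ : State) : Prop where
  env : Env I h W s σ
  w38 : σ.word 38 = L
  w31 : σ.word 31 = δ
  path : I.Path (σ.warr 6) 0 l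
  nx : ∀ y, y ≤ I.m + 1 → σ.warr 6 y ≤ I.m + 1
  tag : ∀ y, y ≤ I.m + 1 → σ.warr 5 y < W

/-- The number of available layers, `l.length` times the layers per segment, minus the delay does
not grow; this finally bounds the number of chosen points by `k`. The value at the end is recorded
only in the first round, when the whole problem is one segment. -/
lemma round_spec {I : Ranks} {h W s δ g : ℕ} {l : List ℕ} {σ : State} {V₀ : ℝ}
    (hR : RoundInv I h W s δ (2 * g) l σ) (hg : 1 ≤ g) (hLW : 2 * g + 1 < W) (hδW : δ < W)
    (hV₀ : I.Feasible δ (2 * g) 0 l V₀) :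
    wp W s round σ fun t σ' => t ≤ 180 * (2 * g * ((I.np + 2 ^ h) * (h + 1))) ∧
      ∃ l' δ', RoundInv I h W s δ' g l' σ' ∧ δ' ≤ δ ∧
        l'.length * g + δ ≤ l.length * (2 * g) + δ' ∧
        (∀ V, I.Feasible δ (2 * g) 0 l V → ∃ V', V ≤ V' ∧ I.Feasible δ' g 0 l' V') ∧
        (2 * g ≠ σ.word 41 → σ'.real 0 = σ.real 0) ∧
        (2 * g = σ.word 41 → l = [I.m + 1] → I.Reach δ 0 (2 * g) (I.m + 1) (σ'.real 0) ∧
          ∀ v, I.Reach δ 0 (2 * g) (I.m + 1) v → v ≤ σ'.real 0) := by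
  have hE := hR.env
  have hc := hE.consts
  have hlW := hc.lW
  have hls := hc.ls
  have hpos : 1 ≤ 2 ^ h := Nat.one_le_two_pow
  have eq : 2 ^ (h + 1) = 2 * 2 ^ h := by ring
  have hm := hE.hm
  have hM := hR.path.miles
  unfold round
  rw [wp_seq, wp_wdiv, hR.w38, hc.w5, show 2 * g / 2 = g by omega]
  refine ⟨by omega, ?_⟩
  rw [wp_seq]
  refine wp_call (layers_spec (mil := (· ∈ 0 :: l)) (δ := δ) (g := g) (L := 2 * g)
    (hE.congr (fun r hr => by fin_cases hr <;> simp) (by simp) (by simp) (by simp))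
    (by simpa using hM) (by simp [hR.w38]) (by simp [hR.w31]) (by simp) (by omega) hLW
    (fun y hy => by have := hR.nx y hy; simp; omega) (by simpa using hR.tag)) ?_
  rintro t₁ σ₁ ⟨ht₁, hI₁, hA₁⟩ hF₁
  have hE₁ : Env I h W s σ₁ := Env.frame (hE.congr (fun r hr => by fin_cases hr <;> simp) (by simp) (by simp) (by simp)) hF₁
    (by decide) (by decide) (by decide) (by decide)
  have a38 : σ₁.word 38 = 2 * g := (hF₁.w 38 (by decide)).trans (by simp [hR.w38])
  have a41 : σ₁.word 41 = σ.word 41 := (hF₁.w 41 (by decide)).trans (by simp)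
  have a31 : σ₁.word 31 = δ := (hF₁.w 31 (by decide)).trans (by simp [hR.w31])
  have a32 : σ₁.word 32 = g := (hF₁.w 32 (by decide)).trans (by simp)
  have b6 : σ₁.warr 6 = σ.warr 6 := (hF₁.wa 6 (by decide)).trans (by simp)
  have r0 : σ₁.real 0 = σ.real 0 := (hF₁.r 0 (by decide)).trans (by simp)
  simp only [setWord_warr] at hI₁
  set δ' := if σ₁.warr 5 (σ.warr 6 0) = 0 then δ - g else δ with hδ'
  have hfe : ∀ V, I.Feasible δ (2 * g) 0 l V → _ := fun V hV =>
    Ranks.Feasible.refine hg hI₁ hδ' hR.path (fun y hy => hy) hV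
  obtain ⟨hok, htau, -⟩ := hfe V₀ hV₀
  rw [wp_seq]
  suffices H : ∀ σ₂ : State, Env I h W s σ₂ → σ₂.word 31 = δ → σ₂.word 32 = g →
      σ₂.warr 6 = σ.warr 6 → σ₂.warr 5 = σ₁.warr 5 →
      (2 * g ≠ σ.word 41 → σ₂.real 0 = σ.real 0) →
      (2 * g = σ.word 41 → σ₂.real 0 = σ₁.rarr 7 (I.m + 1)) →
      wp W s (.seq refineMiles (.instr (.wmove 38 32))) σ₂ fun t σ' => t ≤ 7 * 2 ^ h + 7 ∧
      ∃ l' δ', RoundInv I h W s δ' g l' σ' ∧ δ' ≤ δ ∧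
        l'.length * g + δ ≤ l.length * (2 * g) + δ' ∧
        (∀ V, I.Feasible δ (2 * g) 0 l V → ∃ V', V ≤ V' ∧ I.Feasible δ' g 0 l' V') ∧
        (2 * g ≠ σ.word 41 → σ'.real 0 = σ.real 0) ∧
        (2 * g = σ.word 41 → l = [I.m + 1] → I.Reach δ 0 (2 * g) (I.m + 1) (σ'.real 0) ∧
          ∀ v, I.Reach δ 0 (2 * g) (I.m + 1) v → v ≤ σ'.real 0) by
    have hX : 2 ≤ (I.np + 2 ^ h) * (h + 1) := by nlinarith [Nat.zero_le (I.np * (h + 1)), Nat.zero_le (2 ^ h * h)]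
    have hX2 : 2 ^ h ≤ (I.np + 2 ^ h) * (h + 1) := by nlinarith [Nat.zero_le (I.np * (h + 1)), Nat.zero_le (2 ^ h * h)]
    generalize (I.np + 2 ^ h) * (h + 1) = X at *
    have hT : ∀ t, t ≤ 7 * 2 ^ h + 7 → 1 + (t₁ + (2 + t)) ≤ 180 * (2 * g * X) := fun t ht => by
      nlinarith
    simp only [wp_ite, wp_rload, wp_skip, Test.Holds, a38, a41, hE₁.w8]
    refine ⟨fun h2 => ⟨by omega, ?_⟩, fun h2 => ?_⟩
    · refine wp_mono (H _ (hE₁.congr (by simp) (fun r hr => by fin_cases hr <;> simp) (by simp) (by simp)) (by simp [a31]) (by simp [a32]) (by simp [b6]) (by simp) (fun h3 => absurd h2 h3) (by simp)) ?_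
      rintro t σ' ⟨ht, h'⟩
      exact ⟨hT _ ht, h'⟩
    · refine wp_mono (H _ hE₁ a31 a32 b6 rfl (fun _ => r0) (fun h3 => absurd h3 h2)) ?_
      rintro t σ' ⟨ht, h'⟩
      exact ⟨(by omega : _ ≤ 1 + (t₁ + (2 + t))).trans (hT _ ht), h'⟩
  intro σ₂ hE₂ c31 c32 c6 c5 cn cr
  rw [wp_seq]
  refine wp_call (refineMiles_spec (l := l) (δ := δ) (g := g) hE₂ (by rw [c6]; exact hR.path)
    (by rw [c5]; exact hok) (by rw [c5]; exact htau) c31 c32 hδW (by rw [c5]; exact hA₁)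
    (by rw [c6]; exact hR.nx)) ?_
  rintro t₃ σ₃ ⟨ht₃, hp₃, hn₃, h31⟩ hF₃
  rw [c5] at hp₃
  rw [c5, c6, ← hδ'] at h31
  have hE₃ : Env I h W s σ₃ := hE₂.frame hF₃ (by decide) (by decide) (by decide) (by decide)
  have d32 : σ₃.word 32 = g := (hF₃.w 32 (by decide)).trans c32
  have d5 : σ₃.warr 5 = σ₁.warr 5 := (hF₃.wa 5 (by decide)).trans c5
  have d0 : σ₃.real 0 = σ₂.real 0 := hF₃.r 0 (by decide)
  rw [wp_wmove, d32]
  refine ⟨by omega, by omega, Ranks.refine (σ₁.warr 5) 0 l, δ',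
    ⟨hE₃.congr (fun r hr => by fin_cases hr <;> simp) (by simp) (by simp) (by simp), by simp,
      by simp [h31], by simpa using hp₃, by simpa using hn₃, by simpa [d5] using hA₁⟩,
    by rw [hδ']; split_ifs <;> omega, ?_, fun V hV => (hfe V hV).2.2, fun h2 => ?_, fun h2 hl => ?_⟩
  · rw [hδ']
    split_ifs with ha
    -- The delay drops by at most `g`, and `length_refine_lt` saves one segment of `g` layers.
    · obtain ⟨d, l', rfl⟩ : ∃ d l', l = d :: l' := by
        cases l with
        | nil => exact absurd (show (0 : ℕ) = I.m + 1 from hR.path) (by omega)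
        | cons d l' => exact ⟨d, l', rfl⟩
      rw [hR.path.1] at ha
      have := Ranks.length_refine_lt (l := l') ha
      have h3 := Nat.mul_le_mul_right g this
      rw [Nat.add_mul] at h3
      have h4 : 2 * (d :: l').length * g = (d :: l').length * (2 * g) := by ring
      omega
    · have h3 := Nat.mul_le_mul_right g (Ranks.length_refine_le (σ₁.warr 5) 0 l)
      have h4 : 2 * l.length * g = l.length * (2 * g) := by ring
      omega
  · simpa [d0] using cn h2
  · subst hl
    have h6 : σ.warr 6 0 = I.m + 1 := hR.path.1
    have hb : I.Between (· ∈ 0 :: [I.m + 1]) (σ.warr 6) 0 (I.m + 1) :=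
      ⟨by simp, by omega, by omega, h6.ge, hR.path.2.2.1, by rw [h6]⟩
    have hd : Ranks.delay δ 0 = δ := by simp [Ranks.delay]
    simp only [setWord_real, d0, cr h2]
    obtain ⟨v, _, hr, _⟩ := hV₀
    have h7 := hI₁.exact hb hr (by omega)
    rw [hd] at h7
    exact ⟨h7.2.1, fun v hv => hI₁.up 0 (I.m + 1) v hb (by rwa [hd])⟩

/-- Rounds until consecutive milestones are one layer apart. -/
def rounds : Prog := .loop (.wlt 3 38) round

/-- The numbers of layers form a geometric series: 362 = 2 · 180 + 2, where the surplus pays for the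
loop tests. The cost of the milestones never decreases, and the recorded value is not touched. -/
lemma rounds_tail {I : Ranks} {h W s : ℕ} (i : ℕ) : ∀ (δ : ℕ) (l : List ℕ) (σ : State) (V : ℝ),
    RoundInv I h W s δ (2 ^ i) l σ → 2 ^ i < σ.word 41 → 2 ^ i + 1 < W → δ < W →
    I.Feasible δ (2 ^ i) 0 l V →
    wp W s rounds σ fun t σ' => t ≤ 362 * (2 ^ i * ((I.np + 2 ^ h) * (h + 1))) ∧
      ∃ l', RoundInv I h W s 0 1 l' σ' ∧ l'.length + δ ≤ l.length * 2 ^ i ∧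
        V ≤ I.pathCost 0 l' ∧ σ'.real 0 = σ.real 0 := by
  have hpos : 1 ≤ 2 ^ h := Nat.one_le_two_pow
  have hX : 1 ≤ (I.np + 2 ^ h) * (h + 1) := by nlinarith [Nat.zero_le (I.np * (h + 1)), Nat.zero_le (2 ^ h * h)]
  generalize hXe : (I.np + 2 ^ h) * (h + 1) = X at *
  induction i with
  | zero =>
    intro δ l σ V hR h41 _ hδ hV
    rw [pow_zero] at *
    obtain rfl := hV.delay_eq_zero hR.path
    refine wp_loop_false (by simp [Test.Holds, hR.env.consts.w3, hR.w38]) ⟨by omega, l, hR, by omega, ?_, rfl⟩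
    exact (hV.eq_pathCost hR.path).le
  | succ i ih =>
    intro δ l σ V hR h41 hLW hδ hV
    have hp : 1 ≤ 2 ^ i := Nat.one_le_two_pow
    have e2 : 2 ^ (i + 1) = 2 * 2 ^ i := by ring
    rw [e2] at hR h41 hLW hV ⊢
    refine wp_loop_true (by simp [Test.Holds, hR.env.consts.w3, hR.w38]; omega) ?_
    refine wp_call (round_spec hR hp hLW hδ hV) ?_
    rintro t σ' ⟨ht, l', δ', hR', hδ', hlen, hfe, hne, -⟩ hF
    obtain ⟨V', hVV, hV'⟩ := hfe V hV
    have h41' : σ'.word 41 = σ.word 41 := hF.w 41 (by decide)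
    refine wp_mono (ih δ' l' σ' V' hR' (by omega) (by omega) (by omega) hV') ?_
    rintro u σ'' ⟨hu, l'', hR'', hlen', hV'', h0⟩
    rw [hXe] at ht
    refine ⟨?_, l'', hR'', by omega, by linarith, by rw [h0, hne (by omega)]⟩
    have : 1 ≤ 2 ^ i * X := Nat.mul_pos hp hX
    have e3 : 2 * 2 ^ i * X = 2 * (2 ^ i * X) := by ring
    rw [e3] at ht ⊢
    omega

/-- The first round computes the optimum, and refinement loses nothing, so the final list costs at
least the optimum. It is also an admissible chain, so it costs no more. -/
lemma rounds_spec {I : Ranks} {h W s δ i : ℕ} {σ : State} (hE : Env I h W s σ)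
    (h38 : σ.word 38 = 2 ^ (i + 1)) (h41 : σ.word 41 = 2 ^ (i + 1)) (h31 : σ.word 31 = δ)
    (h6 : σ.warr 6 0 = I.m + 1) (hnx : ∀ y, y ≤ I.m + 1 → σ.warr 6 y ≤ I.m + 1)
    (htag : ∀ y, y ≤ I.m + 1 → σ.warr 5 y < W) (hW : 2 ^ (i + 1) + 1 < W) (hδ : δ < 2 ^ (i + 1)) :
    wp W s rounds σ fun t σ' => t ≤ 362 * (2 ^ (i + 1) * ((I.np + 2 ^ h) * (h + 1))) ∧
      (∃ l, I.Path (σ'.warr 6) 0 l ∧ l.length + δ ≤ 2 ^ (i + 1) ∧ σ'.real 0 = I.pathCost 0 l) ∧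
      (∀ y, y ≤ I.m + 1 → σ'.warr 6 y ≤ I.m + 1) ∧
      ∀ v, I.Reach δ 0 (2 ^ (i + 1)) (I.m + 1) v → v ≤ σ'.real 0 := by
  have hpos : 1 ≤ 2 ^ h := Nat.one_le_two_pow
  have hX : 1 ≤ (I.np + 2 ^ h) * (h + 1) := by nlinarith [Nat.zero_le (I.np * (h + 1)), Nat.zero_le (2 ^ h * h)]
  have hp : 1 ≤ 2 ^ i := Nat.one_le_two_pow
  have e2 : 2 ^ (i + 1) = 2 * 2 ^ i := by ring
  have ht := hE.valid.tau_last
  have ht0 := hE.valid.tau_zero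
  rw [e2] at h38 h41 hW hδ ⊢
  have hP : I.Path (σ.warr 6) 0 [I.m + 1] := ⟨h6, by omega, by omega, rfl⟩
  have hfe1 : ∀ v, I.Reach δ 0 (2 * 2 ^ i) (I.m + 1) v → I.Feasible δ (2 * 2 ^ i) 0 [I.m + 1] v :=
    fun v hv => ⟨v, 0, by simpa [Ranks.delay] using hv, rfl, by simp⟩
  -- There is a chain at all: waiting until the last layer and stepping directly to the end, which
  -- is possible because `δ` is less than the number of layers.
  have hr0 : I.Reach δ 0 (2 * 2 ^ i) (I.m + 1) (0 + I.cost 0 (I.m + 1)) := by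
    rw [show 2 * 2 ^ i = (2 * 2 ^ i - 1) + 1 by omega]
    exact .step _ _ _ _ (.base _ (by omega)) (by omega) (by omega)
  refine wp_loop_true (by simp [Test.Holds, hE.consts.w3, h38]; omega) ?_
  refine wp_call (round_spec (l := [I.m + 1]) ⟨hE, h38, h31, hP, hnx, htag⟩ hp hW (by omega)
    (hfe1 _ hr0)) ?_
  rintro t σ' ⟨ht, l', δ', hR', hδ', hlen, hfe, -, hans⟩ hF
  obtain ⟨ha1, ha2⟩ := hans (by omega) rfl
  obtain ⟨V', hVV, hV'⟩ := hfe _ (hfe1 _ ha1)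
  have h41' : σ'.word 41 = σ.word 41 := hF.w 41 (by decide)
  refine wp_mono (rounds_tail i δ' l' σ' V' hR' (by omega) (by omega) (by omega) hV') ?_
  rintro u σ'' ⟨hu, l'', hR'', hlen', hV'', h0⟩
  generalize (I.np + 2 ^ h) * (h + 1) = X at *
  simp only [List.length_singleton] at hlen
  have hl : l''.length + δ ≤ 2 * 2 ^ i := by omega
  refine ⟨?_, ⟨l'', hR''.path, hl, ?_⟩, hR''.nx, by rw [h0]; exact ha2⟩
  · have : 1 ≤ 2 ^ i * X := Nat.mul_pos hp hX
    have e3 : 2 * 2 ^ i * X = 2 * (2 ^ i * X) := by ring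
    rw [e3] at ht ⊢
    omega
  · rw [h0]
    refine le_antisymm (by linarith) (ha2 _ ?_)
    -- The final list as a chain: it waits at the start as long as its length permits, which is at
    -- least `δ` layers.
    have := (Ranks.Reach.base (I := I) (d := δ) (c := 0) (2 * 2 ^ i - l''.length) (by omega)).append_path hR''.path
    rw [zero_add, show 2 * 2 ^ i - l''.length + l''.length = 2 * 2 ^ i by omega] at this
    exact this

end MaxDominance

namespace MaxDominance

/-! ### Preparation -/

/-- Double the word register `r` until it is at least the word register `b`. -/
def doubling (r b : ℕ) : Prog := .loop (.wlt r b) (.instr (.wop .add r r r))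

lemma doubling_spec {W s r b B : ℕ} {σ : State} (hrb : r ≠ b) (hr : σ.word r = 1)
    (hb : σ.word b = B) (hB : 1 ≤ B) (hW : 2 * B < W) :
    wp W s (doubling r b) σ fun t σ' => ∃ h, t ≤ 2 * 2 ^ h ∧ σ'.word r = 2 ^ h ∧ B ≤ 2 ^ h ∧
      2 ^ h < 2 * B := by
  suffices H : ∀ d h (σ : State), B - 2 ^ h = d → 2 ^ h < 2 * B → σ.word r = 2 ^ h →
      σ.word b = B → wp W s (doubling r b) σ fun t σ' => ∃ h', t + 2 * 2 ^ h ≤ 2 * 2 ^ h' + 1 ∧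
        σ'.word r = 2 ^ h' ∧ B ≤ 2 ^ h' ∧ 2 ^ h' < 2 * B by
    refine wp_mono (H _ 0 σ rfl (by omega) (by simpa using hr) hb) ?_
    rintro t σ' ⟨h, h1, h2⟩
    exact ⟨h, by omega, h2⟩
  intro d
  induction d using Nat.strong_induction_on with
  | _ d ih =>
    intro h σ hd hlt hr hb
    have hpos : 1 ≤ 2 ^ h := Nat.one_le_two_pow
    have eq : 2 ^ (h + 1) = 2 * 2 ^ h := by ring
    by_cases hc : 2 ^ h < B
    · refine wp_loop_true (by simp [Test.Holds, hr, hb, hc]) ?_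
      rw [wp_wadd, hr]
      refine ⟨by omega, ?_⟩
      refine wp_mono (ih (B - 2 ^ (h + 1)) (by omega) (h + 1) _ rfl (by omega) (by simp; omega)
        (by simp [hrb.symm, hb])) ?_
      rintro t σ' ⟨h', h1, h2⟩
      exact ⟨h', by omega, h2⟩
    · exact wp_loop_false (by simp [Test.Holds, hr, hb]; omega) ⟨h, by omega, hr, by omega, hlt⟩

/-- Ranks, cells and the parameters of the rounds. -/
def prepare : Prog :=
  .seq (.instr (.wconst 3 1)) <|
  .seq (.instr (.wconst 5 2)) <|
  .seq (.instr (.wop .add 8 1 3)) <|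
  .seq (.instr (.wop .add 7 8 3)) <|
  .seq (.instr (.wconst 6 1)) <|
  .seq (doubling 6 7) <|
  .seq (.instr (.wop .add 7 6 6)) <|
  .seq (sortDesc 3 2) <|
  .seq (sortDesc 4 3) <|
  .seq aggregate <|
  .seq buildBuckets <|
  .seq buildPositions <|
  .seq buildPenalty <|
  .seq (.instr (.wop .add 40 2 3)) <|
  .seq (.instr (.wconst 41 1)) <|
  .seq (doubling 41 40) <|
  .seq (.instr (.wop .sub 31 41 40)) <|
  .seq (.instr (.wmove 38 41)) <|
  .instr (.wstore 8 6 4)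

/-- The times as the inverse of the enumeration `PI` of the positions. -/
def timeOf (m : ℕ) (PI : ℕ → ℕ) (x : ℕ) : ℕ :=
  ∑ t ∈ Finset.range (m + 1), if PI t = x then t + 1 else 0

/-- `PI` is injective because `f` turns it into the injective order `g` and the end is kept apart;
counting makes it onto. The sum that defines `timeOf` then has exactly one nonzero term at a
position and none at 0. -/
lemma valid_timeOf {I : Ranks} {PI f g : ℕ → ℕ} {key : ℕ → ℝ} (hτ : I.τ = timeOf I.m PI)
    (hg : SortedIdx I.m key g) (hlast : PI I.m = I.m + 1)
    (hPI : ∀ t, t < I.m → 1 ≤ PI t ∧ PI t ≤ I.m ∧ f (I.m - PI t) = g t)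
    (hcol : ∀ c, c < I.np → I.CA c ≤ I.m + 1) (hrow : ∀ c, c < I.np → I.CT c ≤ I.m) :
    I.Valid PI := by
  have hpos : ∀ t, t ≤ I.m → 1 ≤ PI t ∧ PI t ≤ I.m + 1 := fun t ht => by
    rcases Nat.lt_or_eq_of_le ht with h | rfl
    · have := hPI t h; omega
    · omega
  have hinj : ∀ t u, t ≤ I.m → u ≤ I.m → PI t = PI u → t = u := fun t u ht hu h => by
    rcases Nat.lt_or_eq_of_le ht with h1 | rfl <;> rcases Nat.lt_or_eq_of_le hu with h2 | rfl
    · refine hg.inj t u h1 h2 ?_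
      rw [← (hPI t h1).2.2, ← (hPI u h2).2.2, h]
    · have := hPI t h1; omega
    · have := hPI u h2; omega
    · rfl
  refine ⟨?_, fun t ht => ⟨(hpos t ht).1, (hpos t ht).2, ?_⟩, fun x h1 h2 => ?_, hlast, hcol, hrow⟩
  · rw [hτ, timeOf]
    refine Finset.sum_eq_zero fun t ht => if_neg ?_
    have := hpos t (by simpa [Nat.lt_succ_iff] using ht)
    omega
  · rw [hτ, timeOf, Finset.sum_eq_single t]
    · simp
    · intro u hu hne
      refine if_neg fun h => hne (hinj u t (by simpa [Nat.lt_succ_iff] using hu) ht h)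
    · intro h; simp at h; omega
  · obtain ⟨t, ht, h⟩ := Finset.surj_on_of_inj_on_of_card_le (s := Finset.range (I.m + 1))
      (t := Finset.Icc 1 (I.m + 1)) (fun t _ => PI t)
      (fun t ht => by simpa using hpos t (by simpa [Nat.lt_succ_iff] using ht))
      (fun t u ht hu h => hinj t u (by simpa [Nat.lt_succ_iff] using ht)
        (by simpa [Nat.lt_succ_iff] using hu) h) (by simp) x (by simp [h1, h2])
    exact ⟨t, by simpa [Nat.lt_succ_iff] using ht, h.symm⟩

/-- The ranks `I` describe the points in the arrays of the state `σ`, sorted by `XI` and `YI`. -/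
structure Describes (n : ℕ) (I : Ranks) (σ : State) (XI YI PI : ℕ → ℕ) : Prop where
  X : SortedIdx I.m (σ.rarr 3) XI
  Y : SortedIdx I.m (σ.rarr 4) YI
  agg : Aggregated n I.m I.np (fun i => colOf I.m (σ.rarr 3) XI (σ.rarr 0 i))
    (fun i => countGe I.m (σ.rarr 4) YI (σ.rarr 1 i)) (σ.rarr 2) I.CA I.CT I.CW
  idx : ∀ t, t < I.m → XI (I.m - PI t) = YI t

/-- The result `σ'` of the preparation in the state `σ`. -/
structure Prepared (n m k W s : ℕ) (σ : State) (I : Ranks) (h i : ℕ) (σ' : State) : Prop where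
  env : Env I h W s σ'
  m_eq : I.m = m
  np_eq : I.np = min n ((m + 1) * (m + 1))
  h_lt : 2 ^ h < 2 * (m + 2)
  le_i : k + 1 ≤ 2 ^ i
  i_lt : 2 ^ i < 2 * (k + 1)
  w38 : σ'.word 38 = 2 ^ i
  w41 : σ'.word 41 = 2 ^ i
  w31 : σ'.word 31 = 2 ^ i - (k + 1)
  nx_zero : σ'.warr 6 0 = m + 1
  nx : ∀ y, σ'.warr 6 y ≤ m + 1
  tag : ∀ y, σ'.warr 5 y = 0
  desc : Describes n I σ (σ'.warr 2) (σ'.warr 3) (σ'.warr 11)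

set_option maxHeartbeats 400000 in
lemma prepare_spec {W s n m k : ℕ} {σ : State} (hn : σ.word 0 = n) (hm : σ.word 1 = m)
    (hk : σ.word 2 = k) (h4 : σ.word 4 = 0) (h17 : σ.real 17 = 0)
    (hwa : ∀ A ∈ [5, 6, 7, 8, 9], σ.warr A = fun _ => 0) (hra : σ.rarr 8 = fun _ => 0)
    (hs : n + 4 * (m + 2) ≤ s) (hsW : s < W) (hmW : (m + 1) * (m + 1) < W) (hkW : 2 * (k + 1) < W) :
    wp W s prepare σ fun t σ' => ∃ (I : Ranks) (h i : ℕ), Prepared n m k W s σ I h i σ' ∧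
      t ≤ 140 * (2 ^ h * (h + 1)) + 14 * (n * (h + 2)) + 13 * n + 2 * 2 ^ i + 40 := by
  unfold prepare
  simp only [wp_seq, wp_wconst, wp_wadd]
  simp [hm]
  refine ⟨by omega, by omega, by omega, by omega, by omega, ?_⟩
  refine wp_call (doubling_spec (B := m + 2) (by decide) (by simp) (by simp) (by omega) (by omega)) ?_
  rintro t₁ σ₁ ⟨h, ht₁, h6, hm2, hlt⟩ hF₁
  have eq : 2 ^ (h + 1) = 2 * 2 ^ h := by ring
  refine ⟨by omega, ?_⟩
  have hc₂ : Consts h W s (σ₁.setWord 7 (σ₁.word 6 + σ₁.word 6)) := by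
    refine ⟨?_, ?_, ?_, ?_, ?_, ?_, by omega, by omega⟩
    · simp [hF₁.w 3 (by decide)]
    · simp [hF₁.w 4 (by decide), h4]
    · simp [hF₁.w 5 (by decide)]
    · simp [h6]
    · simp [h6]; omega
    · simp [hF₁.r 17 (by decide), h17]
  have w₂ : ∀ r ∈ [0, 1, 2], (σ₁.setWord 7 (σ₁.word 6 + σ₁.word 6)).word r = σ.word r := fun r hr => by
    fin_cases hr <;> simp [hF₁.w 0 (by decide), hF₁.w 1 (by decide), hF₁.w 2 (by decide)]
  have w8₂ : (σ₁.setWord 7 (σ₁.word 6 + σ₁.word 6)).word 8 = m + 1 := by simp [hF₁.w 8 (by decide)]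
  have wa₂ : ∀ A, (σ₁.setWord 7 (σ₁.word 6 + σ₁.word 6)).warr A = σ.warr A := fun A => by
    simp [hF₁.wa A (by simp [doubling, Prog.collect, Instr.waw])]
  have ra₂ : ∀ A, (σ₁.setWord 7 (σ₁.word 6 + σ₁.word 6)).rarr A = σ.rarr A := fun A => by
    simp [hF₁.ra A (by simp [doubling, Prog.collect, Instr.raw])]
  generalize σ₁.setWord 7 (σ₁.word 6 + σ₁.word 6) = σ₂ at *
  refine wp_call (sortDesc_spec (src := 3) (dst := 2) hc₂ ((w₂ 1 (by simp)).trans hm) (by omega)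
    (by decide) (by decide) (by decide)) ?_
  rintro t₃ σ₃ ⟨ht₃, hX₃⟩ hF₃
  have hc₃ : Consts h W s σ₃ := hc₂.frame hF₃ (by decide) (by decide)
  refine wp_call (sortDesc_spec (src := 4) (dst := 3) hc₃
    ((hF₃.w 1 (by decide)).trans ((w₂ 1 (by simp)).trans hm)) (by omega)
    (by decide) (by decide) (by decide)) ?_
  rintro t₄ σ₄ ⟨ht₄, hY₄⟩ hF₄
  have hc₄ : Consts h W s σ₄ := hc₃.frame hF₄ (by decide) (by decide)
  have w₄ : ∀ r, r ∈ [0, 1, 2] → σ₄.word r = σ.word r := fun r hr => by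
    rw [← w₂ r hr]
    fin_cases hr
    · exact (hF₄.w 0 (by decide)).trans (hF₃.w 0 (by decide))
    · exact (hF₄.w 1 (by decide)).trans (hF₃.w 1 (by decide))
    · exact (hF₄.w 2 (by decide)).trans (hF₃.w 2 (by decide))
  have w8₄ : σ₄.word 8 = m + 1 := (hF₄.w 8 (by decide)).trans ((hF₃.w 8 (by decide)).trans w8₂)
  have wa₄ : ∀ A ∈ [5, 6, 7, 8, 9], σ₄.warr A = fun _ => 0 := fun A hA => by
    rw [← hwa A hA, ← wa₂ A]
    refine (hF₄.wa A ?_).trans (hF₃.wa A ?_) <;> fin_cases hA <;> decide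
  have ra₄ : ∀ A ∈ [0, 1, 2, 3, 4, 8], σ₄.rarr A = σ.rarr A := fun A hA => by
    rw [← ra₂ A]
    refine (hF₄.ra A ?_).trans (hF₃.ra A ?_) <;> fin_cases hA <;> decide
  have hX₄ : SortedIdx m (σ.rarr 3) (σ₄.warr 2) := by
    rw [hF₄.wa 2 (by decide), ← ra₂ 3]; exact hX₃
  rw [hF₃.ra 4 (by decide), ra₂ 4] at hY₄
  refine wp_call (aggregate_spec (n := n) hc₄ ((w₄ 0 (by simp)).trans hn) ((w₄ 1 (by simp)).trans hm) w8₄ hm2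
    (by omega) hsW hmW (by rw [ra₄ 3 (by simp)]; exact hX₄) (by rw [ra₄ 4 (by simp)]; exact hY₄)
    (wa₄ 7 (by simp)) (wa₄ 8 (by simp)) ((ra₄ 8 (by simp)).trans hra)) ?_
  rintro t₅ σ₅ ⟨ht₅, hnp, hagg⟩ hF₅
  rw [ra₄ 0 (by simp), ra₄ 1 (by simp), ra₄ 2 (by simp), ra₄ 3 (by simp), ra₄ 4 (by simp)] at hagg
  have hc₅ : Consts h W s σ₅ := hc₄.frame hF₅ (by decide) (by decide)
  have hns : σ₅.word 9 ≤ n := by rw [hnp]; exact min_le_left _ _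
  refine wp_call (buildBuckets_spec hc₅ rfl hm2 (by omega) hsW hagg.row
    ((hF₅.wa 9 (by decide)).trans (wa₄ 9 (by simp)))) ?_
  rintro t₆ σ₆ ⟨ht₆, hbk⟩ hF₆
  have hc₆ : Consts h W s σ₆ := hc₅.frame hF₆ (by decide) (by decide)
  have x₆ : σ₆.warr 2 = σ₄.warr 2 := (hF₆.wa 2 (by decide)).trans (hF₅.wa 2 (by decide))
  have y₆ : σ₆.warr 3 = σ₄.warr 3 := (hF₆.wa 3 (by decide)).trans (hF₅.wa 3 (by decide))
  have w1₆ : σ₆.word 1 = m := (hF₆.w 1 (by decide)).trans ((hF₅.w 1 (by decide)).trans ((w₄ 1 (by simp)).trans hm))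
  have w8₆ : σ₆.word 8 = m + 1 := (hF₆.w 8 (by decide)).trans ((hF₅.w 8 (by decide)).trans w8₄)
  refine wp_call (buildPositions_spec hc₆ w1₆ w8₆ hm2
    (by rw [x₆]; exact hX₄) (by rw [y₆]; exact hY₄)) ?_
  rintro t₇ σ₇ ⟨ht₇, hlast, hPI⟩ hF₇
  have hc₇ : Consts h W s σ₇ := hc₆.frame hF₇ (by decide) (by decide)
  have w9₇ : σ₇.word 9 = σ₅.word 9 := (hF₇.w 9 (by decide)).trans (hF₆.w 9 (by decide))
  refine wp_call (buildPenalty_spec hc₇ w9₇ (by omega) hsW) ?_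
  rintro t₈ σ₈ ⟨ht₈, hpen⟩ hF₈
  have hc₈ : Consts h W s σ₈ := hc₇.frame hF₈ (by decide) (by decide)
  have w2₈ : σ₈.word 2 = k := by
    rw [hF₈.w 2 (by decide), hF₇.w 2 (by decide), hF₆.w 2 (by decide), hF₅.w 2 (by decide),
      w₄ 2 (by simp), hk]
  have w1₈ : σ₈.word 1 = m := by rw [hF₈.w 1 (by decide), hF₇.w 1 (by decide), w1₆]
  have w8₈ : σ₈.word 8 = m + 1 := by rw [hF₈.w 8 (by decide), hF₇.w 8 (by decide), w8₆]
  have w9₈ : σ₈.word 9 = σ₅.word 9 := by rw [hF₈.w 9 (by decide), w9₇]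
  have wa5₈ : σ₈.warr 5 = fun _ => 0 := by
    rw [hF₈.wa 5 (by decide), hF₇.wa 5 (by decide), hF₆.wa 5 (by decide), hF₅.wa 5 (by decide), wa₄ 5 (by simp)]
  have wa6₈ : σ₈.warr 6 = fun _ => 0 := by
    rw [hF₈.wa 6 (by decide), hF₇.wa 6 (by decide), hF₆.wa 6 (by decide), hF₅.wa 6 (by decide), wa₄ 6 (by simp)]
  have wa2₈ : σ₈.warr 2 = σ₄.warr 2 := by rw [hF₈.wa 2 (by decide), hF₇.wa 2 (by decide), x₆]
  have wa3₈ : σ₈.warr 3 = σ₄.warr 3 := by rw [hF₈.wa 3 (by decide), hF₇.wa 3 (by decide), y₆]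
  have wa11₈ : σ₈.warr 11 = σ₇.warr 11 := hF₈.wa 11 (by decide)
  rw [x₆, y₆, ← wa2₈, ← wa3₈, ← wa11₈] at hPI
  rw [← wa11₈] at hlast
  -- The abstract instance is read off the memory; the times exist only in the proof, as the inverse
  -- of array 11.
  set I : Ranks := ⟨m, σ₅.word 9, timeOf m (σ₈.warr 11), σ₅.warr 7, σ₅.warr 8, σ₅.rarr 8⟩ with hI
  have hE₈ : Env I h W s σ₈ := by
    refine ⟨hc₈, ?_, w1₈, w8₈, w9₈, ?_, ?_, ?_, ?_, hm2, ?_, hsW⟩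
    · exact valid_timeOf (f := σ₈.warr 2) (g := σ₈.warr 3) (key := σ.rarr 4) rfl (by rw [wa3₈]; exact hY₄) hlast hPI hagg.col hagg.row
    · rw [hF₈.wa 7 (by decide), hF₇.wa 7 (by decide), hF₆.wa 7 (by decide)]
    · rw [hF₈.ra 8 (by decide), hF₇.ra 8 (by decide), hF₆.ra 8 (by decide)]
    · rw [hF₈.wa 10 (by decide), hF₇.wa 10 (by decide), hF₈.wa 9 (by decide), hF₇.wa 9 (by decide)]
      exact hbk
    · rw [hpen, hF₇.ra 8 (by decide), hF₆.ra 8 (by decide)]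
      rfl
    · show σ₅.word 9 ≤ s
      omega
  refine ⟨by rw [w2₈, hc₈.w3]; omega, by omega, ?_⟩
  refine wp_call (doubling_spec (B := k + 1) (by decide) (by simp) (by simp [w2₈, hc₈.w3]) (by omega) (by omega)) ?_
  rintro t₉ σ₉ ⟨i, ht₉, h41, hk1, hk2⟩ hF₉
  have hE₉ : Env I h W s σ₉ := Env.frame (hE₈.congr (fun r hr => by fin_cases hr <;> simp) (by simp) (by simp) (by simp)) hF₉
    (by decide) (by decide) (by decide) (by decide)
  have w40₉ : σ₉.word 40 = k + 1 := by rw [hF₉.w 40 (by decide)]; simp [w2₈, hc₈.w3]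
  have wa₉ : ∀ A, σ₉.warr A = σ₈.warr A := fun A => by
    rw [hF₉.wa A (by simp [doubling, Prog.collect, Instr.waw])]; simp
  simp only [wp_wsub, wp_wmove, wp_wstore]
  have hw8 : σ₉.word 8 = m + 1 := hE₉.w8
  refine ⟨by rw [h41, w40₉]; omega, by simp [h41]; omega,
    ⟨by simp [hE₉.consts.w4]; omega, by simp [hw8]; omega⟩, I, h, i,
    ⟨hE₉.congr (fun r hr => by fin_cases hr <;> simp) (by simp) (fun r hr => by fin_cases hr <;> simp) (by simp),
    rfl, by rw [← hnp], hlt, hk1, hk2, by simp [h41], by simp [h41], by simp [h41, w40₉],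
    by simp [hE₉.consts.w4, hw8], ?_, by simp [wa₉, wa5₈], ?_⟩, ?_⟩
  · intro y
    simp [hw8, hE₉.consts.w4, wa₉, wa6₈, Function.update_apply]
    split_ifs <;> omega
  · have e : ∀ A, A ≠ 6 → ((((σ₉.setWord 31 (σ₉.word 41 - σ₉.word 40)).setWord 38
        ((σ₉.setWord 31 (σ₉.word 41 - σ₉.word 40)).word 41)).setWarr 6
        (((σ₉.setWord 31 (σ₉.word 41 - σ₉.word 40)).setWord 38
        ((σ₉.setWord 31 (σ₉.word 41 - σ₉.word 40)).word 41)).word 4)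
        (((σ₉.setWord 31 (σ₉.word 41 - σ₉.word 40)).setWord 38
        ((σ₉.setWord 31 (σ₉.word 41 - σ₉.word 40)).word 41)).word 8))).warr A = σ₈.warr A :=
      fun A hA => by simp [hA, wa₉]
    rw [e 2 (by decide), e 3 (by decide), e 11 (by decide)]
    refine ⟨?_, ?_, ?_, fun t ht => (hPI t ht).2.2⟩
    · rw [wa2₈]; exact hX₄
    · rw [wa3₈]; exact hY₄
    · rw [wa2₈, wa3₈]; exact hagg
  · have : 2 ^ h ≤ 2 ^ h * (h + 1) := Nat.le_mul_of_pos_right _ (by omega)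
    linarith only [this, ht₁, ht₃, ht₄, ht₅, ht₆, ht₇, ht₈, ht₉, hm2, hns]

/-! ### Output -/

/-- List the points of the chain. -/
def output : Prog :=
  .seq (.instr (.wconst 0 0)) <|
  .seq (.instr (.wload 20 6 4)) <|
  .loop (.wlt 20 8)
    (.seq (.instr (.wop .sub 21 1 20)) <|
     .seq (.instr (.wload 21 2 21)) <|
     .seq (.instr (.wstore 21 0 0)) <|
     .seq (.instr (.wop .add 0 0 3)) <|
     .instr (.wload 20 6 20))

/-- The list increases strictly, so nothing is repeated, and the filter discards only the end. -/
lemma Ranks.Path.card {I : Ranks} {nx : ℕ → ℕ} {c : ℕ} {l : List ℕ} (hP : I.Path nx c l) :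
    ((c :: l).toFinset.filter (· ≤ I.m)).card = l.length := by
  induction l generalizing c with
  | nil =>
    obtain rfl : c = I.m + 1 := hP
    simp [Finset.filter_singleton]
  | cons d l ih =>
    have h1 := hP.lt
    have h2 := hP.2.2.2.le_last d (by simp)
    have h3 := ih hP.2.2.2
    rw [List.toFinset_cons, Finset.filter_insert, if_pos (by have := hP.2.1; omega),
      Finset.card_insert_of_notMem, h3]
    · simp
    · intro hc
      simp only [Finset.mem_filter, List.mem_toFinset] at hc
      exact absurd (h1 c hc.1).1 (lt_irrefl _)

lemma output_spec {I : Ranks} {h W s d : ℕ} {l : List ℕ} {σ : State} (hE : Env I h W s σ)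
    (hP : I.Path (σ.warr 6) 0 (d :: l)) (hX : ∀ a, a < I.m → σ.warr 2 a < I.m) :
    wp W s output σ fun t σ' => t ≤ 6 * 2 ^ h ∧ σ'.word 0 = l.length ∧
      (Finset.range l.length).image (σ'.warr 0) =
        ((d :: l).toFinset.filter (· ≤ I.m)).image fun x => σ.warr 2 (I.m - x) := by
  have hc := hE.consts
  have hlW := hc.lW
  have hls := hc.ls
  have hpos : 1 ≤ 2 ^ h := Nat.one_le_two_pow
  have eq : 2 ^ (h + 1) = 2 * 2 ^ h := by ring
  have hm := hE.hm
  -- The condition `cnt < c` keeps the output cell within bounds: fewer points have been listed than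
  -- there are positions up to `c`.
  have key : ∀ (l : List ℕ) (c cnt : ℕ) (ρ : State), 1 ≤ c → cnt < c → Env I h W s ρ →
      ρ.warr 6 = σ.warr 6 → ρ.warr 2 = σ.warr 2 → ρ.word 20 = c → ρ.word 0 = cnt →
      I.Path (σ.warr 6) c l → wp W s (.loop (.wlt 20 8)
        (.seq (.instr (.wop .sub 21 1 20)) <|
         .seq (.instr (.wload 21 2 21)) <|
         .seq (.instr (.wstore 21 0 0)) <|
         .seq (.instr (.wop .add 0 0 3)) <|
         .instr (.wload 20 6 20))) ρ fun t σ' => t ≤ 6 * l.length + 1 ∧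
          σ'.word 0 = cnt + l.length ∧ (Finset.range (cnt + l.length)).image (σ'.warr 0) =
            (Finset.range cnt).image (ρ.warr 0) ∪
            ((c :: l).toFinset.filter (· ≤ I.m)).image fun x => σ.warr 2 (I.m - x) := by
    intro l
    induction l with
    | nil =>
      intro c cnt ρ _ _ hE' _ _ h20 h0 hP
      obtain rfl : c = I.m + 1 := hP
      exact wp_loop_false (by simp [Test.Holds, h20, hE'.w8]) ⟨by simp, by simp [h0], by simp [Finset.filter_singleton]⟩
    | cons e l ih =>
      intro c cnt ρ hc1 hcc hE' h6 h2 h20 h0 hP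
      have hle := hP.2.2.2.le_last e (by simp)
      obtain ⟨q0, q1, q2, q3⟩ := hP
      have hXc := hX (I.m - c) (by omega)
      refine wp_loop_true (by simp [Test.Holds, h20, hE'.w8]; omega) ?_
      simp only [wp_seq, wp_wsub, wp_wload, wp_wstore, wp_wadd]
      simp [h20, h0, hE'.w1, h2, h6, q0, hE'.consts.w3]
      refine ⟨by omega, ⟨by omega, by omega⟩, ⟨by omega, by omega⟩, by omega, ⟨by omega, by omega⟩, ?_⟩
      refine wp_mono (ih e (cnt + 1) _ (by omega) (by omega) (hE'.congr (fun r hr => by fin_cases hr <;> simp) (by simp) (fun r hr => by fin_cases hr <;> simp) (by simp)) (by simp [h6]) (by simp [h2]) (by simp) (by simp) q3) ?_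
      rintro t σ' ⟨ht, h1, him⟩
      refine ⟨by omega, by omega, ?_⟩
      rw [show cnt + (l.length + 1) = cnt + 1 + l.length by omega, him]
      simp only [setWord_warr, setWarr_warr, if_true]
      have himg : (Finset.range cnt).image (Function.update (ρ.warr 0) cnt (σ.warr 2 (I.m - c))) =
          (Finset.range cnt).image (ρ.warr 0) :=
        Finset.image_congr fun y hy => by
          simp only [Finset.coe_range, Set.mem_Iio] at hy
          rw [Function.update_of_ne (by omega)]
      rw [Finset.range_add_one, Finset.image_insert, Function.update_self, himg,
        Finset.filter_insert, if_pos (by omega), Finset.image_insert]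
      ext y
      simp
  have hlen := hP.length
  have h1 := hP.2.1
  have h2 := hP.2.2.2.le_last d (by simp)
  unfold output
  simp only [wp_seq, wp_wconst, wp_wload]
  simp only [setWord_word, setWord_warr]
  simp only [show (4 : ℕ) ≠ 0 by decide, if_false, hc.w4, hP.1]
  refine ⟨by omega, ⟨by omega, by omega⟩, ?_⟩
  refine wp_mono (key l d 0 _ h1 h1 (hE.congr (fun r hr => by fin_cases hr <;> simp) (by simp) (by simp) (by simp)) (by simp) (by simp) (by simp) (by simp) hP.2.2.2) ?_
  rintro t σ' ⟨ht, h3, h4⟩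
  simp only [List.length_cons] at hlen
  exact ⟨by omega, by simpa using h3, by simpa using h4⟩

end MaxDominance

namespace MaxDominance

/-! ### Chains of positions and sets of points -/

section Geometry
variable {n : ℕ} {I : Ranks} {A T : ℕ → ℕ} {w : ℕ → ℝ}

open Classical in
/-- The weight of the points with ranks `A`, `T` that are dominated by a position in `S`. -/
noncomputable def Ranks.wt (I : Ranks) (n : ℕ) (A T : ℕ → ℕ) (w : ℕ → ℝ) (S : Set ℕ) : ℝ :=
  ∑ i ∈ Finset.range n, if ∃ x ∈ S, A i ≤ x ∧ I.τ x ≤ T i then w i else 0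

/-- After exchanging the sums, each cell counts in the one column it belongs to. The aggregation
identity for the indicator of the region then passes from cells to points. -/
lemma cost_eq (h : Aggregated n I.m I.np A T w I.CA I.CT I.CW) (x' x : ℕ) :
    I.cost x' x =
      ∑ i ∈ Finset.range n, if (x' < A i ∧ A i ≤ x) ∧ I.τ x ≤ T i then w i else 0 := by
  have := h.sum fun a t => if (x' < a ∧ a ≤ x) ∧ I.τ x ≤ t then 1 else 0
  simp only [ite_mul, one_mul, zero_mul] at this
  rw [← this]
  unfold Ranks.cost Ranks.col
  rw [Finset.sum_comm]
  refine Finset.sum_congr rfl fun c _ => ?_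
  by_cases ht : I.τ x ≤ I.CT c
  · simp only [ht, and_true]
    rw [Finset.sum_ite_eq]
    congr 1
    simp only [Finset.mem_Ico, eq_iff_iff]
    omega
  · simp [ht]

/-- Times increase along the list, so a point in a column up to `d` that is dominated by a later
position is dominated by `d` already. Each dominated point is therefore counted once, by the first
position that is not to the left of it. -/
lemma Ranks.Path.pathCost_eq {nx : ℕ → ℕ} {c : ℕ} {l : List ℕ} (hP : I.Path nx c l)
    (h : Aggregated n I.m I.np A T w I.CA I.CT I.CW) :
    I.pathCost c l = ∑ i ∈ Finset.range n,
      if ∃ x ∈ l, (c < A i ∧ A i ≤ x) ∧ I.τ x ≤ T i then w i else 0 := by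
  induction l generalizing c with
  | nil => simp [pathCost]
  | cons d l ih =>
    have hlt := hP.2.2.2.lt
    have h1 := hP.2.1
    rw [pathCost, ih hP.2.2.2, cost_eq h, ← Finset.sum_add_distrib]
    refine Finset.sum_congr rfl fun i _ => ?_
    by_cases hd : A i ≤ d
    · have e1 : ¬ ∃ x ∈ l, (d < A i ∧ A i ≤ x) ∧ I.τ x ≤ T i := by
        rintro ⟨_, _, ⟨_, _⟩, _⟩; omega
      have e2 : (∃ x ∈ d :: l, (c < A i ∧ A i ≤ x) ∧ I.τ x ≤ T i) ↔
          (c < A i ∧ A i ≤ d) ∧ I.τ d ≤ T i := by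
        constructor
        · rintro ⟨x, hx, ⟨ha, _⟩, ht⟩
          rcases List.mem_cons.1 hx with rfl | hx
          · exact ⟨⟨ha, hd⟩, ht⟩
          · have := hlt x hx
            exact ⟨⟨ha, hd⟩, by omega⟩
        · exact fun hh => ⟨d, by simp, hh⟩
      simp only [e1, e2, if_false, add_zero]
    · have e1 : ¬ ((c < A i ∧ A i ≤ d) ∧ I.τ d ≤ T i) := fun hh => hd hh.1.2
      have e2 : (∃ x ∈ d :: l, (c < A i ∧ A i ≤ x) ∧ I.τ x ≤ T i) ↔
          ∃ x ∈ l, (d < A i ∧ A i ≤ x) ∧ I.τ x ≤ T i := by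
        constructor
        · rintro ⟨x, hx, ⟨_, ha⟩, ht⟩
          rcases List.mem_cons.1 hx with rfl | hx
          · omega
          · exact ⟨x, hx, ⟨by omega, ha⟩, ht⟩
        · rintro ⟨x, hx, ⟨_, ha⟩, ht⟩
          exact ⟨x, by simp [hx], ⟨by omega, ha⟩, ht⟩
      simp only [e1, e2, if_false, zero_add]

/-- Every set of positions has the weight of a chain that is not longer. -/
lemma Ranks.Reach.of_finset {PI : ℕ → ℕ} (hV : I.Valid PI)
    (h : Aggregated n I.m I.np A T w I.CA I.CT I.CW) (hA : ∀ i, i < n → 1 ≤ A i) {d : ℕ}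
    (S : Finset ℕ) (hS : ∀ x ∈ S, 1 ≤ x ∧ x ≤ I.m) (j : ℕ) (hj : d ≤ j) :
    I.Reach d 0 (j + S.card) (S.sup id) (I.wt n A T w S) := by
  induction S using Finset.strongInduction generalizing j with
  | H S ih =>
    rcases S.eq_empty_or_nonempty with rfl | hne
    · have : I.wt n A T w (∅ : Finset ℕ) = 0 := by simp [Ranks.wt]
      rw [this]
      exact .base _ hj
    obtain ⟨x, hxS, hx⟩ := Finset.exists_mem_eq_sup S hne id
    have hle : ∀ y ∈ S, y ≤ x := fun y hy => by
      have : id y ≤ S.sup id := Finset.le_sup hy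
      rw [hx] at this
      exact this
    simp only [id] at hx
    have hτx := hV.tau_pos (hS x hxS).1 (by have := hS x hxS; omega)
    -- The rightmost position `x` dominates all that a position of no smaller time dominates; only
    -- the positions of smaller time matter besides `x`.
    set S₁ := S.filter fun y => y < x ∧ I.τ y < I.τ x with hS₁
    have hss : S₁ ⊂ S := Finset.filter_ssubset.2 ⟨x, hxS, by simp⟩
    have hcard := Finset.card_lt_card hss
    -- The layers saved by the discarded positions are spent waiting at the start.
    have hr := ih S₁ hss (fun y hy => hS y (hss.1 hy)) (j + (S.card - 1 - S₁.card)) (by omega)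
    set x₁ := S₁.sup id with hx₁
    have hx₁S : x₁ = 0 ∧ S₁ = ∅ ∨ x₁ ∈ S₁ := by
      rcases S₁.eq_empty_or_nonempty with he | he
      · left; rw [hx₁, he]; simp
      · right
        obtain ⟨y, hy, e⟩ := Finset.exists_mem_eq_sup S₁ he id
        rw [hx₁, e]; exact hy
    have hlt : x₁ < x ∧ I.τ x₁ < I.τ x := by
      rcases hx₁S with ⟨e, _⟩ | hm
      · rw [e, hV.tau_zero]
        have := hS x hxS
        omega
      · exact (Finset.mem_filter.1 hm).2
    have hst := Ranks.Reach.step _ _ _ _ hr hlt.1 hlt.2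
    rw [hx]
    convert hst using 1
    · omega
    · rw [cost_eq h, Ranks.wt, Ranks.wt, ← Finset.sum_add_distrib]
      refine Finset.sum_congr rfl fun i hi => ?_
      have hAi := hA i (by simpa using hi)
      -- What `S₁` dominates has a column up to `x₁` and is not counted again by the last step. What
      -- only `x` dominates lies beyond `x₁`: otherwise `x₁`, whose time is smaller, would dominate
      -- it.
      by_cases hc : ∃ y ∈ (S₁ : Set ℕ), A i ≤ y ∧ I.τ y ≤ T i
      · obtain ⟨y, hy, hy1, hy2⟩ := hc
        have hy' : y ∈ S₁ := hy
        have hyx : id y ≤ x₁ := Finset.le_sup hy'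
        simp only [id] at hyx
        rw [if_pos ⟨y, hss.1 hy', hy1, hy2⟩, if_pos ⟨y, hy, hy1, hy2⟩, if_neg (by omega), add_zero]
      · rw [if_neg hc, zero_add]
        congr 1
        refine propext ⟨?_, fun hh => ⟨x, hxS, hh.1.2, hh.2⟩⟩
        rintro ⟨y, hy, hy1, hy2⟩
        have hyx := hle y hy
        have hτ : I.τ x ≤ I.τ y := by
          by_contra hcon
          refine hc ⟨y, ?_, hy1, hy2⟩
          have : y ≠ x := fun e => by rw [e] at hcon; omega
          exact Finset.mem_coe.2 (Finset.mem_filter.2 ⟨hy, by omega, by omega⟩)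
        refine ⟨⟨?_, by omega⟩, by omega⟩
        rcases hx₁S with ⟨e, _⟩ | hm
        · omega
        · by_contra hcon
          exact hc ⟨x₁, hm, by omega, by omega⟩

/-- One more step leads to the end. It costs nothing, because the rows are at most m and the end has
time m + 1. -/
lemma Ranks.Reach.of_card_le {PI : ℕ → ℕ} (hV : I.Valid PI)
    (h : Aggregated n I.m I.np A T w I.CA I.CT I.CW) (hA : ∀ i, i < n → 1 ≤ A i)
    (hT : ∀ i, i < n → T i ≤ I.m) {k K : ℕ} (S : Finset ℕ) (hS : ∀ x ∈ S, 1 ≤ x ∧ x ≤ I.m)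
    (hk : S.card ≤ k) (hK : k + 1 ≤ K) :
    I.Reach (K - (k + 1)) 0 K (I.m + 1) (I.wt n A T w S) := by
  have hr := Ranks.Reach.of_finset hV h hA (d := K - (k + 1)) S hS (K - 1 - S.card) (by omega)
  have hlast := hV.tau_last
  have hsup : S.sup id ≤ I.m ∧ I.τ (S.sup id) ≤ I.m := by
    rcases S.eq_empty_or_nonempty with rfl | hne
    · simp [hV.tau_zero]
    · obtain ⟨x, hxS, hx⟩ := Finset.exists_mem_eq_sup S hne id
      rw [hx]
      have h1 := hS x hxS
      have h2 := hV.tau_pos h1.1 (by omega)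
      refine ⟨h1.2, ?_⟩
      by_contra hcon
      have := hV.tau_inj (x := x) (y := I.m + 1) (by omega) le_rfl (by simp at hcon; omega)
      omega
  have hst := Ranks.Reach.step _ _ (I.m + 1) _ hr (by omega) (by omega)
  have h0 : I.cost (S.sup id) (I.m + 1) = 0 := by
    rw [cost_eq h]
    refine Finset.sum_eq_zero fun i hi => if_neg fun hh => ?_
    have := hT i (by simpa using hi)
    omega
  rw [h0, add_zero] at hst
  convert hst using 1
  omega

end Geometry

/-! ### Ranks and the dominance of points in the plane -/

section Points
variable {n m : ℕ} {p : Fin n → ℝ × ℝ} {w : Fin n → ℝ} {q : Fin m → ℝ × ℝ} {k : ℕ} {I : Ranks}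
  {XI YI PI : ℕ → ℕ}

/-- The column of a point. -/
noncomputable def colRank (p : Fin n → ℝ × ℝ) (w : Fin n → ℝ) (q : Fin m → ℝ × ℝ) (k : ℕ)
    (XI : ℕ → ℕ) (i : ℕ) : ℕ := colOf m ((input p w q k).rarr 3) XI ((input p w q k).rarr 0 i)

/-- The row of a point. -/
noncomputable def rowRank (p : Fin n → ℝ × ℝ) (w : Fin n → ℝ) (q : Fin m → ℝ × ℝ) (k : ℕ)
    (YI : ℕ → ℕ) (i : ℕ) : ℕ := countGe m ((input p w q k).rarr 4) YI ((input p w q k).rarr 1 i)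

/-- If `C` abscissas are at least that of the point, these are the first `C` in sorted order, and
the index `m - x` is among them iff `m + 1 - C ≤ x`. If `D` ordinates are, the index `t = τ x - 1`
is among the first `D` iff `τ x ≤ D`. -/
lemma Describes.mem_dom (hD : Describes n I (input p w q k) XI YI PI) (hV : I.Valid PI)
    (hm : I.m = m) (i : Fin n) (j : Fin m) {x : ℕ} (h1 : 1 ≤ x) (h2 : x ≤ m)
    (hx : XI (m - x) = j) :
    p i ∈ dom (q j) ↔ colRank p w q k XI i ≤ x ∧ I.τ x ≤ rowRank p w q k YI i := by
  obtain ⟨hX, hY, -, hidx⟩ := hD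
  subst hm
  obtain ⟨hc1, hc2⟩ := hX.le_iff ((input p w q k).rarr 0 i)
  obtain ⟨hd1, hd2⟩ := hY.le_iff ((input p w q k).rarr 1 i)
  obtain ⟨t, ht, rfl⟩ := hV.surj x h1 (by omega)
  have htm : t < I.m := by
    rcases Nat.lt_or_eq_of_le ht with h | rfl
    · exact h
    · rw [hV.last] at h2; omega
  have e := hc2 (I.m - PI t) (by omega)
  have f := hd2 t htm
  rw [hx] at e
  rw [← hidx t htm, hx] at f
  have a3 : (input p w q k).rarr 3 j = (q j).1 := by simp [input, toArray]
  have a0 : (input p w q k).rarr 0 i = (p i).1 := by simp [input, toArray]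
  have a4 : (input p w q k).rarr 4 j = (q j).2 := by simp [input, toArray]
  have a1 : (input p w q k).rarr 1 i = (p i).2 := by simp [input, toArray]
  have : p i ∈ dom (q j) ↔ (p i).1 ≤ (q j).1 ∧ (p i).2 ≤ (q j).2 := by
    simp [dom, Prod.le_def]
  rw [this, ← a0, ← a1, ← a3, ← a4, e, f, (hV.pos t ht).2.2]
  unfold colRank rowRank colOf
  generalize countGe I.m _ XI _ = C at *
  generalize countGe I.m _ YI _ = D at *
  omega

lemma Describes.rowRank_le (hD : Describes n I (input p w q k) XI YI PI) (hm : I.m = m) (i : ℕ) :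
    rowRank p w q k YI i ≤ m := by
  have := (hD.Y.le_iff ((input p w q k).rarr 1 i)).1
  rw [hm] at this
  exact this

/-- The set `R` may contain the end m + 1, which dominates no point since its time exceeds every
row; so a whole chain can be inserted. -/
lemma Describes.weight_eq (hD : Describes n I (input p w q k) XI YI PI) (hV : I.Valid PI)
    (hm : I.m = m) {S : Finset (Fin m)} {R : Set ℕ}
    (hR : ∀ x ∈ R, 1 ≤ x ∧ x ≤ m + 1)
    (hSR : ∀ j : Fin m, j ∈ S ↔ ∃ x ∈ R, x ≤ m ∧ XI (m - x) = j) :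
    weight p w (domUnion (q '' S)) =
      I.wt n (colRank p w q k XI) (rowRank p w q k YI) ((input p w q k).rarr 2) R := by
  classical
  unfold weight Ranks.wt
  rw [Finset.sum_filter, Finset.sum_range]
  refine Finset.sum_congr rfl fun i _ => ?_
  have a2 : (input p w q k).rarr 2 i = w i := by simp [input, toArray]
  rw [a2]
  congr 1
  refine propext ?_
  have : p i ∈ domUnion (q '' S) ↔ ∃ j ∈ S, p i ∈ dom (q j) := by simp [domUnion]
  rw [this]
  constructor
  · rintro ⟨j, hj, hp⟩
    obtain ⟨x, hx, hxm, hxj⟩ := (hSR j).1 hj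
    exact ⟨x, hx, (hD.mem_dom hV hm i j (hR x hx).1 hxm hxj).1 hp⟩
  · rintro ⟨x, hx, h1, h2⟩
    obtain ⟨hx1, hx2⟩ := hR x hx
    have hxm : x ≤ m := by
      by_contra hcon
      obtain rfl : x = m + 1 := by omega
      have := hV.tau_last
      rw [hm] at this
      have := hD.rowRank_le hm i
      omega
    have hlt : XI (m - x) < m := by have := hD.X.lt (m - x) (by omega); omega
    exact ⟨⟨_, hlt⟩, (hSR _).2 ⟨x, hx, hxm, rfl⟩, (hD.mem_dom hV hm i ⟨_, hlt⟩ hx1 hxm rfl).2 ⟨h1, h2⟩⟩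

lemma Describes.colRank_pos (hD : Describes n I (input p w q k) XI YI PI) (hm : I.m = m) (i : ℕ) :
    1 ≤ colRank p w q k XI i := by
  have := (hD.X.le_iff ((input p w q k).rarr 0 i)).1
  rw [hm] at this
  unfold colRank colOf
  omega

lemma Describes.agg_rank (hD : Describes n I (input p w q k) XI YI PI) (hm : I.m = m) :
    Aggregated n I.m I.np (colRank p w q k XI) (rowRank p w q k YI) ((input p w q k).rarr 2)
      I.CA I.CT I.CW := by
  have := hD.agg
  subst hm
  exact this

/-- The value of a feasible solution is the cost of a chain. -/
lemma Describes.reach (hD : Describes n I (input p w q k) XI YI PI) (hV : I.Valid PI)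
    (hm : I.m = m) {K : ℕ} (hK : k + 1 ≤ K) {v : ℝ} (hv : v ∈ values p w q k) :
    I.Reach (K - (k + 1)) 0 K (I.m + 1) v := by
  classical
  obtain ⟨S, hS, rfl⟩ := hv
  set R := (Finset.Icc 1 m).filter fun x => ∃ j ∈ S, XI (m - x) = j.val with hR
  have hRm : ∀ x ∈ R, 1 ≤ x ∧ x ≤ m := fun x hx => by
    simpa using (Finset.mem_filter.1 hx).1
  have hinj : ∀ x ∈ R, ∀ y ∈ R, XI (m - x) = XI (m - y) → x = y := fun x hx y hy e => by
    have h1 := hRm x hx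
    have h2 := hRm y hy
    have := hD.X.inj (m - x) (m - y) (by omega) (by omega) e
    omega
  have hcard : R.card ≤ k := by
    refine le_trans ?_ hS
    rw [← Finset.card_image_of_injOn (s := R) (f := fun x => XI (m - x)) hinj,
      ← Finset.card_image_of_injective S Fin.val_injective]
    refine Finset.card_le_card fun a ha => ?_
    obtain ⟨x, hx, rfl⟩ := Finset.mem_image.1 ha
    obtain ⟨j, hj, e⟩ := (Finset.mem_filter.1 hx).2
    exact Finset.mem_image.2 ⟨j, hj, e.symm⟩
  rw [hD.weight_eq hV hm (R := R) (fun x hx => by have := hRm x hx; omega)]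
  · refine Ranks.Reach.of_card_le hV (hD.agg_rank hm) (fun i _ => hD.colRank_pos hm i)
      (fun i _ => by rw [hm]; exact hD.rowRank_le hm i) R (by rw [hm]; exact hRm) hcard hK
  · intro j
    constructor
    · intro hj
      obtain ⟨a, ha, e⟩ := hD.X.surj (i := j) (by have := j.2; omega)
      have e' : m - (m - a) = a := by omega
      exact ⟨m - a, Finset.mem_coe.2 (Finset.mem_filter.2 ⟨by simp; omega, j, hj, by rw [e', e]⟩), by omega, by rw [e', e]⟩
    · rintro ⟨x, hx, _, e⟩
      obtain ⟨j', hj', e'⟩ := (Finset.mem_filter.1 hx).2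
      obtain rfl : j = j' := Fin.ext (by rw [← e, e'])
      exact hj'

/-- A chain lists a feasible solution; its cost is the value. -/
lemma Describes.solution (hD : Describes n I (input p w q k) XI YI PI) (hV : I.Valid PI)
    (hm : I.m = m) {nx : ℕ → ℕ} {d : ℕ} {l : List ℕ} (hP : I.Path nx 0 (d :: l)) :
    ∃ S : Finset (Fin m), S.card = l.length ∧ I.pathCost 0 (d :: l) = weight p w (domUnion (q '' S)) ∧
      S.image Fin.val = ((d :: l).toFinset.filter (· ≤ I.m)).image fun x => XI (I.m - x) := by
  classical
  set R := (d :: l).toFinset.filter (· ≤ I.m) with hR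
  have hlt := hP.lt
  have hRm : ∀ x ∈ R, 1 ≤ x ∧ x ≤ I.m := fun x hx => by
    have h1 := Finset.mem_filter.1 hx
    have := hlt x (by simpa using h1.1)
    omega
  have hlt' : ∀ x ∈ R, XI (I.m - x) < m := fun x hx => by
    have := hRm x hx
    have := hD.X.lt (I.m - x) (by omega)
    omega
  refine ⟨Finset.univ.filter fun j : Fin m => ∃ x ∈ R, XI (I.m - x) = j, ?_, ?_, ?_⟩
  rotate_left
  · rw [hD.weight_eq hV hm (R := {x | x ∈ d :: l}), hP.pathCost_eq (hD.agg_rank hm), Ranks.wt]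
    · refine Finset.sum_congr rfl fun i _ => ?_
      have := hD.colRank_pos hm i
      congr 1
      simp only [Set.mem_ofPred_eq, eq_iff_iff]
      refine exists_congr fun x => and_congr_right fun _ => and_congr_left fun _ => ?_
      omega
    · intro x hx
      have h1 := hlt x hx
      have h2 := hP.le_last x (List.mem_cons_of_mem _ hx)
      omega
    · intro j
      simp only [Finset.mem_filter, Finset.mem_univ, true_and, hR, List.mem_toFinset,
        Set.mem_ofPred_eq, hm, and_assoc]
  · ext a
    simp only [Finset.mem_image, Finset.mem_filter, Finset.mem_univ, true_and]
    constructor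
    · rintro ⟨j, ⟨x, hx, e⟩, rfl⟩
      exact ⟨x, hx, e⟩
    · rintro ⟨x, hx, rfl⟩
      exact ⟨⟨_, hlt' x hx⟩, ⟨x, hx, rfl⟩, rfl⟩
  · rw [← hP.2.2.2.card, ← hR]
    symm
    refine Finset.card_bij (fun x hx => (⟨_, hlt' x hx⟩ : Fin m)) ?_ ?_ ?_
    · intro x hx
      simp only [Finset.mem_filter, Finset.mem_univ, true_and]
      exact ⟨x, hx, rfl⟩
    · intro x hx y hy e
      have h1 := hRm x hx
      have h2 := hRm y hy
      have := hD.X.inj (I.m - x) (I.m - y) (by omega) (by omega) (by simpa using e)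
      omega
    · intro j hj
      obtain ⟨x, hx, e⟩ := (Finset.mem_filter.1 hj).2
      exact ⟨x, hx, Fin.ext e⟩

end Points

end MaxDominance

namespace MaxDominance

/-! ### The algorithm -/

/-- The algorithm. -/
def solve : Prog := .seq prepare (.seq rounds output)

lemma solve_spec {W s n m k : ℕ} (hk : 1 ≤ k) (p : Fin n → ℝ × ℝ) (w : Fin n → ℝ)
    (q : Fin m → ℝ × ℝ) (hs : n + 4 * (m + 2) ≤ s) (hsW : s < W) (hmW : (m + 1) * (m + 1) < W)
    (hkW : 2 * (k + 1) < W) :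
    wp W s solve (input p w q k) fun t σ' => IsSolution p w q k σ' ∧
      ∃ h K, 2 ^ h < 2 * (m + 2) ∧ K ≤ 2 * (k + 1) ∧
        t ≤ 146 * (2 ^ h * (h + 1)) + 14 * (n * (h + 2)) + 13 * n + 2 * K + 40 +
          362 * (K * ((min n ((m + 1) * (m + 1)) + 2 ^ h) * (h + 1))) := by
  unfold solve
  rw [wp_seq]
  refine wp_mono (prepare_spec (n := n) (m := m) (k := k) (by simp [input]) (by simp [input])
    (by simp [input]) (by simp [input]) (by simp [input]) (fun A _ => by simp [input])
    (by simp [input]) hs hsW hmW hkW) ?_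
  rintro t₁ σ₁ ⟨I, h, i, hp, ht₁⟩
  -- Since `k ≥ 1`, there are at least two layers, so at least one round runs and records the value.
  obtain ⟨i, rfl⟩ : ∃ j, i = j + 1 := by
    cases i with
    | zero => have := hp.le_i; simp at this; omega
    | succ j => exact ⟨j, rfl⟩
  have hV := hp.env.valid
  have hm := hp.m_eq
  have hi1 := hp.le_i
  have hi2 := hp.i_lt
  have hD := hp.desc
  rw [wp_seq]
  refine wp_call (rounds_spec hp.env hp.w38 hp.w41 hp.w31 (by rw [hm]; exact hp.nx_zero)
    (fun y _ => by rw [hm]; exact hp.nx y) (fun y _ => by rw [hp.tag]; omega) (by omega)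
    (by omega)) ?_
  rintro t₂ σ₂ ⟨ht₂, ⟨l, hP, hlen, hl⟩, -, hmax⟩ hF₂
  obtain ⟨d, l, rfl⟩ : ∃ d l', l = d :: l' := by
    cases l with
    | nil => exact absurd (show (0 : ℕ) = I.m + 1 from hP) (by omega)
    | cons d l' => exact ⟨d, l', rfl⟩
  have hE₂ : Env I h W s σ₂ := hp.env.frame hF₂ (by decide) (by decide) (by decide) (by decide)
  have x₂ : σ₂.warr 2 = σ₁.warr 2 := hF₂.wa 2 (by decide)
  refine wp_call (output_spec hE₂ hP (by rw [x₂]; exact hD.X.lt)) ?_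
  rintro t₃ σ₃ ⟨ht₃, h0, him⟩ hF₃
  have r₃ : σ₃.real 0 = σ₂.real 0 := hF₃.r 0 (by decide)
  obtain ⟨S, hS1, hS2, hS3⟩ := hD.solution hV hm hP
  simp only [List.length_cons] at hlen
  have hSk : S.card ≤ k := by omega
  have hval : σ₃.real 0 = weight p w (domUnion (q '' S)) := by rw [r₃, hl, hS2]
  refine ⟨⟨S, hSk, by rw [h0, hS1], by rw [hS1, him, hS3, x₂], hval, ⟨S, hSk, hval⟩, fun v hv => ?_⟩,
    h, 2 ^ (i + 1), hp.h_lt, hi2.le, ?_⟩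
  · rw [r₃]
    exact hmax v (hD.reach hV hm hi1 hv)
  · rw [hp.np_eq] at ht₂
    have : 2 ^ h ≤ 2 ^ h * (h + 1) := Nat.le_mul_of_pos_right _ (by omega)
    linarith only [ht₁, ht₂, ht₃, this]

/-- With M = max m 2 the hypothesis gives 2^h ≤ 4M, hence (h + 2) log 2 ≤ 4 log 2 + log M ≤ 5 log M;
finally log 2 > 1/2. -/
lemma log_height_le {m h : ℕ} (hh : 2 ^ h < 2 * (m + 2)) :
    (h : ℝ) + 2 ≤ 10 * Real.log (max (m : ℝ) 2) := by
  set M := max (m : ℝ) 2 with hM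
  have h1 : (m : ℝ) ≤ M := le_max_left _ _
  have h2 : (2 : ℝ) ≤ M := le_max_right _ _
  have h3 : (2 : ℝ) ^ h ≤ 2 ^ 2 * M := by
    have : ((2 ^ h : ℕ) : ℝ) < ((2 * (m + 2) : ℕ) : ℝ) := by exact_mod_cast hh
    push_cast at this
    linarith
  have h4 := Real.log_le_log (by positivity) h3
  rw [Real.log_mul (by positivity) (by positivity), Real.log_pow, Real.log_pow] at h4
  have h5 := Real.log_le_log (by norm_num) h2
  have h6 := Real.log_two_gt_d9
  push_cast at h4
  have h7 : (h : ℝ) * Real.log 2 + 2 * Real.log 2 ≤ 5 * Real.log M := by linarith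
  nlinarith

/-- From K ≤ 4k and 2^h ≤ 6m the time is O((n + k (np + m)) (h + 2)). If n + m attains the minimum,
`np ≤ n` is used; otherwise `np ≤ 4 m²`, and k · (n/k) = n pays for the preparation. -/
lemma time_bound {n m k h K t : ℕ} (hm : 1 ≤ m) (hk : 1 ≤ k) (hh : 2 ^ h < 2 * (m + 2))
    (hK : K ≤ 2 * (k + 1))
    (ht : t ≤ 146 * (2 ^ h * (h + 1)) + 14 * (n * (h + 2)) + 13 * n + 2 * K + 40 +
      362 * (K * ((min n ((m + 1) * (m + 1)) + 2 ^ h) * (h + 1)))) :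
    (t : ℝ) ≤ 160000 * (k * min ((n : ℝ) + m) ((n : ℝ) / k + (m : ℝ) ^ 2)
      * Real.log (max (m : ℝ) 2)) := by
  set np := min n ((m + 1) * (m + 1)) with hnp
  have hK4 : K ≤ 4 * k := by omega
  have hh6 : 2 ^ h ≤ 6 * m := by omega
  have hnat : t ≤ (27 * n + k * (1448 * np + 9700 * m)) * (h + 2) := by
    have hmk : m ≤ k * m := Nat.le_mul_of_pos_left _ hk
    have hk' : k ≤ k * m := Nat.le_mul_of_pos_right _ hm
    have e1 : 2 ^ h * (h + 1) ≤ 6 * (k * m) * (h + 2) :=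
      Nat.mul_le_mul (by omega) (by omega)
    have e2 : K * ((np + 2 ^ h) * (h + 1)) ≤ (4 * k) * ((np + 6 * m) * (h + 2)) :=
      Nat.mul_le_mul hK4 (Nat.mul_le_mul (by omega) (by omega))
    have e3 : n ≤ n * (h + 2) := Nat.le_mul_of_pos_right _ (by omega)
    have e4 : k * m ≤ k * m * (h + 2) := Nat.le_mul_of_pos_right _ (by omega)
    have e5 : 1 ≤ k * m := Nat.mul_pos hk hm
    have : (27 * n + k * (1448 * np + 9700 * m)) * (h + 2) =
        27 * (n * (h + 2)) + 362 * ((4 * k) * ((np + 6 * m) * (h + 2))) +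
          1012 * (k * m * (h + 2)) := by ring
    have e6 : 6 * (k * m) * (h + 2) = 6 * (k * m * (h + 2)) := by ring
    omega
  have hlog := log_height_le hh
  have hkR : (1 : ℝ) ≤ k := by exact_mod_cast hk
  have hmR : (1 : ℝ) ≤ m := by exact_mod_cast hm
  have hnR : (0 : ℝ) ≤ n := Nat.cast_nonneg n
  have hnp1 : (np : ℝ) ≤ n := by exact_mod_cast min_le_left _ _
  have hnp2 : (np : ℝ) ≤ 4 * (m : ℝ) ^ 2 := by
    have : np ≤ (m + 1) * (m + 1) := min_le_right _ _
    have : (np : ℝ) ≤ ((m : ℝ) + 1) * (m + 1) := by exact_mod_cast this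
    nlinarith
  have hZ : 27 * (n : ℝ) + k * (1448 * np + 9700 * m) ≤
      16000 * (k * min ((n : ℝ) + m) ((n : ℝ) / k + (m : ℝ) ^ 2)) := by
    rcases min_cases ((n : ℝ) + m) ((n : ℝ) / k + (m : ℝ) ^ 2) with ⟨e, _⟩ | ⟨e, _⟩
    · rw [e]
      have h1 : (n : ℝ) ≤ k * n := by nlinarith
      have h2 : (k : ℝ) * np ≤ k * n := by gcongr
      have h3 : 0 ≤ (k : ℝ) * m := by positivity
      nlinarith
    · rw [e]
      have h1 : (k : ℝ) * ((n : ℝ) / k + (m : ℝ) ^ 2) = n + k * (m : ℝ) ^ 2 := by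
        field_simp
      have h2 : (k : ℝ) * np ≤ k * (4 * (m : ℝ) ^ 2) := by gcongr
      have h3 : (k : ℝ) * m ≤ k * (m : ℝ) ^ 2 := by
        gcongr
        nlinarith
      rw [h1]
      nlinarith
  have htR : (t : ℝ) ≤ (27 * n + k * (1448 * np + 9700 * m)) * ((h : ℝ) + 2) := by
    exact_mod_cast hnat
  have h0 : 0 ≤ 27 * (n : ℝ) + k * (1448 * np + 9700 * m) := by positivity
  calc (t : ℝ) ≤ (27 * n + k * (1448 * np + 9700 * m)) * ((h : ℝ) + 2) := htR
    _ ≤ (16000 * (k * min ((n : ℝ) + m) ((n : ℝ) / k + (m : ℝ) ^ 2))) *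
        (10 * Real.log (max (m : ℝ) 2)) := by
      refine mul_le_mul hZ hlog (by positivity) (h0.trans hZ)
    _ = _ := by ring

end MaxDominance

/-- One program and one constant `C` serve all inputs. `log m` is read as `log 2` for `m = 1`.
Words have `O(log (n + m + k))` bits. -/
theorem mainTheorem1 :
    ∃ (c : RealRAM.Prog) (C : ℕ), ∀ (n m k : ℕ), 1 ≤ m → 1 ≤ k →
      ∀ (p : Fin n → ℝ × ℝ) (w : Fin n → ℝ) (q : Fin m → ℝ × ℝ),
        ∃ (s t : ℕ) (σ : RealRAM.State),
          RealRAM.Run ((n + m + k + 2) ^ C) s c (MaxDominance.input p w q k) t σ ∧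
          MaxDominance.IsSolution p w q k σ ∧
          (t : ℝ) ≤ C * (k * min ((n : ℝ) + m) ((n : ℝ) / k + (m : ℝ) ^ 2)
            * Real.log (max (m : ℝ) 2)) ∧
          c.space s ≤ C * (n + m) := by
  -- One constant serves as time factor, as space factor and as exponent of the word size; the
  -- program is fixed, so its numbers of registers and arrays are constants.
  obtain ⟨C, hC1, hC2⟩ : ∃ C, 160000 ≤ C ∧
      MaxDominance.solve.registers.card + 12 * MaxDominance.solve.arrays.card ≤ C :=
    ⟨_, le_max_left _ _, le_max_right _ _⟩
  refine ⟨MaxDominance.solve, C, fun n m k hm hk p w q => ?_⟩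
  set B := n + m + k + 2 with hB
  have hW : B ^ 3 ≤ B ^ C := Nat.pow_le_pow_right (by omega) (by omega)
  have hB3 : 4 * (B * B) ≤ B ^ 3 := by
    rw [show B ^ 3 = B * (B * B) by ring]
    exact Nat.mul_le_mul_right _ (by omega)
  have hB2 : 4 * B ≤ B * B := Nat.mul_le_mul_right _ (by omega)
  have hmB : (m + 1) * (m + 1) ≤ B * B := Nat.mul_le_mul (by omega) (by omega)
  -- The trees need 2^(h+1) < 4 (m + 2) cells and the input and the cells of points at most n; one
  -- common length covers both and is at most 12 (n + m), as m ≥ 1.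
  obtain ⟨t, σ, hrun, hsol, h, K, hh, hK, ht⟩ := MaxDominance.solve_spec (W := B ^ C)
    (s := n + 4 * (m + 2)) hk p w q le_rfl (by omega) (by omega) (by omega)
  refine ⟨_, t, σ, hrun, hsol, (MaxDominance.time_bound hm hk hh hK ht).trans ?_, ?_⟩
  · have h1 : 0 ≤ Real.log (max (m : ℝ) 2) := Real.log_nonneg (by simp)
    have h2 : (160000 : ℝ) ≤ C := by exact_mod_cast hC1
    gcongr
  · unfold RealRAM.Prog.space
    calc MaxDominance.solve.registers.card + MaxDominance.solve.arrays.card * (n + 4 * (m + 2))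
        ≤ MaxDominance.solve.registers.card * (n + m) +
          MaxDominance.solve.arrays.card * (12 * (n + m)) :=
          add_le_add (Nat.le_mul_of_pos_right _ (by omega)) (Nat.mul_le_mul_left _ (by omega))
      _ = (MaxDominance.solve.registers.card + 12 * MaxDominance.solve.arrays.card) * (n + m) := by
          ring
      _ ≤ C * (n + m) := Nat.mul_le_mul_right _ hC2
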